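/- **Machines.** A Turing machine $(\Gamma,Q,\Delta)$ has a table $\Delta$ of move transitions $(q,\delta,q')$, $\delta\in\{+1,-1\}$ (change the state $q$ to $q'$ and move the head by $\delta$), and matching transitions $(q,a,q',b)$ (in state $q$ reading $a$, write $b$ and enter $q'$). It is complete deterministic if for each $(q,a)$ exactly one transition applies, and reversible if it and its reverse are. A reversible machine acts bijectively on bi-infinite tapes, and on cyclic tapes of length $\ell\ge 2$, containing at most one head (tapes without head are fixed); $T_\ell$ denotes the latter action, on the set $\mathcal C_\ell$. The SMART machine has the tape alphabet $\{0,1,2\}$, the eight states $\blacktriangleright_i,\blacktriangleleft_i,\rhd_i,\lhd_i$ ($i=1,2$) and the transitions $(\blacktriangleright_2,+1,\blacktriangleright_1)$, $(\blacktriangleleft_2,-1,\blacktriangleleft_1)$, $(\rhd_2,+1,\rhd_1)$, $(\lhd_2,-1,\lhd_1)$, and, writing $q\xrightarrow{a|b}q'$ for $(q,a,q',b)$, $\blacktriangleright_1\xrightarrow{0|1}\blacktriangleleft_2$, $\blacktriangleright_1\xrightarrow{1|1,\;2|2}\lhd_2$, $\blacktriangleleft_1\xrightarrow{0|1}\blacktriangleright_2$,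 $\blacktriangleleft_1\xrightarrow{1|1,\;2|2}\rhd_2$, $\rhd_1\xrightarrow{0|2,\;1|0}\blacktriangleright_2$, $\rhd_1\xrightarrow{2|0}\lhd_2$, $\lhd_1\xrightarrow{0|2,\;1|0}\blacktriangleleft_2$, $\lhd_1\xrightarrow{2|0}\rhd_2$. The decorated SMART machine $\mathcal S$ has the states $q\in Q$ of SMART replaced by $(q,d,x)$ with $d\in\{d_0,d_1\}$ and $x\in\{0,\dots,5\}$, where $d$ and $x$ are carried along without being read or modified. **Conveyor belts.** Let $\Sigma=(\Gamma^2\times\{+1,-1\})\sqcup((Q\times\Gamma)\times\Gamma)\sqcup(\Gamma\times(Q\times\Gamma))$. Each $x\in\Sigma^{\mathbb Z}$ splits uniquely into maximal (possibly infinite) words that consist either of cells with bit $+1$, one cell with a head, and cells with bit $-1$, in this order, or of cells with bit $+1$ followed by cells with bit $-1$. For a reversible machine $\mathcal M$, $f_{\mathcal M}\in\mathrm{Aut}(\Sigma^{\mathbb Z})$ fixes words without head, and acts on a word with a head by one step of $\mathcal M$, the word being viewed as a cyclic tape (top track from left to right, then bottom track from right to left), with the bits afterwards reset to $+1$ to the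 left and $-1$ to the right of the head. **Group.** For $\ell\ge2$ let $\mathcal G_\ell\le\mathrm{Sym}(\mathcal C_\ell)$ be the group generated by the unary gates $\pi_g$, $g\in\mathrm{Sym}(Q\times\Gamma)$, which apply $g$ to the head, and the state-dependent moves $\rho_q$, $q\in Q$, which move the head one cell to the right if its state is $q$. Its word norm is taken with respect to these generators and their inverses. **Lemma.** Let $\mathcal S$ be the decorated SMART machine. 1. $f_{\mathcal S}$ has infinite order. 2. Let $m(n)$ be the maximal number of cells that the head of $\mathcal S$ can visit in $n$ steps on a bi-infinite tape. There is $C'>0$ such that $m(n)\le\frac{\ln 2}{\ln 3}\log_2 n+C'$ for all $n\ge1$. 3. There is a constant $K$ such that, for all $\ell\ge2$ and $n\ge0$, $T_\ell^{\,n}\in\mathcal G_\ell$ and its word norm in $\mathcal G_\ell$ is at most $K\ell^4$. -/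

import Mathlib

/-! ## Turing machines whose transitions either move the head or rewrite the current letter -/

namespace TM

/-- The two directions `+1` and `-1` of the tape. -/
inductive Dir
  | right
  | left

/-- The integer `+1` or `-1`. -/
def Dir.val : Dir → ℤ
  | .right => 1
  | .left => -1

def Dir.rev : Dir → Dir
  | .right => .left
  | .left => .right

/-- `move q δ q'` is the move transition `(q, δ, q')`;
`write q a q' b` is the matching transition `(q, a, q', b)`. -/
inductive Transition (Q Γ : Type)
  | move (q : Q) (δ : Dir) (q' : Q)
  | write (q : Q) (a : Γ) (q' : Q) (b : Γ)

/-- The transition can be used by a head in state `q` that reads the letter `a`. -/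
def Transition.Applies {Q Γ : Type} : Transition Q Γ → Q → Γ → Prop
  | .move p _ _, q, _ => p = q
  | .write p c _ _, q, a => p = q ∧ c = a

/-- The reverse of a transition. -/
def Transition.rev {Q Γ : Type} : Transition Q Γ → Transition Q Γ
  | .move q δ q' => .move q' δ.rev q
  | .write q a q' b => .write q' b q a

/-- A Turing machine with state set `Q` and tape alphabet `Γ` is given by its transition table. -/
structure Machine (Q Γ : Type) where
  Δ : Set (Transition Q Γ)

variable {Q Γ : Type}

/-- The reverse machine. -/
def Machine.inv (M : Machine Q Γ) : Machine Q Γ := ⟨{t | t.rev ∈ M.Δ}⟩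

/-- Exactly one transition applies at any time. -/
def Machine.CompleteDeterministic (M : Machine Q Γ) : Prop :=
  ∀ q a, ∃! t, t ∈ M.Δ ∧ t.Applies q a

def Machine.Reversible (M : Machine Q Γ) : Prop :=
  M.CompleteDeterministic ∧ M.inv.CompleteDeterministic

theorem Transition.rev_rev (t : Transition Q Γ) : t.rev.rev = t := by
  rcases t with ⟨q, _ | _, q'⟩ | ⟨q, a, q', b⟩ <;> rfl

theorem Machine.inv_inv (M : Machine Q Γ) : M.inv.inv = M := by
  cases M; simp [Machine.inv, Transition.rev_rev]

theorem Machine.Reversible.inv {M : Machine Q Γ} (hM : M.Reversible) : M.inv.Reversible :=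
  ⟨hM.2, by rw [M.inv_inv]; exact hM.1⟩

/-! ## Tapes with at most one head, and the action of machines on them -/

/-- A cell holds a tape letter (`Sum.inl`), or a head: a state together with a letter
(`Sum.inr`). -/
abbrev Symbol (Q Γ : Type) := Γ ⊕ (Q × Γ)

/-- The tape letter in a cell. -/
def Symbol.letter : Symbol Q Γ → Γ
  | .inl a => a
  | .inr (_, a) => a

/-- Tapes with cells indexed by `P`, containing at most one head. `P = ℤ` gives the bi-infinite
tapes, `P = ZMod ℓ` the cyclic tapes of length `ℓ`. -/
def Tape (P Q Γ : Type) :=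
  {x : P → Symbol Q Γ // ∀ i j, i ≠ j → (x i).isLeft ∨ (x j).isLeft}

variable {P : Type}

def Tape.HeadAt (x : Tape P Q Γ) (i : P) : Prop := (x.1 i).isRight

/-- One step of computation: a tape without head is fixed; otherwise the head uses an applicable
transition. -/
def Machine.Step [Ring P] (M : Machine Q Γ) (x x' : Tape P Q Γ) : Prop :=
  ((∀ i, ¬ x.HeadAt i) ∧ x' = x) ∨
  ∃ i₀ q a, x.1 i₀ = .inr (q, a) ∧
    ((∃ q' b, .write q a q' b ∈ M.Δ ∧
        x'.1 i₀ = .inr (q', b) ∧ ∀ i, i ≠ i₀ → x'.1 i = x.1 i) ∨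
     (∃ δ q', .move q δ q' ∈ M.Δ ∧
        x'.1 i₀ = .inl a ∧
        x'.1 (i₀ + (δ.val : P)) = .inr (q', (x.1 (i₀ + (δ.val : P))).letter) ∧
        ∀ i, i ≠ i₀ → i ≠ i₀ + (δ.val : P) → x'.1 i = x.1 i))

theorem Tape.head_unique (x : Tape P Q Γ) {i j : P} {h k : Q × Γ}
    (hi : x.1 i = .inr h) (hj : x.1 j = .inr k) : i = j := by
  by_contra hne
  have := x.2 i j hne
  simp [hi, hj] at this

theorem Tape.eq_inl (x : Tape P Q Γ) {i j : P} {h : Q × Γ}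
    (hi : x.1 i = .inr h) (hj : j ≠ i) : x.1 j = .inl (x.1 j).letter := by
  rcases hx : x.1 j with a | k
  · rfl
  · exact absurd (x.head_unique hx hi) hj

theorem Dir.val_ne_zero [Ring P] [Nontrivial P] (δ : Dir) : ((δ.val : ℤ) : P) ≠ 0 := by
  cases δ <;> simp [Dir.val]

theorem Dir.val_rev (δ : Dir) : δ.rev.val = - δ.val := by
  cases δ <;> rfl

theorem Machine.step_exists [Ring P] [Nontrivial P] {M : Machine Q Γ}
    (hM : M.CompleteDeterministic) (x : Tape P Q Γ) : ∃ x', M.Step x x' := by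
  classical
  by_cases hx : ∀ i, ¬ x.HeadAt i
  · exact ⟨x, .inl ⟨hx, rfl⟩⟩
  · push Not at hx
    obtain ⟨i₀, hi₀⟩ := hx
    obtain ⟨⟨q, a⟩, h⟩ := Sum.isRight_iff.1 hi₀
    obtain ⟨t, ⟨ht, hta⟩, -⟩ := hM q a
    have hl : ∀ j, j ≠ i₀ → (x.1 j).isLeft := fun j hj => by rw [x.eq_inl h hj]; rfl
    rcases t with ⟨p, δ, q'⟩ | ⟨p, c, q', b⟩
    · obtain rfl : p = q := hta
      have hδ : i₀ + ((δ.val : ℤ) : P) ≠ i₀ := by simpa using δ.val_ne_zero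
      refine ⟨⟨fun i => if i = i₀ then .inl a else
        if i = i₀ + ((δ.val : ℤ) : P) then
          .inr (q', (x.1 (i₀ + ((δ.val : ℤ) : P))).letter) else x.1 i, ?_⟩, ?_⟩
      · intro i j hij
        dsimp only
        split_ifs <;> simp_all
      · refine .inr ⟨i₀, p, a, h, .inr ⟨δ, q', ht, by simp, by simp [hδ], ?_⟩⟩
        intro i h1 h2
        simp [h1, h2]
    · obtain ⟨rfl, rfl⟩ : p = q ∧ c = a := hta
      refine ⟨⟨fun i => if i = i₀ then .inr (q', b) else x.1 i, ?_⟩, ?_⟩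
      · intro i j hij
        dsimp only
        split_ifs <;> simp_all
      · refine .inr ⟨i₀, p, c, h, .inl ⟨q', b, ht, by simp, ?_⟩⟩
        intro i h1
        simp [h1]

theorem Machine.step_unique [Ring P] {M : Machine Q Γ}
    (hM : M.CompleteDeterministic) {x y z : Tape P Q Γ} (hy : M.Step x y) (hz : M.Step x z) :
    y = z := by
  rcases hy with ⟨hx, rfl⟩ | ⟨i, q, a, h, hy⟩
  · rcases hz with ⟨-, rfl⟩ | ⟨i, q, a, h, -⟩
    · rfl
    · exact absurd (by simp [Tape.HeadAt, h]) (hx i)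
  · rcases hz with ⟨hx, -⟩ | ⟨i', q', a', h', hz⟩
    · exact absurd (by simp [Tape.HeadAt, h]) (hx i)
    · obtain rfl := x.head_unique h h'
      rw [h] at h'
      obtain ⟨rfl, rfl⟩ : q = q' ∧ a = a' := by simpa using h'
      have key : ∀ t t', _ → _ → t = t' := fun t t' => (hM q a).unique (y₁ := t) (y₂ := t')
      rcases hy with ⟨p, b, ht, hy1, hy2⟩ | ⟨δ, p, ht, hy1, hy2, hy3⟩ <;>
      rcases hz with ⟨p', b', ht', hz1, hz2⟩ | ⟨δ', p', ht', hz1, hz2, hz3⟩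
      · have := key _ _ ⟨ht, rfl, rfl⟩ ⟨ht', rfl, rfl⟩
        simp only [Transition.write.injEq] at this
        obtain ⟨-, -, rfl, rfl⟩ := this
        refine Subtype.ext (funext fun j => ?_)
        by_cases hj : j = i
        · rw [hj, hy1, hz1]
        · rw [hy2 j hj, hz2 j hj]
      · exact absurd (key _ _ ⟨ht, rfl, rfl⟩ ⟨ht', rfl⟩) (by simp)
      · exact absurd (key _ _ ⟨ht, rfl⟩ ⟨ht', rfl, rfl⟩) (by simp)
      · have := key _ _ ⟨ht, rfl⟩ ⟨ht', rfl⟩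
        simp only [Transition.move.injEq] at this
        obtain ⟨-, rfl, rfl⟩ := this
        refine Subtype.ext (funext fun j => ?_)
        by_cases hj : j = i
        · rw [hj, hy1, hz1]
        · by_cases hj' : j = i + ((δ.val : ℤ) : P)
          · rw [hj', hy2, hz2]
          · rw [hy3 j hj hj', hz3 j hj hj']

theorem Machine.Step.rev [Ring P] [Nontrivial P] {M : Machine Q Γ} {x y : Tape P Q Γ}
    (h : M.Step x y) : M.inv.Step y x := by
  rcases h with ⟨hx, rfl⟩ | ⟨i, q, a, h, ⟨q', b, ht, h1, h2⟩ | ⟨δ, q', ht, h1, h2, h3⟩⟩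
  · exact .inl ⟨hx, rfl⟩
  · exact .inr ⟨i, q', b, h1, .inl ⟨q, a, ht, h, fun j hj => (h2 j hj).symm⟩⟩
  · have hδ : i + ((δ.val : ℤ) : P) ≠ i := by simpa using δ.val_ne_zero
    have hi : i + ((δ.val : ℤ) : P) + ((δ.rev.val : ℤ) : P) = i := by
      rw [Dir.val_rev]; push_cast; abel
    refine .inr ⟨_, q', _, h2, .inr ⟨δ.rev, q, ?_, ?_, ?_, ?_⟩⟩
    · change Transition.move q δ.rev.rev q' ∈ M.Δ
      cases δ <;> exact ht
    · exact x.eq_inl h hδ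
    · rw [hi, h, h1]; rfl
    · intro j hj hj'
      rw [hi] at hj'
      exact (h3 j hj' hj).symm

/-- The bijection `T` of the set of tapes defined by a reversible machine: `T x` is the unique
tape that is reached from `x` in one step. -/
noncomputable def Machine.Reversible.action [Ring P] [Nontrivial P] {M : Machine Q Γ}
    (hM : M.Reversible) : Equiv.Perm (Tape P Q Γ) where
  toFun x := (M.step_exists hM.1 x).choose
  invFun x := (M.inv.step_exists hM.2 x).choose
  left_inv x := M.inv.step_unique hM.2 (M.inv.step_exists hM.2 _).choose_spec
    (M.step_exists hM.1 x).choose_spec.rev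
  right_inv x := by
    have h := (M.inv.step_exists hM.2 x).choose_spec.rev
    rw [M.inv_inv] at h
    exact M.step_unique hM.1 (M.step_exists hM.1 _).choose_spec h

/-! ## The movement function -/

/-- The lengths of the intervals of cells all of whose cells are visited by the head during some
computation of `n` steps on a bi-infinite tape. -/
def Machine.visitedLengths (M : Machine Q Γ) (n : ℕ) : Set ℕ :=
  {k | ∃ (l : ℤ) (x : ℕ → Tape ℤ Q Γ), (∀ j < n, M.Step (x j) (x (j + 1))) ∧
    ∀ i, l ≤ i → i < l + k → ∃ j ≤ n, (x j).HeadAt i}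

/-- The supremum in the movement function is that of a bounded set. -/
theorem Machine.visitedLengths_bddAbove (M : Machine Q Γ) (n : ℕ) :
    BddAbove (M.visitedLengths n) := by
  refine ⟨n + 1, ?_⟩
  rintro k ⟨l, x, -, h⟩
  have h' : ∀ i : Fin k, ∃ j : Fin (n + 1), (x j).HeadAt (l + i) := fun i => by
    obtain ⟨j, hj, hx⟩ := h (l + i) (by omega) (by omega)
    exact ⟨⟨j, by omega⟩, hx⟩
  choose f hf using h'
  have hinj : Function.Injective f := by
    intro a b hab
    have ha := hf a
    have hb := hf b
    rw [hab] at ha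
    obtain ⟨_, ha⟩ := Sum.isRight_iff.1 ha
    obtain ⟨_, hb⟩ := Sum.isRight_iff.1 hb
    have := (x (f b)).head_unique ha hb
    ext; omega
  simpa using Fintype.card_le_of_injective f hinj

/-- The movement function `m`: the maximal number of cells the machine can visit in `n` steps. -/
noncomputable def Machine.movement (M : Machine Q Γ) (n : ℕ) : ℕ := sSup (M.visitedLengths n)

/-! ## Unary gates, state-dependent moves, and the group they generate -/

/-- The unary gate `π_g`, which applies `g` to the head. -/
def gate (g : Equiv.Perm (Q × Γ)) : Equiv.Perm (Tape P Q Γ) where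
  toFun x := ⟨fun j => (x.1 j).map id g, fun i j h => by simpa using x.2 i j h⟩
  invFun x := ⟨fun j => (x.1 j).map id g.symm, fun i j h => by simpa using x.2 i j h⟩
  left_inv x := Subtype.ext (funext fun j => by simp)
  right_inv x := Subtype.ext (funext fun j => by simp)

/-- The cell holds a head in state `q`. -/
def Symbol.HasState (q : Q) (s : Symbol Q Γ) : Prop := ∃ a, s = .inr (q, a)

open Classical in
/-- The contents of the tape after the head, if it is in state `q`, has moved by `s` cells. -/
noncomputable def stateMoveFun [Ring P] (q : Q) (s : P) (w : P → Symbol Q Γ) (j : P) :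
    Symbol Q Γ :=
  if (w (j - s)).HasState q then .inr (q, (w j).letter)
  else if (w j).HasState q then .inl (w j).letter
  else w j

theorem stateMoveFun_mem [Ring P] (q : Q) (s : P) (x : Tape P Q Γ) (i j : P) (hij : i ≠ j) :
    (stateMoveFun q s x.1 i).isLeft ∨ (stateMoveFun q s x.1 j).isLeft := by
  have key : ∀ i, (stateMoveFun q s x.1 i).isLeft ∨ (∃ a, x.1 (i - s) = .inr (q, a)) ∨
      (∃ h, x.1 i = .inr h ∧ h.1 ≠ q) := by
    intro i
    unfold stateMoveFun
    split_ifs with h1 h2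
    · exact .inr (.inl h1)
    · exact .inl rfl
    · rcases hx : x.1 i with a | ⟨p, a⟩
      · exact .inl rfl
      · refine .inr (.inr ⟨_, rfl, ?_⟩)
        rintro rfl
        exact h2 ⟨a, hx⟩
  rcases key i with h | ⟨a, h⟩ | ⟨h, h, hq⟩
  · exact .inl h
  · rcases key j with h' | ⟨a', h'⟩ | ⟨h', h', hq'⟩
    · exact .inr h'
    · exact absurd (by simpa using x.head_unique h h') hij
    · obtain rfl := x.head_unique h h'
      rw [h] at h'
      obtain rfl := Sum.inr.inj h'
      exact absurd rfl hq'
  · rcases key j with h' | ⟨a', h'⟩ | ⟨h', h', hq'⟩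
    · exact .inr h'
    · have := x.head_unique h h'
      rw [this, h'] at h
      obtain rfl := Sum.inr.inj h
      exact absurd rfl hq
    · exact absurd (x.head_unique h h') hij

theorem stateMoveFun_neg [Ring P] (q : Q) (s : P) (hs : s ≠ 0) (x : Tape P Q Γ) :
    stateMoveFun q (-s) (stateMoveFun q s x.1) = x.1 := by
  have hl : ∀ (w : P → Symbol Q Γ) j, (stateMoveFun q s w j).letter = (w j).letter := by
    intro w j
    unfold stateMoveFun
    split_ifs <;> rfl
  have hstate : ∀ j, (stateMoveFun q s x.1 j).HasState q ↔ (x.1 (j - s)).HasState q := by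
    intro j
    unfold stateMoveFun
    split_ifs with h1 h2
    · exact iff_of_true ⟨_, rfl⟩ h1
    · exact iff_of_false (by simp [Symbol.HasState]) h1
    · simp [h1, h2]
  funext j
  rw [stateMoveFun, hl, hstate, hstate]
  have e : j - -s - s = j := by abel
  rw [e]
  split_ifs with h1 h2
  · obtain ⟨a, h⟩ := h1
    rw [h]; rfl
  · obtain ⟨a, h⟩ := h2
    exact (x.eq_inl h (fun h' => hs (by simpa using h'.symm))).symm
  · simp [stateMoveFun, h1, h2]

/-- The state-dependent right move `ρ_q`, which moves the head one cell to the right if its state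
is `q`. -/
noncomputable def stateMove [Ring P] [Nontrivial P] (q : Q) : Equiv.Perm (Tape P Q Γ) where
  toFun x := ⟨stateMoveFun q 1 x.1, stateMoveFun_mem q 1 x⟩
  invFun x := ⟨stateMoveFun q (-1) x.1, stateMoveFun_mem q (-1) x⟩
  left_inv x := Subtype.ext (stateMoveFun_neg q 1 one_ne_zero x)
  right_inv x := Subtype.ext (by
    simpa using stateMoveFun_neg q (-1) (neg_ne_zero.2 one_ne_zero) x)

/-- The unary gates and the state-dependent moves. -/
def instructions (P Q Γ : Type) [Ring P] [Nontrivial P] : Set (Equiv.Perm (Tape P Q Γ)) :=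
  Set.range gate ∪ Set.range stateMove

/-- The group `𝒢_ℓ` of permutations of the cyclic tapes of length `ℓ ≥ 2`. -/
def cyclicGroup (ℓ : ℕ) [Fact (1 < ℓ)] (Q Γ : Type) : Subgroup (Equiv.Perm (Tape (ZMod ℓ) Q Γ)) :=
  Subgroup.closure (instructions (ZMod ℓ) Q Γ)

/-- The word norm of `g` relative to `S`: the length of a shortest word over `S ∪ S⁻¹` with
product `g` (meaningful for `g` in the group generated by `S`). -/
noncomputable def wordNorm {G : Type} [Group G] (S : Set G) (g : G) : ℕ :=
  sInf {n | ∃ w : List G, (∀ s ∈ w, s ∈ S ∨ s⁻¹ ∈ S) ∧ w.prod = g ∧ w.length = n}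

/-! ## The action of a machine on conveyor belts in a full shift -/

/-- The two tracks of a conveyor belt. -/
inductive Track
  | top
  | bot
  deriving DecidableEq

def Track.flip : Track → Track
  | .top => .bot
  | .bot => .top

/-- The direction of the full shift in which a head on the given track goes when it moves in
direction `δ` along its belt: a belt runs to the right on the top track and to the left on the
bottom track. -/
def Track.dir : Track → Dir → Dir
  | .top, δ => δ
  | .bot, δ => δ.rev

/-- The alphabet `(Γ² × {+1,-1}) ⊔ ((Q × Γ) × Γ) ⊔ (Γ × (Q × Γ))`. Every cell holds a pair `u` of
letters, one on each track, and moreover either a conveyor bit, or a head (a state) on one of the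
two tracks. -/
inductive BeltCell (Q Γ : Type)
  | bit (u : Track → Γ) (ε : Dir)
  | head (τ : Track) (q : Q) (u : Track → Γ)

/-- The transition of a complete deterministic machine that applies at state `q` and
letter `a`. -/
noncomputable def Machine.CompleteDeterministic.trans {M : Machine Q Γ}
    (hM : M.CompleteDeterministic) (q : Q) (a : Γ) : Transition Q Γ := (hM q a).choose

open Classical in
/-- One simultaneous step of all heads of `y`, where `tr q a` is the transition that applies at
state `q` and letter `a`.

The configuration `y` splits uniquely into maximal words of the forms `(+1)* head (-1)*` and
`(+1)⁺ (-1)⁺`. A word of the first form is a cyclic tape, the top track read from left to right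
followed by the bottom track read from right to left, on which its head acts; a word of the second
form is not changed. The neighbour of a head in direction `d` lies in the same word exactly if it
carries the bit opposite to `d`. If it does not, then a head that moves in direction `d` turns
around the end of the belt: it stays in its column and changes track. If it does, the head moves to
that neighbour, which loses its bit, and the column that the head leaves gets the bit `d`, so that
bits still point to the head and the splitting into words is preserved. -/
noncomputable def beltStep (tr : Q → Γ → Transition Q Γ) (y : ℤ → BeltCell Q Γ) (i : ℤ) :
    BeltCell Q Γ :=
  match y i with
  | .head τ q u =>
    match tr q (u τ) with
    | .write _ _ q' c => .head τ q' (Function.update u τ c)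
    | .move _ δ q' =>
      if ∃ v, y (i + (τ.dir δ).val) = .bit v (τ.dir δ).rev then .bit u (τ.dir δ)
      else .head τ.flip q' u
  | .bit u ε =>
    match y (i + ε.val) with
    | .head τ q v =>
      match tr q (v τ) with
      | .move _ δ q' => if τ.dir δ = ε.rev then .head τ q' u else .bit u ε
      | .write _ _ _ _ => .bit u ε
    | .bit _ _ => .bit u ε

/-- `tr'` undoes `tr`. -/
def Undoes (tr' tr : Q → Γ → Transition Q Γ) : Prop :=
  (∀ q a p c q' b, tr q a = .write p c q' b → tr' q' b = .write q' b q a) ∧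
  (∀ q a p δ q', tr q a = .move p δ q' → ∀ c, tr' q' c = .move q' δ.rev q)

theorem Dir.rev_rev (d : Dir) : d.rev.rev = d := by cases d <;> rfl

theorem Track.dir_rev (τ : Track) (δ : Dir) : τ.dir δ.rev = (τ.dir δ).rev := by
  cases τ <;> cases δ <;> rfl

theorem Track.flip_dir (τ : Track) (δ : Dir) : τ.flip.dir δ = (τ.dir δ).rev := by
  cases τ <;> cases δ <;> rfl

theorem Track.flip_flip (τ : Track) : τ.flip.flip = τ := by cases τ <;> rfl

theorem beltStep_undo {tr' tr : Q → Γ → Transition Q Γ} (h : Undoes tr' tr)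
    (y : ℤ → BeltCell Q Γ) : beltStep tr' (beltStep tr y) = y := by
  obtain ⟨hw, hm⟩ := h
  have back : ∀ (i : ℤ) (d : Dir), i + d.val + d.rev.val = i := fun i d => by
    rw [Dir.val_rev]; ring
  -- the neighbour in direction `d` points back to a head only if it did so before
  have bitback : ∀ i (d : Dir) τ q u, y i = .head τ q u →
      (∃ v, beltStep tr y (i + d.val) = .bit v d.rev) → ∃ v, y (i + d.val) = .bit v d.rev := by
    rintro i d τ q u hi ⟨v, hv⟩
    rcases hj : y (i + d.val) with ⟨w, ε⟩ | ⟨σ, p, w⟩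
    · unfold beltStep at hv
      rw [hj] at hv
      dsimp only at hv
      split at hv <;> (try split at hv) <;> (try split at hv) <;> simp_all
    · exfalso
      unfold beltStep at hv
      rw [hj] at hv
      dsimp only at hv
      split at hv
      · simp at hv
      · split at hv
        · rename_i hex
          obtain ⟨v', hv'⟩ := hex
          simp only [BeltCell.bit.injEq] at hv
          rw [hv.2, back, hi] at hv'
          simp at hv'
        · simp at hv
  funext i
  rcases hi : y i with ⟨u, ε⟩ | ⟨τ, q, u⟩
  · by_cases hin : ∃ τ q v p δ q', y (i + ε.val) = .head τ q v ∧ tr q (v τ) = .move p δ q' ∧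
        τ.dir δ = ε.rev
    · obtain ⟨τ, q, v, p, δ, q', hj, ht, hd⟩ := hin
      have e1 : beltStep tr y i = .head τ q' u := by
        simp [beltStep, hi, hj, ht, hd]
      have e2 : beltStep tr y (i + ε.val) = .bit v ε.rev := by
        simp [beltStep, hj, ht, hd, back, hi, Dir.rev_rev]
      have ht' := hm _ _ _ _ _ ht (u τ)
      have hd' : τ.dir δ.rev = ε := by rw [Track.dir_rev, hd, Dir.rev_rev]
      rw [beltStep, e1]
      simp [ht', hd', e2]
    · have e1 : beltStep tr y i = .bit u ε := by
        unfold beltStep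
        rw [hi]
        dsimp only
        split
        · split
          · split
            · exact absurd ⟨_, _, _, _, _, _, by assumption, by assumption, by assumption⟩ hin
            · rfl
          · rfl
        · rfl
      rw [beltStep, e1]
      dsimp only
      split
      · rename_i τ q' v hj'
        split
        · rename_i p δ q ht'
          rw [if_neg]
          intro hd
          rcases hj : y (i + ε.val) with ⟨w, η⟩ | ⟨σ, r, w⟩
          · rw [beltStep, hj] at hj'
            dsimp only at hj'
            split at hj'
            · rename_i σ s x hk
              split at hj'
              · rename_i _ δ₁ q₁ ht
                split at hj'
                · rename_i hd₁
                  simp only [BeltCell.head.injEq] at hj'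
                  obtain ⟨rfl, rfl, rfl⟩ := hj'
                  rw [hm _ _ _ _ _ ht] at ht'
                  simp only [Transition.move.injEq] at ht'
                  obtain ⟨-, rfl, -⟩ := ht'
                  rw [Track.dir_rev, hd₁, Dir.rev_rev] at hd
                  rw [hd, back, hi] at hk
                  simp at hk
                · simp at hj'
              · simp at hj'
            · simp at hj'
          · rw [beltStep, hj] at hj'
            dsimp only at hj'
            split at hj'
            · rename_i p₁ c q₁ b ht
              simp only [BeltCell.head.injEq] at hj'
              obtain ⟨rfl, rfl, rfl⟩ := hj'
              rw [Function.update_self, hw _ _ _ _ _ _ ht] at ht'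
              simp at ht'
            · rename_i p₁ δ₁ q₁ ht
              split at hj'
              · simp at hj'
              · rename_i hne
                simp only [BeltCell.head.injEq] at hj'
                obtain ⟨rfl, rfl, rfl⟩ := hj'
                rw [hm _ _ _ _ _ ht] at ht'
                simp only [Transition.move.injEq] at ht'
                obtain ⟨-, rfl, -⟩ := ht'
                rw [Track.dir_rev, Track.flip_dir, Dir.rev_rev] at hd
                exact hne ⟨u, by rw [hd, back, hi, Dir.rev_rev]⟩
        · rfl
      · rfl
  · rcases ht : tr q (u τ) with ⟨p, δ, q'⟩ | ⟨p, c, q', b⟩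
    · have ht' := hm _ _ _ _ _ ht
      by_cases hj : ∃ v, y (i + (τ.dir δ).val) = .bit v (τ.dir δ).rev
      · have e1 : beltStep tr y i = .bit u (τ.dir δ) := by
          rw [beltStep, hi]
          simp only [ht]
          rw [if_pos hj]
        obtain ⟨v, hv⟩ := hj
        have e2 : beltStep tr y (i + (τ.dir δ).val) = .head τ q' v := by
          rw [beltStep, hv]
          simp [back, hi, ht, Dir.rev_rev]
        rw [beltStep, e1]
        simp [e2, ht', Track.dir_rev]
      · have e1 : beltStep tr y i = .head τ.flip q' u := by
          rw [beltStep, hi]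
          simp only [ht]
          rw [if_neg hj]
        rw [beltStep, e1]
        simp only [ht', Track.flip_flip]
        rw [if_neg]
        rw [Track.dir_rev, Track.flip_dir, Dir.rev_rev]
        exact fun h => hj (bitback i _ τ q u hi h)
    · have e1 : beltStep tr y i = .head τ q' (Function.update u τ b) := by
        rw [beltStep, hi]
        simp only [ht]
      rw [beltStep, e1]
      simp [hw _ _ _ _ _ _ ht]

theorem Machine.CompleteDeterministic.trans_spec {M : Machine Q Γ}
    (hM : M.CompleteDeterministic) (q : Q) (a : Γ) :
    hM.trans q a ∈ M.Δ ∧ (hM.trans q a).Applies q a := (hM q a).choose_spec.1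

theorem Machine.CompleteDeterministic.trans_eq {M : Machine Q Γ}
    (hM : M.CompleteDeterministic) {q : Q} {a : Γ} {t : Transition Q Γ} (ht : t ∈ M.Δ)
    (ha : t.Applies q a) : hM.trans q a = t :=
  (hM q a).unique (hM.trans_spec q a) ⟨ht, ha⟩

theorem Machine.Reversible.undoes {M : Machine Q Γ} (hM : M.Reversible) :
    Undoes hM.2.trans hM.1.trans := by
  refine ⟨fun q a p c q' b h => ?_, fun q a p δ q' h c => ?_⟩
  · have hs := hM.1.trans_spec q a
    rw [h] at hs
    obtain ⟨hs, rfl, rfl⟩ := hs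
    exact hM.2.trans_eq hs ⟨rfl, rfl⟩
  · have hs := hM.1.trans_spec q a
    rw [h] at hs
    obtain ⟨hs, rfl⟩ := hs
    refine hM.2.trans_eq ?_ rfl
    change Transition.rev _ ∈ M.Δ
    rwa [← Transition.rev_rev (.move p δ q')] at hs

/-- The automorphism `f_M` of the full shift defined by a reversible machine `M`, as a permutation
of the configurations. -/
noncomputable def Machine.Reversible.beltAction {M : Machine Q Γ} (hM : M.Reversible) :
    Equiv.Perm (ℤ → BeltCell Q Γ) where
  toFun := beltStep hM.1.trans
  invFun := beltStep hM.2.trans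
  left_inv := beltStep_undo hM.undoes
  right_inv := beltStep_undo (by
    have h := hM.inv.undoes
    have e : hM.inv.2.trans = hM.1.trans := by
      funext q a
      refine hM.inv.2.trans_eq ?_ (hM.1.trans_spec q a).2
      rw [M.inv_inv]
      exact (hM.1.trans_spec q a).1
    rwa [e] at h)

/-! ## The decorated SMART machine -/

/-- The machine whose heads carry an additional component in `D` that is neither read nor
modified. -/
def Machine.decorate (M : Machine Q Γ) (D : Type) : Machine (Q × D) Γ where
  Δ := {t | (∃ q δ q' x, .move q δ q' ∈ M.Δ ∧ t = .move (q, x) δ (q', x)) ∨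
    (∃ q a q' b x, .write q a q' b ∈ M.Δ ∧ t = .write (q, x) a (q', x) b)}

theorem Machine.CompleteDeterministic.decorate {M : Machine Q Γ}
    (hM : M.CompleteDeterministic) (D : Type) : (M.decorate D).CompleteDeterministic := by
  rintro ⟨q, x⟩ a
  obtain ⟨t, ⟨ht, hta⟩, hu⟩ := hM q a
  rcases t with ⟨p, δ, q'⟩ | ⟨p, c, q', b⟩
  · obtain rfl : p = q := hta
    refine ⟨.move (p, x) δ (q', x), ⟨.inl ⟨_, _, _, _, ht, rfl⟩, rfl⟩, ?_⟩
    rintro _ ⟨⟨r, δ', r', x', h, rfl⟩ | ⟨r, d, r', d', x', h, rfl⟩, h'⟩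
    · obtain ⟨rfl, rfl⟩ : r = p ∧ x' = x := by simpa [Transition.Applies] using h'
      have := hu _ ⟨h, rfl⟩
      simp_all
    · obtain ⟨⟨rfl, rfl⟩, rfl⟩ : (r = p ∧ x' = x) ∧ d = a := by
        simpa [Transition.Applies] using h'
      have := hu _ ⟨h, rfl, rfl⟩
      simp_all
  · obtain ⟨rfl, rfl⟩ : p = q ∧ c = a := hta
    refine ⟨.write (p, x) c (q', x) b, ⟨.inr ⟨_, _, _, _, _, ht, rfl⟩, rfl, rfl⟩, ?_⟩
    rintro _ ⟨⟨r, δ', r', x', h, rfl⟩ | ⟨r, d, r', d', x', h, rfl⟩, h'⟩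
    · obtain ⟨rfl, rfl⟩ : r = p ∧ x' = x := by simpa [Transition.Applies] using h'
      have := hu _ ⟨h, rfl⟩
      simp_all
    · obtain ⟨⟨rfl, rfl⟩, rfl⟩ : (r = p ∧ x' = x) ∧ d = c := by
        simpa [Transition.Applies] using h'
      have := hu _ ⟨h, rfl, rfl⟩
      simp_all

theorem Machine.decorate_inv (M : Machine Q Γ) (D : Type) :
    (M.decorate D).inv = M.inv.decorate D := by
  refine congrArg Machine.mk (Set.ext fun t => ⟨?_, ?_⟩)
  · rintro (⟨q, δ, q', x, h, e⟩ | ⟨q, a, q', b, x, h, e⟩)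
    · rw [← t.rev_rev, e]
      refine .inl ⟨q', δ.rev, q, x, ?_, rfl⟩
      change Transition.rev (Transition.rev (.move q δ q')) ∈ M.Δ
      rwa [Transition.rev_rev]
    · rw [← t.rev_rev, e]
      exact .inr ⟨q', b, q, a, x, h, rfl⟩
  · rintro (⟨q, δ, q', x, h, rfl⟩ | ⟨q, a, q', b, x, h, rfl⟩)
    · exact .inl ⟨q', δ.rev, q, x, h, rfl⟩
    · exact .inr ⟨q', b, q, a, x, h, rfl⟩

theorem Machine.Reversible.decorate {M : Machine Q Γ} (hM : M.Reversible) (D : Type) :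
    (M.decorate D).Reversible :=
  ⟨hM.1.decorate D, by rw [M.decorate_inv]; exact hM.2.decorate D⟩

/-- The filled triangles `▶`, `◀` and the hollow triangles `▷`, `◁`. -/
inductive Triangle
  | filledRight
  | filledLeft
  | hollowRight
  | hollowLeft

/-- The subscripts of the states of SMART. -/
inductive Index
  | one
  | two

/-- The states of SMART. -/
abbrev SmartState := Triangle × Index

open Triangle Index in
/-- The SMART machine, with tape alphabet `{0, 1, 2}`. -/
def smart : Machine SmartState (Fin 3) where
  Δ := {
    .move (filledRight, two) .right (filledRight, one),
    .write (filledRight, one) 0 (filledLeft, two) 1,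
    .write (filledRight, one) 1 (hollowLeft, two) 1,
    .write (filledRight, one) 2 (hollowLeft, two) 2,
    .move (filledLeft, two) .left (filledLeft, one),
    .write (filledLeft, one) 0 (filledRight, two) 1,
    .write (filledLeft, one) 1 (hollowRight, two) 1,
    .write (filledLeft, one) 2 (hollowRight, two) 2,
    .move (hollowRight, two) .right (hollowRight, one),
    .write (hollowRight, one) 0 (filledRight, two) 2,
    .write (hollowRight, one) 1 (filledRight, two) 0,
    .write (hollowRight, one) 2 (hollowLeft, two) 0,
    .move (hollowLeft, two) .left (hollowLeft, one),
    .write (hollowLeft, one) 0 (filledLeft, two) 2,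
    .write (hollowLeft, one) 1 (filledLeft, two) 0,
    .write (hollowLeft, one) 2 (hollowRight, two) 0 }

theorem Machine.inv_completeDeterministic {M : Machine Q Γ}
    (h : ∀ q a, ∃! t, t ∈ M.Δ ∧ t.rev.Applies q a) : M.inv.CompleteDeterministic := by
  intro q a
  obtain ⟨t, ⟨ht, hta⟩, hu⟩ := h q a
  refine ⟨t.rev, ⟨?_, hta⟩, fun s hs => ?_⟩
  · change t.rev.rev ∈ M.Δ
    rwa [t.rev_rev]
  · rw [← hu s.rev ⟨hs.1, by rw [s.rev_rev]; exact hs.2⟩, s.rev_rev]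

set_option maxHeartbeats 2000000 in
theorem smart_reversible : smart.Reversible := by
  refine ⟨?_, Machine.inv_completeDeterministic ?_⟩
  · rintro ⟨_ | _ | _ | _, _ | _⟩ a
    all_goals fin_cases a
    all_goals
      refine existsUnique_of_exists_of_unique ?_ ?_
      · simp [smart, Transition.Applies, or_and_right, exists_or]
      · rintro s t ⟨hs, hs'⟩ ⟨ht, ht'⟩
        simp only [smart, Set.mem_insert_iff, Set.mem_singleton_iff] at hs ht
        rcases hs with rfl | rfl | rfl | rfl | rfl | rfl | rfl | rfl | rfl | rfl | rfl | rfl |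
          rfl | rfl | rfl | rfl <;>
        simp [Transition.Applies] at hs' <;>
        rcases ht with rfl | rfl | rfl | rfl | rfl | rfl | rfl | rfl | rfl | rfl | rfl | rfl |
          rfl | rfl | rfl | rfl <;>
        simp [Transition.Applies] at ht' ⊢
  · rintro ⟨_ | _ | _ | _, _ | _⟩ a
    all_goals fin_cases a
    all_goals
      refine existsUnique_of_exists_of_unique ?_ ?_
      · simp [smart, Transition.Applies, Transition.rev, or_and_right, exists_or]
      · rintro s t ⟨hs, hs'⟩ ⟨ht, ht'⟩
        simp only [smart, Set.mem_insert_iff, Set.mem_singleton_iff] at hs ht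
        rcases hs with rfl | rfl | rfl | rfl | rfl | rfl | rfl | rfl | rfl | rfl | rfl | rfl |
          rfl | rfl | rfl | rfl <;>
        simp [Transition.Applies, Transition.rev] at hs' <;>
        rcases ht with rfl | rfl | rfl | rfl | rfl | rfl | rfl | rfl | rfl | rfl | rfl | rfl |
          rfl | rfl | rfl | rfl <;>
        simp [Transition.Applies, Transition.rev] at ht' ⊢

/-- The decorations: a duck in `{d₀, d₁}` and a ghost in `{0, …, 5}`. -/
abbrev Decoration := Fin 2 × Fin 6

/-- The states of the decorated SMART machine. -/
abbrev DecState := SmartState × Decoration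

/-- The decorated SMART machine. -/
def decoratedSmart : Machine DecState (Fin 3) := smart.decorate Decoration

theorem decoratedSmart_reversible : decoratedSmart.Reversible := smart_reversible.decorate _

end TM

/-! Two steps of SMART from a state of index two form a macro step: move, then rewrite the cell
reached. Everything about SMART is derived from macro steps.

On the bi-infinite tape, a head in front of `k` zeros with a suitable nonzero boundary letter
crosses them and leaves state and letters as they were (`sweep`). A sweep over `k + 1` zeros
consists of three sweeps over `k` zeros and three single macro steps, so its duration is about `3 ^
(k + 1) / 2`. Every configuration lies inside a sweep over `k` zeros or stands at a longer block of
zeros (`isHigh_or_sweep`), and consecutive sweeps run in opposite directions (`IsStart.next`). Hence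
the head stays within `k + 10` cells for `sweepTime k` macro steps (`iterate_span`), which gives
movement at most `log_3 n + 12`. Arbitrarily long sweeps also exclude finite order: on one infinite
belt, a power equal to the identity would confine the head.

On cyclic tapes the macro step is shown to be conjugate to an odometer. Cut the cycle at the head
and read the letters from one end of the unread interval, changing ends after each nonzero letter
(`enc`). This produces a balanced ternary number `Y` with `|Y| ≤ half ℓ`, a type, a direction and
the left end `κ` of the unread interval. One macro step changes `Y` by `+1` or `-1`, according to
the type, modulo `3 ^ ℓ`; type and direction are constant, and `κ` changes only once per turn of the
counter (`encStep_dec_normMap`). So a power of the macro step is a conjugate of the addition of one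
constant, whose cost does not depend on the constant (`costLE_incMap`).

It remains to compute the counter with few generators. As in Barrington's theorem, conjunctions of
conditions on the letters are computed by commutators of controlled three-cycles of the state.
Balanced halving makes comparison of ternary numbers cost `O(ℓ ^ 2)`, so that adding a constant to
the number on the tape costs `O(ℓ ^ 3)`. The decorations have twelve values, an even number, so
gates that ignore them are even permutations and therefore products of three-cycles. Each of the `ℓ`
letters is processed at cost `O(ℓ ^ 3)` (`costLE_stageMap`), in total `O(ℓ ^ 4)`. Finally, `T ^ (2 *
m)` is recovered from the `m`-th power of the macro step, which acts on index two only, by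
conjugating it with `T`. -/

namespace TM

/-! ## Configurations with a head, and the macro steps of SMART -/

/-- A tape with a head, given by the state, the letters and the position of the head. -/
abbrev Conf (P Q Γ : Type) := Q × (P → Γ) × P

section

variable {P Q Γ : Type} [DecidableEq P]

def Conf.toTape (c : Conf P Q Γ) : Tape P Q Γ :=
  ⟨fun i => if i = c.2.2 then .inr (c.1, c.2.1 i) else .inl (c.2.1 i), fun i j h => by
    by_cases hi : i = c.2.2 <;> by_cases hj : j = c.2.2 <;> simp_all⟩

theorem Conf.toTape_apply (c : Conf P Q Γ) (i : P) :
    c.toTape.1 i = if i = c.2.2 then .inr (c.1, c.2.1 i) else .inl (c.2.1 i) := rfl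

theorem Conf.headAt_toTape (c : Conf P Q Γ) (i : P) : c.toTape.HeadAt i ↔ i = c.2.2 := by
  unfold Tape.HeadAt
  rw [c.toTape_apply]
  split_ifs <;> simp_all

theorem Conf.letter_toTape (c : Conf P Q Γ) (i : P) : (c.toTape.1 i).letter = c.2.1 i := by
  rw [c.toTape_apply]
  split_ifs <;> rfl

theorem Conf.toTape_injective : Function.Injective (Conf.toTape (P := P) (Q := Q) (Γ := Γ)) := by
  intro c c' h
  have hp : c.2.2 = c'.2.2 := by
    have := (c.headAt_toTape c.2.2).2 rfl
    rw [h] at this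
    exact (c'.headAt_toTape _).1 this
  have hw : c.2.1 = c'.2.1 := by
    funext i
    rw [← c.letter_toTape, h, c'.letter_toTape]
  have hq : c.1 = c'.1 := by
    have := c.toTape_apply c.2.2
    rw [h, c'.toTape_apply] at this
    simp [hp] at this
    exact this.1.symm
  exact Prod.ext hq (Prod.ext hw hp)

theorem Tape.exists_conf (x : Tape P Q Γ) {i : P} (h : x.HeadAt i) :
    ∃ c : Conf P Q Γ, c.toTape = x ∧ c.2.2 = i := by
  obtain ⟨⟨q, a⟩, h⟩ := Sum.isRight_iff.1 h
  refine ⟨(q, fun j => (x.1 j).letter, i), Subtype.ext (funext fun j => ?_), rfl⟩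
  rw [Conf.toTape_apply]
  by_cases hj : j = i
  · subst hj
    simp [h, Symbol.letter]
  · rw [x.eq_inl h hj]
    simp [hj, Symbol.letter]

end

/-- A triangle is filled or not, and points in a direction. -/
def triangle : Bool × Dir → Triangle
  | (true, .right) => .filledRight
  | (true, .left) => .filledLeft
  | (false, .right) => .hollowRight
  | (false, .left) => .hollowLeft

theorem triangle_surjective : Function.Surjective triangle := by
  rintro (_ | _ | _ | _)
  exacts [⟨(true, .right), rfl⟩, ⟨(true, .left), rfl⟩, ⟨(false, .right), rfl⟩,
    ⟨(false, .left), rfl⟩]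

/-- The matching transitions of SMART. -/
def smartWrite : Bool × Dir → Fin 3 → (Bool × Dir) × Fin 3
  | (true, d), 0 => ((true, d.rev), 1)
  | (true, d), 1 => ((false, d.rev), 1)
  | (true, d), 2 => ((false, d.rev), 2)
  | (false, d), 0 => ((true, d), 2)
  | (false, d), 1 => ((true, d), 0)
  | (false, d), 2 => ((false, d.rev), 0)

section

variable {P : Type} [Ring P] [DecidableEq P]

/-- A head in a state of index two moves and enters the state of index one. -/
def moveConf (s : Bool × Dir) (x : Decoration) (w : P → Fin 3) (p : P) : Conf P DecState (Fin 3) :=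
  (((triangle s, .one), x), w, p + (s.2.val : P))

/-- A head in a state of index one rewrites the letter. -/
def writeConf (s : Bool × Dir) (x : Decoration) (w : P → Fin 3) (p : P) : Conf P DecState (Fin 3) :=
  (((triangle (smartWrite s (w p)).1, .two), x), Function.update w p (smartWrite s (w p)).2, p)

theorem step_move [Nontrivial P] (s : Bool × Dir) (x : Decoration) (w : P → Fin 3) (p : P) :
    decoratedSmart.Step (Conf.toTape (((triangle s, .two), x), w, p))
      (moveConf s x w p).toTape := by
  have hne : p + ((s.2.val : ℤ) : P) ≠ p := by simpa using s.2.val_ne_zero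
  refine .inr ⟨p, ((triangle s, .two), x), w p, by simp [Conf.toTape_apply],
    .inr ⟨s.2, ((triangle s, .one), x), ?_, ?_, ?_, ?_⟩⟩
  · refine .inl ⟨_, _, _, _, ?_, rfl⟩
    obtain ⟨_ | _, _ | _⟩ := s <;> simp [smart, triangle]
  · simp [Conf.toTape_apply, moveConf, hne.symm]
  · rw [Conf.letter_toTape]
    simp [Conf.toTape_apply, moveConf]
  · intro i h1 h2
    simp [Conf.toTape_apply, moveConf, h1, h2]

theorem step_write (s : Bool × Dir) (x : Decoration) (w : P → Fin 3) (p : P) :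
    decoratedSmart.Step (Conf.toTape (((triangle s, .one), x), w, p))
      (writeConf s x w p).toTape := by
  refine .inr ⟨p, ((triangle s, .one), x), w p, by simp [Conf.toTape_apply],
    .inl ⟨((triangle (smartWrite s (w p)).1, .two), x), (smartWrite s (w p)).2, ?_, ?_, ?_⟩⟩
  · refine .inr ⟨_, _, _, _, _, ?_, rfl⟩
    generalize w p = a
    obtain ⟨_ | _, _ | _⟩ := s <;> fin_cases a <;> simp [smart, triangle, smartWrite, Dir.rev]
  · simp [Conf.toTape_apply, writeConf]
  · intro i h1
    simp [Conf.toTape_apply, writeConf, h1]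

/-- Two steps of SMART from a state of index two. -/
def macroStep (c : Conf P (Bool × Dir) (Fin 3)) : Conf P (Bool × Dir) (Fin 3) :=
  ((smartWrite c.1 (c.2.1 (c.2.2 + (c.1.2.val : P)))).1,
    Function.update c.2.1 (c.2.2 + (c.1.2.val : P))
      (smartWrite c.1 (c.2.1 (c.2.2 + (c.1.2.val : P)))).2,
    c.2.2 + (c.1.2.val : P))

/-- The tape of index two that belongs to a configuration. -/
def macroTape (x : Decoration) (c : Conf P (Bool × Dir) (Fin 3)) : Tape P DecState (Fin 3) :=
  Conf.toTape (((triangle c.1, .two), x), c.2.1, c.2.2)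

theorem headAt_macroTape (x : Decoration) (c : Conf P (Bool × Dir) (Fin 3)) (i : P) :
    (macroTape x c).HeadAt i ↔ i = c.2.2 := Conf.headAt_toTape _ _

theorem writeConf_moveConf (x : Decoration) (c : Conf P (Bool × Dir) (Fin 3)) :
    (writeConf c.1 x c.2.1 (c.2.2 + (c.1.2.val : P))).toTape = macroTape x (macroStep c) := rfl

end

end TM

namespace TM

/-! ## Sweeps of SMART on the bi-infinite tape -/

/-- The number of steps of a sweep over `k` zeros. -/
def sweepTime : ℕ → ℕ
  | 0 => 0
  | k + 1 => 3 * sweepTime k + 3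

/-- Each further cell costs a factor of three. This is the source of the factor `ln 2 / ln 3`. -/
theorem two_mul_sweepTime (k : ℕ) : 2 * sweepTime k + 3 = 3 ^ (k + 1) := by
  induction k with
  | zero => rfl
  | succ k ih => rw [sweepTime, pow_succ]; omega

abbrev IntConf := Conf ℤ (Bool × Dir) (Fin 3)

/-- The configuration `y` is reached from `x` in `n` macro steps between the cells `i` and
`i + K * e`. -/
def Reach (x y : IntConf) (n : ℕ) (i e K : ℤ) : Prop :=
  macroStep^[n] x = y ∧ ∀ m ≤ n, ∃ t : ℤ, 0 ≤ t ∧ t ≤ K ∧ (macroStep^[m] x).2.2 = i + t * e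

theorem Reach.trans {x y z : IntConf} {n m N : ℕ} {i e K : ℤ} (h : Reach x y n i e K)
    (h' : Reach y z m i e K) (hN : N = n + m) : Reach x z N i e K := by
  subst hN
  have key : ∀ k, macroStep^[n + k] x = macroStep^[k] y := fun k => by
    rw [add_comm, Function.iterate_add_apply, h.1]
  refine ⟨by rw [key, h'.1], fun k hk => ?_⟩
  rcases le_total k n with hkn | hkn
  · exact h.2 k hkn
  · obtain ⟨l, rfl⟩ := Nat.exists_eq_add_of_le hkn
    rw [key]
    exact h'.2 l (by omega)

theorem Reach.single {x y : IntConf} {i e K t t' : ℤ} (h : macroStep x = y) (hx : x.2.2 = i + t * e)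
    (hy : y.2.2 = i + t' * e) (h0 : 0 ≤ t) (h1 : t ≤ K) (h0' : 0 ≤ t') (h1' : t' ≤ K) :
    Reach x y 1 i e K := by
  refine ⟨h, fun m hm => ?_⟩
  interval_cases m
  · exact ⟨t, h0, h1, hx⟩
  · exact ⟨t', h0', h1', by simpa [h] using hy⟩

theorem Reach.widen {x y : IntConf} {n : ℕ} {i e K i' e' K' : ℤ} (h : Reach x y n i e K)
    (hw : ∀ t, 0 ≤ t → t ≤ K → ∃ t', 0 ≤ t' ∧ t' ≤ K' ∧ i + t * e = i' + t' * e') :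
    Reach x y n i' e' K' := by
  refine ⟨h.1, fun m hm => ?_⟩
  obtain ⟨t, h0, h1, ht⟩ := h.2 m hm
  obtain ⟨t', h0', h1', ht'⟩ := hw t h0 h1
  exact ⟨t', h0', h1', ht.trans ht'⟩

section

variable {d : Dir} {w : ℤ → Fin 3} {i j : ℤ}

theorem macroStep_filled_zero (hj : i + d.val = j) (h : w j = 0) :
    macroStep ((true, d), w, i) = ((true, d.rev), Function.update w j 1, j) := by
  subst hj
  simp [macroStep, h, smartWrite]

theorem macroStep_filled_ne (hj : i + d.val = j) (h : w j ≠ 0) :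
    macroStep ((true, d), w, i) = ((false, d.rev), w, j) := by
  subst hj
  have h' : w (i + d.val) = 1 ∨ w (i + d.val) = 2 := by
    generalize w (i + d.val) = a at h
    fin_cases a <;> simp_all
  rcases h' with h' | h' <;> simp [macroStep, h', smartWrite]

theorem macroStep_hollow_zero (hj : i + d.val = j) (h : w j = 0) :
    macroStep ((false, d), w, i) = ((true, d), Function.update w j 2, j) := by
  subst hj
  simp [macroStep, h, smartWrite]

theorem macroStep_hollow_one (hj : i + d.val = j) (h : w j = 1) :
    macroStep ((false, d), w, i) = ((true, d), Function.update w j 0, j) := by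
  subst hj
  simp [macroStep, h, smartWrite]

theorem macroStep_hollow_two (hj : i + d.val = j) (h : w j = 2) :
    macroStep ((false, d), w, i) = ((false, d.rev), Function.update w j 0, j) := by
  subst hj
  simp [macroStep, h, smartWrite]

end

theorem Dir.add_mul_val_ne (d : Dir) (i : ℤ) {s t : ℤ} (h : s ≠ t) :
    i + s * d.val ≠ i + t * d.val := by
  cases d <;> simp [Dir.val] <;> omega

theorem update_update_eq_self {w : ℤ → Fin 3} {j : ℤ} {a b : Fin 3} (h : w j = b) :
    Function.update (Function.update w j a) j b = w := by
  rw [Function.update_idem]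
  exact Function.update_eq_self_iff.2 h.symm

/-- A filled head sweeps over zeros that end behind the head at another letter, and a hollow head
sweeps over zeros that end in front of the head at another letter. -/
theorem sweep (k : ℕ) : ∀ (d : Dir) (i : ℤ) (w : ℤ → Fin 3),
    (∀ j : ℤ, 1 ≤ j → j ≤ k → w (i + j * d.val) = 0) →
    (w i ≠ 0 → Reach ((true, d), w, i) ((true, d), w, i + k * d.val) (sweepTime k) i d.val (k + 1)) ∧
    (w (i + (k + 1) * d.val) ≠ 0 →
      Reach ((false, d), w, i) ((false, d), w, i + k * d.val) (sweepTime k) i d.val (k + 1)) := by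
  induction k with
  | zero =>
    intro d i w _
    constructor <;>
    · intro _
      refine ⟨by simp [sweepTime], fun m hm => ⟨0, le_rfl, by positivity, ?_⟩⟩
      obtain rfl : m = 0 := by simpa [sweepTime] using hm
      simp
  | succ k ih =>
    intro d i w hw
    push_cast at hw ⊢
    -- The inner sweeps going forward begin at offset `0` or `1`, those going back at offset `k + 1`
    -- or `k + 2`; their windows all fit into that of the outer sweep.
    have widen : ∀ {x y : IntConf} {n : ℕ} {j : ℤ} (s : ℤ), Reach x y n j d.val (k + 1) →
        j = i + s * d.val → 0 ≤ s → s ≤ 1 → Reach x y n i d.val (k + 1 + 1) := by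
      intro x y n j s h hj h0 h1
      refine h.widen fun t ht ht' => ⟨s + t, by omega, by omega, by rw [hj]; ring⟩
    have widen' : ∀ {x y : IntConf} {n : ℕ} {j : ℤ} (s : ℤ), Reach x y n j d.rev.val (k + 1) →
        j = i + s * d.val → k + 1 ≤ s → s ≤ k + 2 → Reach x y n i d.val (k + 1 + 1) := by
      intro x y n j s h hj h0 h1
      refine h.widen fun t ht ht' => ⟨s - t, by omega, by omega, by rw [hj, Dir.val_rev]; ring⟩
    have hS : sweepTime (k + 1) = 3 * sweepTime k + 3 := rfl
    constructor
    · intro hi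
      -- sweep, turn, sweep back, turn, sweep, pass
      have hlast : w (i + (k + 1) * d.val) = 0 := hw _ (by omega) le_rfl
      set w' := Function.update w (i + (k + 1) * d.val) 1 with hw'
      have ne : ∀ s : ℤ, s ≠ k + 1 → w' (i + s * d.val) = w (i + s * d.val) := fun s hs =>
        Function.update_of_ne (d.add_mul_val_ne i hs) _ _
      have hi' : w' i = w i := by simpa using ne 0 (by omega)
      have hl' : w' (i + (k + 1) * d.val) = 1 := Function.update_self _ _ _
      have s1 := (ih d i w fun j h1 h2 => hw j h1 (by omega)).1 hi
      have s2 : macroStep ((true, d), w, i + k * d.val) =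
          ((true, d.rev), w', i + (k + 1) * d.val) := macroStep_filled_zero (by ring) hlast
      have s3 := (ih d.rev (i + (k + 1) * d.val) w' fun j h1 h2 => by
        have : i + (k + 1) * d.val + j * d.rev.val = i + (k + 1 - j) * d.val := by
          rw [Dir.val_rev]; ring
        rw [this, ne _ (by omega)]
        exact hw _ (by omega) (by omega)).1 (by rw [hl']; decide)
      have e3 : i + (k + 1) * d.val + k * d.rev.val = i + d.val := by rw [Dir.val_rev]; ring
      rw [e3] at s3
      have s4 : macroStep ((true, d.rev), w', i + d.val) = ((false, d), w', i) := by
        rw [macroStep_filled_ne (j := i) (by rw [Dir.val_rev]; ring) (by rwa [hi']), Dir.rev_rev]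
      have s5 := (ih d i w' fun j h1 h2 => by
        rw [ne _ (by omega)]
        exact hw j h1 (by omega)).2 (by rw [hl']; decide)
      have s6 : macroStep ((false, d), w', i + k * d.val) = ((true, d), w, i + (k + 1) * d.val) := by
        rw [macroStep_hollow_one (j := i + (k + 1) * d.val) (by ring) hl', hw',
          update_update_eq_self hlast]
      exact (((((widen 0 s1 (by ring) le_rfl (by omega)).trans
        (.single (t := k) (t' := k + 1) s2 rfl rfl (by omega) (by omega) (by omega) (by omega))
          rfl).trans
        (widen' (k + 1) s3 rfl le_rfl (by omega)) rfl).trans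
        (.single (t := 1) (t' := 0) s4 (by simp) (by simp) (by omega) (by omega) (by omega)
          (by omega)) rfl).trans
        (widen 0 s5 (by ring) le_rfl (by omega)) rfl).trans
        (.single (t := k) (t' := k + 1) s6 rfl rfl (by omega) (by omega) (by omega) (by omega))
          (by omega)
    · intro hl
      -- Write a `2` as a wall, sweep as a filled head, turn at the far letter, sweep back to the
      -- wall, erase it, and sweep again.
      have hfirst : w (i + d.val) = 0 := by simpa using hw 1 le_rfl (by omega)
      set w' := Function.update w (i + d.val) 2 with hw'
      have ne : ∀ s : ℤ, s ≠ 1 → w' (i + s * d.val) = w (i + s * d.val) := fun s hs =>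
        Function.update_of_ne (by simpa using d.add_mul_val_ne i hs) _ _
      have hf' : w' (i + d.val) = 2 := Function.update_self _ _ _
      have hl' : w' (i + (k + 2) * d.val) ≠ 0 := by
        rw [ne _ (by omega)]
        convert hl using 3
        ring
      have e (s : ℤ) : i + d.val + s * d.val = i + (s + 1) * d.val := by ring
      have s1 : macroStep ((false, d), w, i) = ((true, d), w', i + d.val) :=
        macroStep_hollow_zero rfl hfirst
      have s2 := (ih d (i + d.val) w' fun j h1 h2 => by
        rw [e, ne _ (by omega)]
        exact hw _ (by omega) (by omega)).1 (by rw [hf']; decide)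
      rw [e] at s2
      have s3 : macroStep ((true, d), w', i + (k + 1) * d.val) =
          ((false, d.rev), w', i + (k + 2) * d.val) := macroStep_filled_ne (by ring) hl'
      have s4 := (ih d.rev (i + (k + 2) * d.val) w' fun j h1 h2 => by
        have : i + (k + 2) * d.val + j * d.rev.val = i + (k + 2 - j) * d.val := by
          rw [Dir.val_rev]; ring
        rw [this, ne _ (by omega)]
        exact hw _ (by omega) (by omega)).2 (by
          have : i + (k + 2) * d.val + (k + 1) * d.rev.val = i + d.val := by
            rw [Dir.val_rev]; ring
          rw [this, hf']; decide)
      have e4 : i + (k + 2) * d.val + k * d.rev.val = i + 2 * d.val := by rw [Dir.val_rev]; ring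
      rw [e4] at s4
      have s5 : macroStep ((false, d.rev), w', i + 2 * d.val) = ((false, d), w, i + d.val) := by
        rw [macroStep_hollow_two (j := i + d.val) (by rw [Dir.val_rev]; ring) hf', Dir.rev_rev, hw',
          update_update_eq_self hfirst]
      have s6 := (ih d (i + d.val) w fun j h1 h2 => by
        rw [e]
        exact hw _ (by omega) (by omega)).2 (by rw [e]; exact hl)
      rw [e] at s6
      exact (((((Reach.single (i := i) (e := d.val) (K := k + 1 + 1) (t := 0) (t' := 1) s1 (by simp)
          (by simp) (by omega) (by omega) (by omega) (by omega)).trans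
        (widen 1 s2 (by ring) (by omega) (by omega)) rfl).trans
        (.single (t := k + 1) (t' := k + 2) s3 rfl rfl (by omega) (by omega) (by omega) (by omega))
          rfl).trans
        (widen' (k + 2) s4 rfl (by omega) (by omega)) rfl).trans
        (.single (t := 2) (t' := 1) s5 rfl (by simp) (by omega) (by omega) (by omega) (by omega))
          rfl).trans
        (widen 1 s6 (by ring) (by omega) (by omega)) (by omega)

end TM

namespace TM

/-! ## The movement function of SMART -/

/-- A sweep over `k` zeros starts at `x`. -/
def IsStart (k : ℕ) (x : IntConf) : Prop :=
  (∀ j : ℤ, 1 ≤ j → j ≤ k → x.2.1 (x.2.2 + j * x.1.2.val) = 0) ∧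
    bif x.1.1 then x.2.1 x.2.2 ≠ 0 else x.2.1 (x.2.2 + (k + 1) * x.1.2.val) ≠ 0

/-- The head is at one end of more than `k` zeros that it sweeps over as a whole. -/
def IsHigh (k : ℕ) (x : IntConf) : Prop :=
  bif x.1.1 then ∀ j : ℤ, 0 ≤ j → j ≤ k → x.2.1 (x.2.2 - j * x.1.2.val) = 0
  else ∀ j : ℤ, 1 ≤ j → j ≤ k + 1 → x.2.1 (x.2.2 + j * x.1.2.val) = 0

theorem IsStart.reach {k : ℕ} {x : IntConf} (h : IsStart k x) :
    Reach x (x.1, x.2.1, x.2.2 + k * x.1.2.val) (sweepTime k) x.2.2 x.1.2.val (k + 1) := by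
  obtain ⟨⟨_ | _, d⟩, w, i⟩ := x
  · exact (sweep k d i w h.1).2 h.2
  · exact (sweep k d i w h.1).1 h.2

theorem IsStart.iterate {k : ℕ} {f : Bool} {d : Dir} {w : ℤ → Fin 3} {i j : ℤ}
    (h : IsStart k ((f, d), w, i)) (hj : i + k * d.val = j) :
    macroStep^[sweepTime k] ((f, d), w, i) = ((f, d), w, j) := by
  subst hj
  exact h.reach.1

theorem iterate_add_of_eq {x y z : IntConf} {n m : ℕ} (h : macroStep^[n] x = y)
    (h' : macroStep^[m] y = z) : macroStep^[n + m] x = z := by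
  rw [add_comm, Function.iterate_add_apply, h, h']

/-- A sweep over `k` zeros is part of a sweep over `k + 1` zeros. -/
theorem IsStart.parent {k : ℕ} {y : IntConf} (h : IsStart k y) :
    ∃ z m, IsStart (k + 1) z ∧ m + sweepTime k ≤ sweepTime (k + 1) ∧ macroStep^[m] z = y := by
  obtain ⟨⟨f, d⟩, w, i⟩ := y
  have hS : sweepTime (k + 1) = 3 * sweepTime k + 3 := rfl
  have hz := h.1
  have cases3 : ∀ a : Fin 3, a ≠ 0 → a = 1 ∨ a = 2 := by decide
  have upd : ∀ (a : Fin 3) (s t : ℤ), s ≠ t →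
      Function.update w (i + s * d.val) a (i + t * d.val) = w (i + t * d.val) := fun a s t hs =>
    Function.update_of_ne (d.add_mul_val_ne i hs.symm) _ _
  have upd0 : ∀ (a : Fin 3) (t : ℤ), t ≠ 0 →
      Function.update w i a (i + t * d.val) = w (i + t * d.val) := fun a t ht => by
    simpa using upd a 0 t ht.symm
  have back : ∀ s t : ℤ, i + s * d.val + t * d.rev.val = i + (s - t) * d.val := fun s t => by
    rw [Dir.val_rev]; ring
  have fwd : ∀ s : ℤ, i - d.val + s * d.val = i + (s - 1) * d.val := fun s => by ring
  cases f
  · have hl : w (i + (k + 1) * d.val) ≠ 0 := h.2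
    by_cases hA : w i = 0
    · -- last part of the sweep of a hollow head
      have hS' : IsStart (k + 1) ((false, d), w, i - d.val) := by
        constructor
        · intro j h1 h2
          push_cast at h2
          simp only [fwd]
          rcases eq_or_ne j 1 with rfl | hj
          · simpa using hA
          · exact hz _ (by omega) (by omega)
        · simp only [fwd]
          push_cast
          convert hl using 3
          ring
      refine ⟨_, 1 + (sweepTime k + (1 + (sweepTime k + 1))), hS', by omega, ?_⟩
      set w' := Function.update w i 2 with hw'
      have hn : ∀ s : ℤ, s ≠ 0 → w' (i + s * d.val) = w (i + s * d.val) := upd0 2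
      have hi' : w' i = 2 := Function.update_self _ _ _
      refine iterate_add_of_eq (macroStep_hollow_zero (j := i) (by ring) hA) ?_
      refine iterate_add_of_eq (IsStart.iterate ⟨fun j h1 h2 => ?_, ?_⟩ rfl) ?_
      · exact (hn _ (by omega)).trans (hz _ h1 h2)
      · simp
      refine iterate_add_of_eq (macroStep_filled_ne (j := i + (k + 1) * d.val) (by ring) ?_) ?_
      · exact (hn _ (by omega)).trans_ne hl
      refine iterate_add_of_eq (IsStart.iterate (j := i + d.val) ⟨fun j h1 h2 => ?_, ?_⟩ ?_) ?_
      · simp only [back]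
        exact (hn _ (by omega)).trans (hz _ (by omega) (by omega))
      · simp only [back]
        simp
      · rw [back]; ring
      · change macroStep _ = _
        rw [macroStep_hollow_two (j := i) (by rw [Dir.val_rev]; ring) hi', Dir.rev_rev, hw',
          update_update_eq_self hA]
    · rcases cases3 _ hl with hl1 | hl1
      · -- last part of the sweep of a filled head
        set w' := Function.update w (i + (k + 1) * d.val) 0 with hw'
        have hn : ∀ s : ℤ, s ≠ k + 1 → w' (i + s * d.val) = w (i + s * d.val) := fun s hs =>
          upd 0 _ s hs.symm
        have hl' : w' (i + (k + 1) * d.val) = 0 := Function.update_self _ _ _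
        have hi' : w' i = w i := by simpa using hn 0 (by omega)
        refine ⟨((true, d), w', i), sweepTime k + (1 + (sweepTime k + 1)), ⟨fun j h1 h2 => ?_, ?_⟩,
          by omega, ?_⟩
        · push_cast at h2
          rcases eq_or_ne j (k + 1) with rfl | hj
          · exact hl'
          · exact (hn _ hj).trans (hz _ h1 (by omega))
        · exact hi'.trans_ne hA
        refine iterate_add_of_eq (IsStart.iterate ⟨fun j h1 h2 => ?_, ?_⟩ rfl) ?_
        · exact (hn _ (by omega)).trans (hz _ h1 h2)
        · exact hi'.trans_ne hA
        refine iterate_add_of_eq (y := ((true, d.rev), w, i + (k + 1) * d.val)) ?_ ?_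
        · change macroStep _ = _
          rw [macroStep_filled_zero (j := i + (k + 1) * d.val) (by ring) hl', hw',
            update_update_eq_self hl1]
        refine iterate_add_of_eq (IsStart.iterate (j := i + d.val) ⟨fun j h1 h2 => ?_, ?_⟩ ?_) ?_
        · simp only [back]
          exact hz _ (by omega) (by omega)
        · simp [hl1]
        · rw [back]; ring
        · change macroStep _ = _
          rw [macroStep_filled_ne (j := i) (by rw [Dir.val_rev]; ring) hA, Dir.rev_rev]
      · -- second part of the sweep of a hollow head in the other direction
        set w' := Function.update w (i + (k + 1) * d.val) 0 with hw'
        have hn : ∀ s : ℤ, s ≠ k + 1 → w' (i + s * d.val) = w (i + s * d.val) := fun s hs =>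
          upd 0 _ s hs.symm
        have hl' : w' (i + (k + 1) * d.val) = 0 := Function.update_self _ _ _
        have hi' : w' i = w i := by simpa using hn 0 (by omega)
        refine ⟨((false, d.rev), w', i + (k + 2) * d.val), 1 + (sweepTime k + 1),
          ⟨fun j h1 h2 => ?_, ?_⟩, by omega, ?_⟩
        · push_cast at h2
          simp only [back]
          rcases eq_or_ne j 1 with rfl | hj
          · convert hl' using 3
            ring
          · exact (hn _ (by omega)).trans (hz _ (by omega) (by omega))
        · simp only [back]
          push_cast
          have : i + ((k : ℤ) + 2 - (k + 1 + 1)) * d.val = i := by ring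
          rw [this]
          exact hi'.trans_ne hA
        refine iterate_add_of_eq (y := ((true, d.rev), w, i + (k + 1) * d.val)) ?_ ?_
        · change macroStep _ = _
          rw [macroStep_hollow_zero (j := i + (k + 1) * d.val) (by rw [Dir.val_rev]; ring) hl', hw',
            update_update_eq_self hl1]
        refine iterate_add_of_eq (IsStart.iterate (j := i + d.val) ⟨fun j h1 h2 => ?_, ?_⟩ ?_) ?_
        · simp only [back]
          exact hz _ (by omega) (by omega)
        · simp [hl1]
        · rw [back]; ring
        · change macroStep _ = _
          rw [macroStep_filled_ne (j := i) (by rw [Dir.val_rev]; ring) hA, Dir.rev_rev]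
  · have hA : w i ≠ 0 := h.2
    by_cases hl : w (i + (k + 1) * d.val) = 0
    · -- first part of the sweep of a filled head
      refine ⟨((true, d), w, i), 0, ⟨fun j h1 h2 => ?_, hA⟩, by omega, rfl⟩
      push_cast at h2
      rcases eq_or_ne j (k + 1) with rfl | hj
      · exact hl
      · exact hz _ h1 (by omega)
    -- The nonzero letter under the head is attributed to the enclosing sweep: a `1` marks a turning
    -- filled head, a `2` the wall of a hollow one. Undoing this write gives the tape on which the
    -- enclosing sweep starts.
    · set w' := Function.update w i 0 with hw'
      have hn : ∀ s : ℤ, s ≠ 0 → w' (i + s * d.val) = w (i + s * d.val) := upd0 0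
      have hi' : w' i = 0 := Function.update_self _ _ _
      rcases cases3 _ hA with hA1 | hA1
      · -- second part of the sweep of a filled head in the other direction
        refine ⟨((true, d.rev), w', i + (k + 1) * d.val), sweepTime k + 1,
          ⟨fun j h1 h2 => ?_, ?_⟩, by omega, ?_⟩
        · push_cast at h2
          simp only [back]
          rcases eq_or_ne j (k + 1) with rfl | hj
          · simpa using hi'
          · exact (hn _ (by omega)).trans (hz _ (by omega) (by omega))
        · exact (hn _ (by omega)).trans_ne hl
        refine iterate_add_of_eq (IsStart.iterate (j := i + d.val) ⟨fun j h1 h2 => ?_, ?_⟩ ?_) ?_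
        · simp only [back]
          exact (hn _ (by omega)).trans (hz _ (by omega) (by omega))
        · exact (hn _ (by omega)).trans_ne hl
        · rw [back]; ring
        · change macroStep _ = _
          rw [macroStep_filled_zero (j := i) (by rw [Dir.val_rev]; ring) hi', Dir.rev_rev, hw',
            update_update_eq_self hA1]
      · -- first part of the sweep of a hollow head
        refine ⟨((false, d), w', i - d.val), 1, ⟨fun j h1 h2 => ?_, ?_⟩, by omega, ?_⟩
        · push_cast at h2
          simp only [fwd]
          rcases eq_or_ne j 1 with rfl | hj
          · simpa using hi'
          · exact (hn _ (by omega)).trans (hz _ (by omega) (by omega))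
        · simp only [fwd]
          push_cast
          have : (k : ℤ) + 1 + 1 - 1 = k + 1 := by ring
          rw [this]
          exact (hn _ (by omega)).trans_ne hl
        · change macroStep _ = _
          rw [macroStep_hollow_zero (j := i) (by ring) hi', hw', update_update_eq_self hA1]

/-- Sweeps are enlarged one cell at a time by `IsStart.parent`. If the head stands at a block of
more than `k` zeros, the block either extends further or has length exactly `k + 1` and is itself
swept. -/
theorem isHigh_or_sweep (k : ℕ) (x : IntConf) :
    IsHigh k x ∨ ∃ y m, IsStart k y ∧ m ≤ sweepTime k ∧ macroStep^[m] y = x := by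
  induction k with
  | zero =>
    obtain ⟨⟨f, d⟩, w, i⟩ := x
    have single : ∀ j : ℤ, 1 ≤ j → j ≤ 1 → j = 1 := fun j h1 h2 => le_antisymm h2 h1
    by_cases hx : (bif f then w i else w (i + d.val)) = 0
    · left
      cases f
      · intro j h1 h2
        obtain rfl := single j h1 (by simpa using h2)
        simpa using hx
      · intro j h1 h2
        obtain rfl : j = 0 := by push_cast at h2; omega
        simpa using hx
    · refine .inr ⟨_, 0, ⟨fun j h1 h2 => ?_, ?_⟩, by omega, rfl⟩
      · push_cast at h2
        omega
      · cases f <;> simpa using hx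
  | succ k ih =>
    rcases ih with h | ⟨y, m, hy, hm, rfl⟩
    · obtain ⟨⟨f, d⟩, w, i⟩ := x
      cases f
      · by_cases hl : w (i + (k + 2) * d.val) = 0
        · left
          intro j h1 h2
          rcases eq_or_ne j (k + 2) with rfl | hj
          · exact hl
          · push_cast at h2
            exact h j h1 (by omega)
        · refine .inr ⟨_, 0, ⟨fun j h1 h2 => h j h1 (by push_cast at h2; omega), ?_⟩, by omega, rfl⟩
          convert hl using 4
          push_cast
          ring
      · by_cases hl : w (i - (k + 1) * d.val) = 0
        · left
          intro j h1 h2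
          rcases eq_or_ne j (k + 1) with rfl | hj
          · exact hl
          · push_cast at h2
            exact h j h1 (by omega)
        -- A filled head has the zeros behind it, so it stands at the end of the sweep and the full
        -- duration has elapsed; the hollow head above stood at the start.
        · refine .inr ⟨((true, d), w, i - (k + 1) * d.val), sweepTime (k + 1),
            ⟨fun j h1 h2 => ?_, hl⟩, le_rfl, ?_⟩
          · push_cast at h2
            simp only [show i - (k + 1) * d.val + j * d.val = i - (k + 1 - j) * d.val by ring]
            exact h (k + 1 - j) (by omega) (by omega)
          · refine IsStart.iterate ⟨fun j h1 h2 => ?_, hl⟩ (by push_cast; ring)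
            push_cast at h2
            simp only [show i - (k + 1) * d.val + j * d.val = i - (k + 1 - j) * d.val by ring]
            exact h (k + 1 - j) (by omega) (by omega)
    · obtain ⟨z, n, hz, hn, rfl⟩ := hy.parent
      refine .inr ⟨z, n + m, hz, by omega, iterate_add_of_eq rfl rfl⟩

/-- A hollow head enters the zeros, leaves a `2` behind it and becomes filled. A filled head either
writes a `1` and turns back, or turns into a hollow head, to which the first case applies. -/
theorem IsHigh.next {k : ℕ} {x : IntConf} (h : IsHigh k x) : ∃ s ≤ 2,
    IsStart k (macroStep^[s] x) ∧
    (macroStep^[s] x).1.2 = bif x.1.1 then x.1.2.rev else x.1.2 := by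
  have hollow : ∀ (d : Dir) (w : ℤ → Fin 3) (i : ℤ), IsHigh k ((false, d), w, i) →
      IsStart k (macroStep ((false, d), w, i)) ∧ (macroStep ((false, d), w, i)).1.2 = d := by
    intro d w i h
    have h1 : w (i + d.val) = 0 := by simpa using h 1 le_rfl (by omega)
    rw [macroStep_hollow_zero rfl h1]
    refine ⟨⟨fun j hj1 hj2 => ?_, by simp⟩, rfl⟩
    have e : i + d.val + j * d.val = i + (j + 1) * d.val := by ring
    simp only [e]
    rw [Function.update_of_ne]
    · exact h _ (by omega) (by omega)
    · simpa using d.add_mul_val_ne i (s := j + 1) (t := 1) (by omega)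
  obtain ⟨⟨_ | _, d⟩, w, i⟩ := x
  · obtain ⟨h1, h2⟩ := hollow d w i h
    exact ⟨1, by omega, h1, h2⟩
  · have e : ∀ j : ℤ, i + d.val + j * d.rev.val = i - (j - 1) * d.val := fun j => by
      rw [Dir.val_rev]; ring
    by_cases hc : w (i + d.val) = 0
    · refine ⟨1, by omega, ?_⟩
      change IsStart k (macroStep _) ∧ (macroStep _).1.2 = _
      rw [macroStep_filled_zero rfl hc]
      refine ⟨⟨fun j hj1 hj2 => ?_, by simp⟩, rfl⟩
      simp only [e]
      rw [Function.update_of_ne]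
      · exact h _ (by omega) (by omega)
      · have := d.add_mul_val_ne i (s := 1 - j) (t := 1) (by omega)
        intro h'
        exact this (by linear_combination h')
    · refine ⟨2, le_rfl, ?_⟩
      change IsStart k (macroStep (macroStep _)) ∧ (macroStep (macroStep _)).1.2 = _
      rw [macroStep_filled_ne rfl hc]
      refine hollow _ _ _ fun j hj1 hj2 => ?_
      simp only [e]
      exact h _ (by omega) (by omega)

/-- The reversal of direction is the point: the next sweep goes back over the region of the previous
one, so that two sweeps together do not cover about `2 * k` cells. -/
theorem IsStart.next {k : ℕ} {y : IntConf} (h : IsStart k y) : ∃ s ≤ 3,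
    IsStart k (macroStep^[sweepTime k + s] y) ∧
      (macroStep^[sweepTime k + s] y).1.2 = y.1.2.rev := by
  -- After the macro step that follows the sweep, the return sweep starts at once or the head is at
  -- a longer block of zeros; `IsHigh.next` then needs at most two more.
  suffices H : ∀ x, macroStep^[sweepTime k + 1] y = x → (IsStart k x ∧ x.1.2 = y.1.2.rev) ∨
      (IsHigh k x ∧ (bif x.1.1 then x.1.2.rev else x.1.2) = y.1.2.rev) by
    rcases H _ rfl with ⟨h1, h2⟩ | ⟨h1, h2⟩
    · exact ⟨1, by omega, h1, h2⟩
    · obtain ⟨s, hs, h3, h4⟩ := h1.next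
      rw [← Function.iterate_add_apply] at h3 h4
      have e : s + (sweepTime k + 1) = sweepTime k + (s + 1) := by ring
      rw [e] at h3 h4
      exact ⟨s + 1, by omega, h3, h4.trans (by rw [← h2])⟩
  rintro x rfl
  obtain ⟨⟨f, d⟩, w, i⟩ := y
  rw [Function.iterate_succ_apply', h.iterate rfl]
  have hz := h.1
  have e : ∀ j : ℤ, i + (k + 1) * d.val + j * d.rev.val = i + (k + 1 - j) * d.val := fun j => by
    rw [Dir.val_rev]; ring
  have hne : ∀ j : ℤ, j ≠ 0 → i + (k + 1 - j) * d.val ≠ i + (k + 1) * d.val := fun j hj =>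
    d.add_mul_val_ne i (by omega)
  have e1 : i + k * d.val + d.val = i + (k + 1) * d.val := by ring
  cases f
  · have hc : w (i + (k + 1) * d.val) ≠ 0 := h.2
    have cases3 : ∀ a : Fin 3, a ≠ 0 → a = 1 ∨ a = 2 := by decide
    rcases cases3 _ hc with hc1 | hc1
    · rw [macroStep_hollow_one e1 hc1]
      refine .inr ⟨fun j hj0 hj1 => ?_, rfl⟩
      have e' : i + (k + 1) * d.val - j * d.val = i + (k + 1 - j) * d.val := by ring
      simp only [e']
      rcases eq_or_ne j 0 with rfl | hj
      · simp
      · rw [Function.update_of_ne (hne j hj)]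
        exact hz _ (by omega) (by omega)
    · rw [macroStep_hollow_two e1 hc1]
      have hz' : ∀ j : ℤ, 1 ≤ j → j ≤ k →
          Function.update w (i + (k + 1) * d.val) 0 (i + (k + 1 - j) * d.val) = 0 := by
        intro j h1 h2
        rw [Function.update_of_ne (hne j (by omega))]
        exact hz _ (by omega) (by omega)
      have hi : Function.update w (i + (k + 1) * d.val) 0 i = w i :=
        Function.update_of_ne (by simpa using d.add_mul_val_ne i (s := 0) (t := k + 1) (by omega))
          _ _
      by_cases hA : w i = 0
      · refine .inr ⟨fun j hj0 hj1 => ?_, rfl⟩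
        simp only [e]
        rcases eq_or_ne j (k + 1) with rfl | hj
        · simpa [hi] using hA
        · exact hz' j hj0 (by omega)
      · refine .inl ⟨⟨fun j hj0 hj1 => ?_, ?_⟩, rfl⟩
        · simp only [e]
          exact hz' j hj0 hj1
        · simp only [e]
          simpa [hi] using hA
  · by_cases hc : w (i + (k + 1) * d.val) = 0
    · rw [macroStep_filled_zero e1 hc]
      refine .inl ⟨⟨fun j hj0 hj1 => ?_, by simp⟩, rfl⟩
      simp only [e]
      rw [Function.update_of_ne (hne j (by omega))]
      exact hz _ (by omega) (by omega)
    · rw [macroStep_filled_ne e1 hc]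
      refine .inl ⟨⟨fun j hj0 hj1 => ?_, ?_⟩, rfl⟩
      · simp only [e]
        exact hz _ (by omega) (by omega)
      · simp only [e]
        simpa using h.2

end TM

/-! ### The logarithmic bound for the visited cells -/

namespace TM

theorem iterate_pos_bound (x : IntConf) (n : ℕ) :
    |(macroStep^[n] x).2.2 - x.2.2| ≤ n := by
  induction n with
  | zero => simp
  | succ n ih =>
    rw [Function.iterate_succ_apply']
    have : ∀ y : IntConf, |(macroStep y).2.2 - y.2.2| ≤ 1 := fun y => by
      obtain ⟨⟨f, _ | _⟩, w, i⟩ := y <;> simp [macroStep, Dir.val]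
    have h := this (macroStep^[n] x)
    rw [abs_le] at *
    push_cast
    omega

theorem IsStart.span {k : ℕ} {y : IntConf} (h : IsStart k y) :
    ∃ a : ℤ, ∀ m ≤ 2 * sweepTime k, a ≤ (macroStep^[m] y).2.2 ∧
      (macroStep^[m] y).2.2 ≤ a + k + 9 := by
  obtain ⟨s, hs, hz, hd⟩ := h.next
  set z := macroStep^[sweepTime k + s] y with hzdef
  have he := h.reach.1
  have hpos : ∀ r, |(macroStep^[sweepTime k + r] y).2.2 - (y.2.2 + k * y.1.2.val)| ≤ r := by
    intro r
    have := iterate_pos_bound (macroStep^[sweepTime k] y) r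
    rwa [← Function.iterate_add_apply, add_comm r, he] at this
  have hzp := hpos s
  rw [← hzdef, abs_le] at hzp
  -- The window is placed around the end of the first sweep: the return sweep starts at most `3`
  -- cells away from there and reaches at most `k + 1` cells further.
  refine ⟨y.2.2 + k * y.1.2.val - (match y.1.2 with | .right => k + 4 | .left => 4), ?_⟩
  intro m hm
  rcases le_total m (sweepTime k) with h1 | h1
  · obtain ⟨t, ht0, ht1, ht⟩ := h.reach.2 m h1
    rw [ht]
    cases y.1.2 <;> simp only [Dir.val] <;> omega
  · obtain ⟨r, rfl⟩ := Nat.exists_eq_add_of_le h1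
    rcases le_total r s with h2 | h2
    · have := hpos r
      rw [abs_le] at this
      cases hy : y.1.2 <;> rw [hy] at this <;> simp only [Dir.val] at this ⊢ <;> omega
    · obtain ⟨r, rfl⟩ := Nat.exists_eq_add_of_le h2
      obtain ⟨t, ht0, ht1, ht⟩ := hz.reach.2 r (by omega)
      have e : macroStep^[sweepTime k + (s + r)] y = macroStep^[r] z := by
        rw [hzdef, ← Function.iterate_add_apply]
        congr 1
        omega
      rw [e, ht, hd]
      cases hy : y.1.2 <;> rw [hy] at hzp <;> simp only [Dir.val, Dir.rev] at hzp ⊢ <;> omega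

/-- A configuration inside a sweep is at most `sweepTime k` after its start, so the bound over twice
this time from the start applies. At a longer block of zeros a sweep starts within two macro steps.
-/
theorem iterate_span (k : ℕ) (x : IntConf) :
    ∃ a : ℤ, ∀ m ≤ sweepTime k, a ≤ (macroStep^[m] x).2.2 ∧
      (macroStep^[m] x).2.2 ≤ a + k + 9 := by
  rcases isHigh_or_sweep k x with h | ⟨y, n, hy, hn, rfl⟩
  · obtain ⟨s, hs, hz, -⟩ := h.next
    have hpos : ∀ r, |(macroStep^[r] x).2.2 - x.2.2| ≤ r := iterate_pos_bound x
    have hzp := hpos s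
    set z := macroStep^[s] x with hzdef
    rw [abs_le] at hzp
    refine ⟨z.2.2 - (match z.1.2 with | .right => 4 | .left => k + 5), fun m hm => ?_⟩
    rcases le_total m s with h2 | h2
    · have := hpos m
      rw [abs_le] at this
      cases z.1.2 <;> simp only <;> omega
    · obtain ⟨r, rfl⟩ := Nat.exists_eq_add_of_le h2
      obtain ⟨t, ht0, ht1, ht⟩ := hz.reach.2 r (by omega)
      rw [add_comm s, Function.iterate_add_apply, ← hzdef, ht]
      cases z.1.2 <;> simp only [Dir.val] <;> omega
  · obtain ⟨a, ha⟩ := hy.span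
    refine ⟨a, fun m hm => ?_⟩
    rw [← Function.iterate_add_apply]
    exact ha _ (by omega)

/-- The positions of the head in a computation of SMART are those of a sequence of macro steps. -/
theorem exists_macro_positions {n : ℕ} {x : ℕ → Tape ℤ DecState (Fin 3)}
    (hx : ∀ j < n, decoratedSmart.Step (x j) (x (j + 1))) {i₀ : ℤ} (h₀ : (x 0).HeadAt i₀) :
    ∃ c : IntConf, ∀ j ≤ n, ∀ i, (x j).HeadAt i →
      ∃ m ≤ n + 1, i = (macroStep^[m] c).2.2 := by
  obtain ⟨⟨⟨⟨T, I⟩, e⟩, w, p⟩, h0, -⟩ := (x 0).exists_conf h₀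
  obtain ⟨s, rfl⟩ := triangle_surjective T
  obtain ⟨c, hc⟩ : ∃ c : IntConf, x 0 = macroTape e c ∨
      x 0 = (moveConf c.1 e c.2.1 c.2.2).toTape := by
    cases I
    -- A head of index one has moved but not yet written: it is in the middle of a macro step that
    -- began one cell back.
    · exact ⟨(s, w, p - s.2.val), .inr (by rw [← h0]; simp [moveConf])⟩
    · exact ⟨(s, w, p), .inl (by rw [← h0]; rfl)⟩
  have hD := decoratedSmart_reversible.1
  have inv : ∀ j ≤ n, ∃ m ≤ j, x j = macroTape e (macroStep^[m] c) ∨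
      x j = (moveConf (macroStep^[m] c).1 e (macroStep^[m] c).2.1 (macroStep^[m] c).2.2).toTape := by
    intro j
    induction j with
    | zero => exact fun _ => ⟨0, le_rfl, hc⟩
    | succ j ih =>
      intro hj
      obtain ⟨m, hm, h | h⟩ := ih (by omega)
      · refine ⟨m, by omega, .inr (Machine.step_unique hD (hx j (by omega)) ?_)⟩
        rw [h]
        exact step_move _ _ _ _
      · refine ⟨m + 1, by omega, .inl (Machine.step_unique hD (hx j (by omega)) ?_)⟩
        rw [h, Function.iterate_succ_apply', ← writeConf_moveConf]
        exact step_write _ _ _ _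
  refine ⟨c, fun j hj i hi => ?_⟩
  obtain ⟨m, hm, h | h⟩ := inv j hj
  · rw [h, headAt_macroTape] at hi
    exact ⟨m, by omega, hi⟩
  · rw [h, Conf.headAt_toTape] at hi
    refine ⟨m + 1, by omega, ?_⟩
    rw [Function.iterate_succ_apply', hi]
    rfl

theorem headAt_zero_of_headAt {n : ℕ} {x : ℕ → Tape ℤ DecState (Fin 3)}
    (hx : ∀ j < n, decoratedSmart.Step (x j) (x (j + 1))) {j : ℕ} (hj : j ≤ n) {i : ℤ}
    (h : (x j).HeadAt i) : ∃ i₀, (x 0).HeadAt i₀ := by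
  by_contra! h0
  have : ∀ m ≤ n, x m = x 0 := by
    intro m
    induction m with
    | zero => exact fun _ => rfl
    | succ m ih =>
      intro hm
      refine Machine.step_unique decoratedSmart_reversible.1 (hx m (by omega)) ?_
      rw [ih (by omega)]
      exact .inl ⟨h0, rfl⟩
  rw [this j hj] at h
  exact h0 i h

theorem decoratedSmart_movement_le {k n : ℕ} (hn : n + 1 ≤ sweepTime k) :
    decoratedSmart.movement n ≤ k + 10 := by
  -- The set of lengths is nonempty, since a tape without head visits the empty interval.
  refine csSup_le ⟨0, 0, fun _ => ⟨fun _ => .inl 0, by simp⟩, ?_, ?_⟩ ?_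
  · exact fun j _ => .inl ⟨by simp [Tape.HeadAt], rfl⟩
  · intro i h1 h2
    simp only [CharP.cast_eq_zero] at h2
    omega
  · rintro b ⟨l, x, hx, hv⟩
    by_contra! hb
    obtain ⟨j, hj, hh⟩ := hv l le_rfl (by omega)
    obtain ⟨i₀, h₀⟩ := headAt_zero_of_headAt hx hj hh
    obtain ⟨c, hc⟩ := exists_macro_positions hx h₀
    obtain ⟨a, ha⟩ := iterate_span k c
    have key : ∀ i, l ≤ i → i < l + b → a ≤ i ∧ i ≤ a + k + 9 := by
      intro i h1 h2
      obtain ⟨j, hj, hh⟩ := hv i h1 h2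
      obtain ⟨m, hm, rfl⟩ := hc j hj i hh
      exact ha m (by omega)
    have h1 := key l le_rfl (by omega)
    have h2 := key (l + b - 1) (by omega) (by omega)
    omega

/-- With `k = Nat.log 3 n + 2` a sweep lasts longer than `n` macro steps. The product of logarithms
on the right is `log_3 n`, and `12 = 2 + 10`. -/
theorem decoratedSmart_movement_bound (n : ℕ) :
    (decoratedSmart.movement n : ℝ) ≤ Real.log 2 / Real.log 3 * Real.logb 2 n + 12 := by
  have h1 : n < 3 ^ (Nat.log 3 n + 1) := Nat.lt_pow_succ_log_self (by norm_num) n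
  have h2 := two_mul_sweepTime (Nat.log 3 n + 2)
  have h3 : decoratedSmart.movement n ≤ Nat.log 3 n + 2 + 10 := by
    refine decoratedSmart_movement_le ?_
    rw [pow_succ, pow_succ] at h2
    have : 1 ≤ 3 ^ Nat.log 3 n := Nat.one_le_pow _ _ (by norm_num)
    rw [pow_succ] at h1
    rw [pow_succ] at h2
    omega
  have h4 : (Nat.log 3 n : ℝ) ≤ Real.logb 3 n := by
    exact_mod_cast Real.natLog_le_logb n 3
  have h5 : Real.log 2 / Real.log 3 * Real.logb 2 n = Real.logb 3 n := by
    have : Real.log 2 ≠ 0 := (Real.log_pos (by norm_num)).ne'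
    rw [Real.logb, Real.logb]
    field_simp
  rw [h5]
  have : (decoratedSmart.movement n : ℝ) ≤ (Nat.log 3 n : ℝ) + 2 + 10 := by exact_mod_cast h3
  linarith

end TM

namespace TM

/-! ## The automorphism of the full shift has infinite order -/

/-- The configuration in which a single infinite conveyor belt carries the given tape on its top
track. -/
def beltConf (c : Conf ℤ DecState (Fin 3)) (i : ℤ) : BeltCell DecState (Fin 3) :=
  if i = c.2.2 then .head .top c.1 (fun τ => if τ = .top then c.2.1 i else 0)
  else .bit (fun τ => if τ = .top then c.2.1 i else 0) (if i < c.2.2 then .right else .left)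

theorem beltConf_self (c : Conf ℤ DecState (Fin 3)) :
    beltConf c c.2.2 = .head .top c.1 (fun τ => if τ = .top then c.2.1 c.2.2 else 0) := if_pos rfl

theorem beltConf_lt (c : Conf ℤ DecState (Fin 3)) {i : ℤ} (h : i < c.2.2) :
    beltConf c i = .bit (fun τ => if τ = .top then c.2.1 i else 0) .right := by
  rw [beltConf, if_neg h.ne, if_pos h]

theorem beltConf_gt (c : Conf ℤ DecState (Fin 3)) {i : ℤ} (h : c.2.2 < i) :
    beltConf c i = .bit (fun τ => if τ = .top then c.2.1 i else 0) .left := by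
  rw [beltConf, if_neg h.ne', if_neg h.not_gt]

/-- All bits of the belt point to the head, so the neighbour in the direction of motion always
carries the opposite bit and the head never turns around onto the bottom track. -/
theorem beltConf_move (s : Bool × Dir) (x : Decoration) (w : ℤ → Fin 3) (p : ℤ) :
    beltStep decoratedSmart_reversible.1.trans (beltConf (((triangle s, .two), x), w, p)) =
      beltConf (moveConf s x w p) := by
  have ht : ∀ a, decoratedSmart_reversible.1.trans ((triangle s, .two), x) a =
      .move ((triangle s, .two), x) s.2 ((triangle s, .one), x) := by
    intro a
    refine Machine.CompleteDeterministic.trans_eq _ (.inl ⟨_, _, _, _, ?_, rfl⟩) rfl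
    obtain ⟨_ | _, _ | _⟩ := s <;> simp [smart, triangle]
  set c : Conf ℤ DecState (Fin 3) := (((triangle s, .two), x), w, p) with hc
  have hq : c.1 = ((triangle s, .two), x) := rfl
  have hw : c.2.1 = w := rfl
  have h0 : beltConf c p = .head .top c.1 (fun τ => if τ = .top then c.2.1 p else 0) :=
    beltConf_self c
  have hl : ∀ {i}, i < p → beltConf c i = _ := fun h => beltConf_lt c h
  have hr : ∀ {i}, p < i → beltConf c i = _ := fun h => beltConf_gt c h
  set c' := moveConf s x w p with hc'
  have hq' : c'.1 = ((triangle s, .one), x) := rfl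
  have hw' : c'.2.1 = w := rfl
  have hp' : c'.2.2 = p + s.2.val := rfl
  have h0' := beltConf_self c'
  rw [hp'] at h0'
  have hl' : ∀ {i}, i < p + s.2.val → beltConf c' i = _ := fun h => beltConf_lt c' (by rwa [hp'])
  have hr' : ∀ {i}, p + s.2.val < i → beltConf c' i = _ := fun h => beltConf_gt c' (by rwa [hp'])
  obtain ⟨f, d⟩ := s
  funext i
  cases d <;> simp only [Dir.val] at h0' hl' hr'
  · rcases lt_trichotomy i p with h | rfl | h
    · rw [beltStep, hl h, hl' (by omega)]
      rcases (show i + 1 = p ∨ i + 1 < p by omega) with h' | h'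
      · simp [Dir.val, h', h0, hq, hw, ht, Track.dir, Dir.rev, hw']
      · simp [Dir.val, hl h', hw, hw']
    · rw [beltStep, h0, hl' (by omega)]
      simp [ht, Track.dir, Dir.val, hr (show i < i + 1 by omega), Dir.rev, hq, hw, hw']
    · rw [beltStep, hr h]
      rcases (show i = p + 1 ∨ p + 1 < i by omega) with rfl | h'
      · rw [h0']
        simp [Dir.val, h0, hq, hw, ht, Track.dir, Dir.rev, hq', hw']
      · rw [hr' h']
        simp [Dir.val, hr (show p < i + -1 by omega), hw, hw']
  · rcases lt_trichotomy i p with h | rfl | h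
    · rw [beltStep, hl h]
      rcases (show i = p + -1 ∨ i < p + -1 by omega) with rfl | h'
      · rw [h0']
        simp [Dir.val, h0, hq, hw, ht, Track.dir, Dir.rev, hq', hw']
      · rw [hl' h']
        simp [Dir.val, hl (show i + 1 < p by omega), hw, hw']
    · rw [beltStep, h0, hr' (by omega)]
      simp [ht, Track.dir, Dir.val, hl (show i + -1 < i by omega), Dir.rev, hq, hw, hw']
    · rw [beltStep, hr h, hr' (by omega)]
      rcases (show i + -1 = p ∨ p < i + -1 by omega) with h' | h'
      · simp [Dir.val, h', h0, hq, hw, ht, Track.dir, Dir.rev, hw']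
      · simp [Dir.val, hr h', hw, hw']

theorem beltConf_write (s : Bool × Dir) (x : Decoration) (w : ℤ → Fin 3) (p : ℤ) :
    beltStep decoratedSmart_reversible.1.trans (beltConf (((triangle s, .one), x), w, p)) =
      beltConf (writeConf s x w p) := by
  have ht : ∀ a, decoratedSmart_reversible.1.trans ((triangle s, .one), x) a =
      .write ((triangle s, .one), x) a ((triangle (smartWrite s a).1, .two), x)
        (smartWrite s a).2 := by
    intro a
    refine Machine.CompleteDeterministic.trans_eq _ (.inr ⟨_, _, _, _, _, ?_, rfl⟩) ⟨rfl, rfl⟩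
    obtain ⟨_ | _, _ | _⟩ := s <;> fin_cases a <;> simp [smart, triangle, smartWrite, Dir.rev]
  set c : Conf ℤ DecState (Fin 3) := (((triangle s, .one), x), w, p) with hc
  have hq : c.1 = ((triangle s, .one), x) := rfl
  have hv : c.2.1 = w := rfl
  have h0 : beltConf c p = _ := beltConf_self c
  set c' := writeConf s x w p with hc'
  have h0' : beltConf c' p = _ := beltConf_self c'
  have hw : ∀ i, i ≠ p → c'.2.1 i = w i := fun i hi => Function.update_of_ne hi _ _
  funext i
  rcases lt_trichotomy i p with h | rfl | h
  · rw [beltStep, beltConf_lt c h, beltConf_lt c' h, hw i h.ne]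
    rcases (show i + 1 = p ∨ i + 1 < p by omega) with h' | h'
    · simp [Dir.val, h', h0, hq, hv, ht]
    · simp [Dir.val, beltConf_lt c h', hv]
  · rw [beltStep, h0, h0']
    simp only [hc, ht, hc', writeConf, if_true]
    congr 1
    funext τ
    cases τ <;> simp
  · rw [beltStep, beltConf_gt c h, beltConf_gt c' h, hw i h.ne']
    rcases (show i + -1 = p ∨ p < i + -1 by omega) with h' | h'
    · simp [Dir.val, h', h0, hq, hv, ht]
    · simp [Dir.val, beltConf_gt c h', hv]

theorem beltAction_macroStep (x : Decoration) (c : IntConf) (n : ℕ) :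
    (decoratedSmart_reversible.beltAction ^ (2 * n))
        (beltConf (((triangle c.1, .two), x), c.2.1, c.2.2)) =
      beltConf (((triangle (macroStep^[n] c).1, .two), x), (macroStep^[n] c).2.1,
        (macroStep^[n] c).2.2) := by
  induction n generalizing c with
  | zero => rfl
  | succ n ih =>
    have e : 2 * (n + 1) = 2 * n + 2 := by ring
    rw [e, pow_add, Equiv.Perm.mul_apply, pow_two, Equiv.Perm.mul_apply, Function.iterate_succ_apply,
      ← ih]
    congr 1
    change beltStep _ (beltStep _ _) = _
    rw [beltConf_move]
    exact beltConf_write _ _ _ _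

/-- From a single letter `1` a filled head sweeps `n + 1` cells away. If the `n`-th power were
trivial, the same position would be reached in fewer than `n` macro steps, which is too few. -/
theorem beltAction_not_isOfFinOrder : ¬ IsOfFinOrder decoratedSmart_reversible.beltAction := by
  rw [isOfFinOrder_iff_pow_eq_one]
  rintro ⟨n, hn, h⟩
  set c : IntConf := ((true, .right), Pi.single 0 1, 0) with hc
  have hs : IsStart (n + 1) c := by
    refine ⟨fun j h1 h2 => ?_, by simp [hc]⟩
    have : j ≠ 0 := by omega
    simp [hc, Dir.val, this]
  have hpos : (macroStep^[sweepTime (n + 1)] c).2.2 = n + 1 := by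
    rw [hs.reach.1]
    simp [hc, Dir.val]
  have hper : (macroStep^[sweepTime (n + 1) % n] c).2.2 =
      (macroStep^[sweepTime (n + 1)] c).2.2 := by
    have h1 := beltAction_macroStep (0, 0) c (sweepTime (n + 1))
    have h2 := beltAction_macroStep (0, 0) c (sweepTime (n + 1) % n)
    -- The number of macro steps, not that of steps, is reduced modulo `n`; this keeps the remaining
    -- exponent even.
    have e : 2 * sweepTime (n + 1) = 2 * (sweepTime (n + 1) % n) +
        n * (2 * (sweepTime (n + 1) / n)) := by
      have := Nat.mod_add_div (sweepTime (n + 1)) n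
      rw [mul_left_comm, ← mul_add, this]
    rw [e, pow_add, pow_mul _ n, h, one_pow, mul_one, h2] at h1
    by_contra hne
    have h3 := congrFun h1 (macroStep^[sweepTime (n + 1)] c).2.2
    rw [beltConf, if_neg (Ne.symm hne), beltConf, if_pos rfl] at h3
    exact absurd h3 (by simp)
  have hb := iterate_pos_bound c (sweepTime (n + 1) % n)
  rw [hper, hpos, abs_le] at hb
  have := Nat.mod_lt (sweepTime (n + 1)) hn
  simp only [hc] at hb
  omega

end TM

namespace TM

/-! ## Maps of cyclic tapes of bounded word norm -/

instance : DecidableEq Triangle := fun a b => by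
  cases a <;> cases b <;> first | exact isTrue rfl | exact isFalse (by simp)

instance : DecidableEq Index := fun a b => by
  cases a <;> cases b <;> first | exact isTrue rfl | exact isFalse (by simp)

instance : Fintype Triangle :=
  ⟨{.filledRight, .filledLeft, .hollowRight, .hollowLeft}, fun a => by cases a <;> simp⟩

instance : Fintype Index := ⟨{.one, .two}, fun a => by cases a <;> simp⟩

theorem card_decState : Fintype.card DecState = 96 := rfl

/-- A state, the letters as seen from the head, and the position of the head. -/
abbrev View (ℓ : ℕ) := Conf (ZMod ℓ) DecState (Fin 3)

section

variable {ℓ : ℕ}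

def View.toTape (c : View ℓ) : Tape (ZMod ℓ) DecState (Fin 3) :=
  Conf.toTape (c.1, fun i => c.2.1 (i - c.2.2), c.2.2)

theorem View.toTape_injective : Function.Injective (View.toTape (ℓ := ℓ)) := by
  rintro ⟨q, v, p⟩ ⟨q', v', p'⟩ h
  have := Conf.toTape_injective h
  simp only [Prod.mk.injEq] at this
  obtain ⟨rfl, h, rfl⟩ := this
  have : v = v' := funext fun i => by simpa using congrFun h (i + p)
  rw [this]

theorem Tape.exists_view (x : Tape (ZMod ℓ) DecState (Fin 3)) {i : ZMod ℓ} (h : x.HeadAt i) :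
    ∃ c : View ℓ, c.toTape = x := by
  obtain ⟨⟨q, w, p⟩, rfl, -⟩ := x.exists_conf h
  exact ⟨(q, fun i => w (i + p), p), by simp [View.toTape]⟩

variable [Fact (1 < ℓ)]

/-- `g` is a product of at most `n` generators of the group of cyclic tapes and their inverses. -/
def WordLE (g : Equiv.Perm (Tape (ZMod ℓ) DecState (Fin 3))) (n : ℕ) : Prop :=
  ∃ w : List (Equiv.Perm (Tape (ZMod ℓ) DecState (Fin 3))),
    (∀ s ∈ w, s ∈ instructions (ZMod ℓ) DecState (Fin 3) ∨
      s⁻¹ ∈ instructions (ZMod ℓ) DecState (Fin 3)) ∧ w.prod = g ∧ w.length ≤ n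

theorem WordLE.mul {g h : Equiv.Perm (Tape (ZMod ℓ) DecState (Fin 3))} {n m : ℕ}
    (hg : WordLE g n) (hh : WordLE h m) : WordLE (g * h) (n + m) := by
  obtain ⟨w, hw, rfl, hn⟩ := hg
  obtain ⟨w', hw', rfl, hm⟩ := hh
  refine ⟨w ++ w', fun s hs => ?_, List.prod_append, by simp; omega⟩
  rcases List.mem_append.1 hs with h | h
  exacts [hw s h, hw' s h]

theorem WordLE.inv {g : Equiv.Perm (Tape (ZMod ℓ) DecState (Fin 3))} {n : ℕ}
    (hg : WordLE g n) : WordLE g⁻¹ n := by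
  obtain ⟨w, hw, rfl, hn⟩ := hg
  refine ⟨(w.map (·⁻¹)).reverse, fun s hs => ?_, (List.prod_inv_reverse w).symm, by simpa using hn⟩
  simp only [List.mem_reverse, List.mem_map] at hs
  obtain ⟨t, ht, rfl⟩ := hs
  rw [inv_inv]
  exact (hw t ht).symm

theorem WordLE.mem_cyclicGroup {g : Equiv.Perm (Tape (ZMod ℓ) DecState (Fin 3))} {n : ℕ}
    (hg : WordLE g n) : g ∈ cyclicGroup ℓ DecState (Fin 3) := by
  obtain ⟨w, hw, rfl, -⟩ := hg
  refine Subgroup.list_prod_mem _ fun s hs => ?_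
  rcases hw s hs with h | h
  · exact Subgroup.subset_closure h
  · exact (Subgroup.inv_mem_iff _).1 (Subgroup.subset_closure h)

theorem WordLE.wordNorm_le {g : Equiv.Perm (Tape (ZMod ℓ) DecState (Fin 3))} {n : ℕ}
    (hg : WordLE g n) : wordNorm (instructions (ZMod ℓ) DecState (Fin 3)) g ≤ n := by
  obtain ⟨w, hw, rfl, hn⟩ := hg
  refine le_trans ?_ hn
  unfold wordNorm
  exact Nat.sInf_le ⟨w, hw, rfl, rfl⟩

/-- `g` acts as `f` on the tapes with a head and fixes the tapes without a head. -/
def Realizes (g : Equiv.Perm (Tape (ZMod ℓ) DecState (Fin 3))) (f : View ℓ → View ℓ) : Prop :=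
  (∀ c, g c.toTape = (f c).toTape) ∧ ∀ x : Tape _ _ _, (∀ i, ¬ x.HeadAt i) → g x = x

theorem Realizes.eq {g h : Equiv.Perm (Tape (ZMod ℓ) DecState (Fin 3))} {f : View ℓ → View ℓ}
    (hg : Realizes g f) (hh : Realizes h f) : g = h := by
  ext1 x
  by_cases hx : ∃ i, x.HeadAt i
  · obtain ⟨i, hi⟩ := hx
    obtain ⟨c, rfl⟩ := x.exists_view hi
    rw [hg.1, hh.1]
  · push Not at hx
    rw [hg.2 x hx, hh.2 x hx]

theorem Realizes.mul {g h : Equiv.Perm (Tape (ZMod ℓ) DecState (Fin 3))} {f k : View ℓ → View ℓ}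
    (hg : Realizes g f) (hh : Realizes h k) : Realizes (g * h) (f ∘ k) :=
  ⟨fun c => by rw [Equiv.Perm.mul_apply, hh.1, hg.1]; rfl,
    fun x hx => by rw [Equiv.Perm.mul_apply, hh.2 x hx, hg.2 x hx]⟩

theorem Realizes.inv {g : Equiv.Perm (Tape (ZMod ℓ) DecState (Fin 3))} {f k : View ℓ → View ℓ}
    (hg : Realizes g f) (hk : ∀ c, f (k c) = c) : Realizes g⁻¹ k :=
  ⟨fun c => by rw [Equiv.Perm.inv_eq_iff_eq, hg.1, hk],
    fun x hx => by rw [Equiv.Perm.inv_eq_iff_eq, hg.2 x hx]⟩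

/-- The map `f` is realized by a product of at most `n` generators and their inverses. -/
def CostLE (f : View ℓ → View ℓ) (n : ℕ) : Prop := ∃ g, Realizes g f ∧ WordLE g n

theorem CostLE.mono {f : View ℓ → View ℓ} {n m : ℕ} (h : CostLE f n) (hnm : n ≤ m) :
    CostLE f m := by
  obtain ⟨g, hg, w, hw, hp, hn⟩ := h
  exact ⟨g, hg, w, hw, hp, hn.trans hnm⟩

theorem CostLE.id : CostLE (id : View ℓ → View ℓ) 0 :=
  ⟨1, ⟨fun _ => rfl, fun _ _ => rfl⟩, [], by simp⟩

theorem CostLE.comp {f k : View ℓ → View ℓ} {n m : ℕ} (hf : CostLE f n) (hk : CostLE k m) :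
    CostLE (f ∘ k) (n + m) := by
  obtain ⟨g, hg, hn⟩ := hf
  obtain ⟨h, hh, hm⟩ := hk
  exact ⟨g * h, hg.mul hh, hn.mul hm⟩

theorem CostLE.inv {f k : View ℓ → View ℓ} {n : ℕ} (hf : CostLE f n) (hk : ∀ c, f (k c) = c) :
    CostLE k n := by
  obtain ⟨g, hg, hn⟩ := hf
  exact ⟨g⁻¹, hg.inv hk, hn.inv⟩

theorem CostLE.iterate {f : View ℓ → View ℓ} {n : ℕ} (hf : CostLE f n) (k : ℕ) :
    CostLE f^[k] (k * n) := by
  induction k with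
  | zero => simpa using CostLE.id
  | succ k ih =>
    rw [Function.iterate_succ']
    exact (hf.comp ih).mono (by linarith)

/-- The gate that applies `f` to the state and to the letter at distance `i` from the head. -/
def gateAt (i : ZMod ℓ) (f : Equiv.Perm (DecState × Fin 3)) (c : View ℓ) : View ℓ :=
  ((f (c.1, c.2.1 i)).1, Function.update c.2.1 i (f (c.1, c.2.1 i)).2, c.2.2)

theorem costLE_gateAt_zero (f : Equiv.Perm (DecState × Fin 3)) :
    CostLE (gateAt (ℓ := ℓ) 0 f) 1 := by
  refine ⟨gate f, ⟨fun ⟨q, v, p⟩ => Subtype.ext (funext fun i => ?_), fun x hx => ?_⟩,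
    [gate f], by simp [instructions], by simp, le_rfl⟩
  · change ((View.toTape (q, v, p)).1 i).map id f = _
    simp only [View.toTape, Conf.toTape_apply, gateAt]
    by_cases hi : i = p
    · subst hi
      simp
    · have : i - p ≠ 0 := sub_ne_zero.2 hi
      simp [hi, this]
  · refine Subtype.ext (funext fun i => ?_)
    change (x.1 i).map id f = _
    have := hx i
    unfold Tape.HeadAt at this
    rcases h : x.1 i with a | a
    · rfl
    · simp [h] at this

/-- The head moves one cell to the right if its state is in `A`. -/
def moveIn (A : Finset DecState) (c : View ℓ) : View ℓ :=
  if c.1 ∈ A then (c.1, fun j => c.2.1 (j + 1), c.2.2 + 1) else c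

theorem costLE_moveIn_singleton (q : DecState) : CostLE (moveIn (ℓ := ℓ) {q}) 1 := by
  refine ⟨stateMove q, ⟨fun ⟨q', v, p⟩ => Subtype.ext (funext fun i => ?_), fun x hx => ?_⟩,
    [stateMove q], fun s hs => ?_, by simp, le_rfl⟩
  rotate_left 2
  · rw [List.mem_singleton.1 hs]
    exact .inl (.inr ⟨q, rfl⟩)
  · change stateMoveFun q 1 _ i = _
    have hs : ∀ j, ((View.toTape (q', v, p)).1 j).HasState q ↔ j = p ∧ q' = q := by
      intro j
      simp only [View.toTape, Conf.toTape_apply, Symbol.HasState]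
      split_ifs with h <;> simp [h]
    have hl : ∀ j, ((View.toTape (q', v, p)).1 j).letter = v (j - p) := fun j =>
      Conf.letter_toTape _ _
    rw [stateMoveFun]
    simp only [hs, hl, moveIn, Finset.mem_singleton]
    by_cases hq : q' = q
    · subst hq
      have e : v (i - (p + 1) + 1) = v (i - p) := by congr 1; ring
      simp only [and_true, if_true, View.toTape, Conf.toTape_apply, sub_eq_iff_eq_add, e]
      by_cases h : i = p + 1 <;> by_cases h' : i = p <;> simp [h, h']
    · simp [hq]
  · refine Subtype.ext (funext fun i => ?_)
    change stateMoveFun q 1 _ i = _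
    have : ∀ j, ¬ (x.1 j).HasState q := by
      rintro j ⟨a, ha⟩
      exact hx j (by simp [Tape.HeadAt, ha])
    simp [stateMoveFun, this]

/-- Moves do not change the state, so at most one of the moves for distinct states acts. -/
theorem costLE_moveIn (A : Finset DecState) : CostLE (moveIn (ℓ := ℓ) A) A.card := by
  induction A using Finset.induction_on with
  | empty => exact CostLE.id
  | insert q A hq ih =>
    have : moveIn (ℓ := ℓ) (insert q A) = moveIn {q} ∘ moveIn A := by
      funext c
      by_cases h1 : c.1 = q
      · simp [moveIn, h1, hq]
      · by_cases h2 : c.1 ∈ A <;> simp [moveIn, h1, h2]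
    rw [this, Finset.card_insert_of_notMem hq, add_comm]
    exact (costLE_moveIn_singleton q).comp ih

theorem card_le_96 (A : Finset DecState) : A.card ≤ 96 :=
  card_decState ▸ Finset.card_le_univ A

/-- The head moves by `i` cells. -/
def shiftView (i : ZMod ℓ) (c : View ℓ) : View ℓ := (c.1, fun j => c.2.1 (j + i), c.2.2 + i)

theorem costLE_shiftView (n : ℕ) : CostLE (shiftView (ℓ := ℓ) n) (96 * n) := by
  have e : (moveIn (ℓ := ℓ) Finset.univ)^[n] = shiftView n := by
    induction n with
    | zero => funext c; simp [shiftView]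
    | succ n ih =>
      rw [Function.iterate_succ', ih]
      funext c
      have : ∀ j : ZMod ℓ, j + 1 + n = j + (n + 1) := fun j => by ring
      simp [moveIn, shiftView, add_assoc, this]
  have h := (costLE_moveIn (ℓ := ℓ) Finset.univ).iterate n
  rw [e] at h
  exact h.mono (by rw [mul_comm]; exact Nat.mul_le_mul_right _ (card_le_96 _))

theorem costLE_shiftView_neg (n : ℕ) : CostLE (shiftView (-(n : ZMod ℓ))) (96 * n) :=
  (costLE_shiftView n).inv fun c => by simp [shiftView]

theorem CostLE.conj_shift {f k : View ℓ → View ℓ} {a : ℕ} (hf : CostLE f a) (n : ℕ)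
    (h : ∀ c, shiftView (-(n : ZMod ℓ)) (f (shiftView (n : ZMod ℓ) c)) = k c) : CostLE k (a + 192 * n) := by
  have := ((costLE_shiftView_neg n).comp hf).comp (costLE_shiftView n)
  have e : (shiftView (-(n : ZMod ℓ)) ∘ f) ∘ shiftView (n : ZMod ℓ) = k := funext h
  rw [e] at this
  exact this.mono (by omega)

/-- The head carries its state to the cell, applies the gate there and returns. Moving one cell in
all of the 96 states costs 96, hence 192 per cell for the round trip. -/
theorem costLE_gateAt (i : ZMod ℓ) (f : Equiv.Perm (DecState × Fin 3)) :
    CostLE (gateAt i f) (193 * ℓ) := by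
  have : NeZero ℓ := ⟨by have := Fact.out (p := 1 < ℓ); omega⟩
  refine ((costLE_gateAt_zero f).conj_shift (k := gateAt i f) i.val fun c => ?_).mono ?_
  · rw [ZMod.natCast_zmod_val]
    obtain ⟨q, v, p⟩ := c
    simp only [shiftView, gateAt, zero_add, add_neg_cancel_right, Prod.mk.injEq, true_and, and_true]
    funext j
    by_cases hj : j = i
    · subst hj; simp
    · have : j + -i ≠ 0 := by rwa [← sub_eq_add_neg, sub_ne_zero]
      simp [hj, this]
  · have h1 := ZMod.val_lt i
    omega

end

end TM

namespace TM

/-! ## Permutations of the state controlled by the tape -/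

/-- Words are padded to length `2 ^ m`; halving `m` times with a factor of four each time then costs
`O(ℓ ^ 2)`. -/
theorem exists_two_pow {ℓ : ℕ} (hℓ : 0 < ℓ) : ∃ m, ℓ ≤ 2 ^ m ∧ 4 ^ m ≤ 4 * ℓ ^ 2 := by
  have h : ∃ m, ℓ ≤ 2 ^ m := ⟨ℓ, Nat.lt_two_pow_self.le⟩
  refine ⟨Nat.find h, Nat.find_spec h, ?_⟩
  have h4 : ∀ m, 4 ^ m = 2 ^ m * 2 ^ m := fun m => by rw [← mul_pow]; norm_num
  rw [h4]
  rcases hm : Nat.find h with _ | m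
  · nlinarith
  · have := Nat.find_min h (m := m) (by omega)
    rw [pow_succ]
    have h5 : 2 ^ m * 2 ^ m ≤ ℓ * ℓ := Nat.mul_le_mul (by omega) (by omega)
    linarith [sq ℓ]

section

variable {ℓ : ℕ}

open Classical in
/-- The permutation `σ` is applied to the state if the letters satisfy `P`. -/
noncomputable def condState (P : (ZMod ℓ → Fin 3) → Prop) (σ : Equiv.Perm DecState) (c : View ℓ) :
    View ℓ := (if P c.2.1 then σ c.1 else c.1, c.2)

variable [Fact (1 < ℓ)]

/-- Every three-cycle of the states, controlled by `P`, has cost at most `n`. -/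
def PredCost (P : (ZMod ℓ → Fin 3) → Prop) (n : ℕ) : Prop :=
  ∀ σ : Equiv.Perm DecState, σ.IsThreeCycle → CostLE (condState P σ) n

/-- Two three-cycles with exactly one common point have a three-cycle as commutator, so five states
suffice. -/
theorem exists_commutator_isThreeCycle :
    ∃ a b : Equiv.Perm DecState, a.IsThreeCycle ∧ b.IsThreeCycle ∧
      (a * b * a⁻¹ * b⁻¹).IsThreeCycle := by
  let ι : Fin 5 ↪ DecState := ⟨fun i => ((.filledRight, .one), (0, i.castSucc)), by
    decide⟩
  let e := Equiv.ofInjective ι ι.injective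
  have key : ∀ s : Equiv.Perm (Fin 5), s.IsThreeCycle →
      (Equiv.Perm.extendDomainHom e s).IsThreeCycle := fun s hs =>
    (Equiv.Perm.cycleType_extendDomain e).trans hs
  let a : Equiv.Perm (Fin 5) := Equiv.swap 0 1 * Equiv.swap 0 2
  let b : Equiv.Perm (Fin 5) := Equiv.swap 0 3 * Equiv.swap 0 4
  have h : (a * b * a⁻¹ * b⁻¹).IsThreeCycle := by
    rw [← _root_.card_support_eq_three_iff]
    decide
  refine ⟨Equiv.Perm.extendDomainHom e a, Equiv.Perm.extendDomainHom e b,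
    key _ (Equiv.Perm.isThreeCycle_swap_mul_swap_same (by decide) (by decide) (by decide)),
    key _ (Equiv.Perm.isThreeCycle_swap_mul_swap_same (by decide) (by decide) (by decide)), ?_⟩
  have := key _ h
  rwa [map_mul, map_mul, map_mul, map_inv, map_inv] at this

theorem Equiv.Perm.IsThreeCycle.exists_commutator {σ : Equiv.Perm DecState}
    (hσ : σ.IsThreeCycle) : ∃ a b : Equiv.Perm DecState, a.IsThreeCycle ∧ b.IsThreeCycle ∧
      a * b * a⁻¹ * b⁻¹ = σ := by
  obtain ⟨a, b, ha, hb, h⟩ := exists_commutator_isThreeCycle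
  obtain ⟨g, hg⟩ := isConj_iff.1 (Equiv.Perm.isConj_iff_cycleType_eq.2 (h.trans hσ.symm))
  refine ⟨g * a * g⁻¹, g * b * g⁻¹, ?_, ?_, ?_⟩
  · rw [Equiv.Perm.IsThreeCycle, Equiv.Perm.cycleType_conj]; exact ha
  · rw [Equiv.Perm.IsThreeCycle, Equiv.Perm.cycleType_conj]; exact hb
  · rw [← hg]; group

theorem PredCost.mono {P : (ZMod ℓ → Fin 3) → Prop} {n m : ℕ} (h : PredCost P n) (hnm : n ≤ m) :
    PredCost P m := fun σ hσ => (h σ hσ).mono hnm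

/-- Barrington's trick: if `P` controls `a` and `P'` controls `b`, the commutator of the two
controlled permutations is trivial unless both conditions hold. Each of the two is used twice. -/
theorem PredCost.and {P P' : (ZMod ℓ → Fin 3) → Prop} {n m : ℕ} (h : PredCost P n)
    (h' : PredCost P' m) : PredCost (fun v => P v ∧ P' v) (2 * n + 2 * m) := by
  intro σ hσ
  obtain ⟨a, b, ha, hb, rfl⟩ := Equiv.Perm.IsThreeCycle.exists_commutator hσ
  have := (((h a ha).comp (h' b hb)).comp (h a⁻¹ ha.inv)).comp (h' b⁻¹ hb.inv)
  convert this.mono (m := 2 * n + 2 * m) (by omega) using 1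
  funext c
  by_cases h1 : P c.2.1 <;> by_cases h2 : P' c.2.1 <;> simp [condState, h1, h2]

/-- Disjointness ensures that the permutation is applied at most once, so the costs only add. -/
theorem PredCost.or {P P' : (ZMod ℓ → Fin 3) → Prop} {n m : ℕ} (h : PredCost P n)
    (h' : PredCost P' m) (hd : ∀ v, P v → ¬ P' v) : PredCost (fun v => P v ∨ P' v) (n + m) := by
  intro σ hσ
  convert (h σ hσ).comp (h' σ hσ) using 1
  funext c
  have := hd c.2.1
  by_cases h1 : P c.2.1 <;> by_cases h2 : P' c.2.1 <;> simp_all [condState]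

theorem PredCost.congr {P P' : (ZMod ℓ → Fin 3) → Prop} {n : ℕ} (h : PredCost P n)
    (e : ∀ v, P' v ↔ P v) : PredCost P' n := by
  rwa [show P' = P from funext fun v => propext (e v)]

theorem PredCost.translate {P : (ZMod ℓ → Fin 3) → Prop} {n : ℕ} (h : PredCost P n) (k : ℕ) :
    PredCost (fun v => P fun j => v (j + (k : ZMod ℓ))) (n + 192 * k) := fun σ hσ =>
  (h σ hσ).conj_shift k fun c => by
    obtain ⟨q, v, p⟩ := c
    simp only [condState, shiftView, add_neg_cancel_right, neg_add_cancel_right]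
    rfl

theorem predCost_mem (A : Finset (Fin 3)) : PredCost (ℓ := ℓ) (fun v => v 0 ∈ A) 1 := by
  intro σ _
  convert costLE_gateAt_zero (ℓ := ℓ)
    (Equiv.prodCongrLeft fun a => if a ∈ A then σ else 1) using 1
  funext c
  by_cases h : c.2.1 0 ∈ A <;> simp [condState, gateAt, h]

/-- The word is halved, and the condition on the upper half is read after a move by `2 ^ m` cells.
The cost solves `c (m + 1) = 4 * c m + 384 * 2 ^ m` with `c 0 = 1`; treating the letters one by one
would be exponential. -/
theorem predCost_forall_two_pow (m : ℕ) (E : ℕ → Finset (Fin 3)) :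
    PredCost (ℓ := ℓ) (fun v => ∀ i < 2 ^ m, v (i : ℕ) ∈ E i) (193 * 4 ^ m - 192 * 2 ^ m) := by
  induction m generalizing E with
  | zero => exact (predCost_mem (E 0)).congr fun v => by simp
  | succ m ih =>
    refine (((ih E).and ((ih fun i => E (i + 2 ^ m)).translate (2 ^ m))).congr
      fun v => ⟨fun h => ⟨fun i hi => h i (by rw [pow_succ]; omega), fun i hi => ?_⟩,
      fun h i hi => ?_⟩).mono ?_
    · have := h (i + 2 ^ m) (by rw [pow_succ]; omega)
      simpa using this
    · by_cases h' : i < 2 ^ m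
      · exact h.1 i h'
      · have := h.2 (i - 2 ^ m) (by rw [pow_succ] at hi; omega)
        obtain ⟨j, rfl⟩ := Nat.exists_eq_add_of_le (not_lt.1 h')
        simpa [add_comm] using this
    · have : 2 ^ m ≤ 4 ^ m := Nat.pow_le_pow_left (by norm_num) m
      rw [pow_succ, pow_succ]
      omega

/-- The deciding letter lies in the upper half, or it lies in the lower half while all of the upper
half is in the sets `E`. These cases exclude each other. The comparison recurs with factor `1 + 2 =
3 < 4`, so the condition on the upper half keeps the cost of order `4 ^ m`. -/
theorem predCost_lex_two_pow (m : ℕ) (E G : ℕ → Finset (Fin 3)) (h : ∀ j, Disjoint (E j) (G j)) :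
    PredCost (ℓ := ℓ) (fun v => ∃ j < 2 ^ m, v (j : ℕ) ∈ G j ∧
      ∀ i, j < i → i < 2 ^ m → v (i : ℕ) ∈ E i) (1000 * 4 ^ m - 576 * 2 ^ m) := by
  induction m generalizing E G with
  | zero =>
    refine ((predCost_mem (G 0)).congr fun v => ?_).mono (by norm_num)
    constructor
    · rintro ⟨j, hj, h, -⟩
      obtain rfl : j = 0 := by simpa using hj
      simpa using h
    · exact fun h => ⟨0, by simp, by simpa using h, fun i h1 h2 => by simp at h2; omega⟩
  | succ m ih =>
    have hi := (ih (fun i => E (i + 2 ^ m)) (fun i => G (i + 2 ^ m)) fun j => h _).translate (2 ^ m)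
    have lo := (ih E G h).and
      ((predCost_forall_two_pow m fun i => E (i + 2 ^ m)).translate (2 ^ m))
    refine ((hi.or lo ?_).congr fun v => ?_).mono ?_
    · rintro v ⟨j, hj, h1, -⟩ ⟨-, h2⟩
      exact Finset.disjoint_left.1 (h _) (h2 j hj) h1
    · have sum : ∀ i : ℕ, v ((i : ZMod ℓ) + (2 ^ m : ℕ)) = v ((i + 2 ^ m : ℕ) : ZMod ℓ) := by simp
      simp only [sum]
      constructor
      · rintro ⟨j, hj, h1, h2⟩
        rw [pow_succ] at hj h2
        by_cases hj' : j < 2 ^ m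
        · exact .inr ⟨⟨j, hj', h1, fun i h3 h4 => h2 i h3 (by omega)⟩,
            fun i hi => h2 _ (by omega) (by omega)⟩
        · obtain ⟨k, rfl⟩ := Nat.exists_eq_add_of_le (not_lt.1 hj')
          refine .inl ⟨k, by omega, by rwa [add_comm], fun i h3 h4 => h2 _ (by omega) (by omega)⟩
      · rintro (⟨j, hj, h1, h2⟩ | ⟨⟨j, hj, h1, h2⟩, h3⟩)
        · refine ⟨j + 2 ^ m, by rw [pow_succ]; omega, h1, fun i h3 h4 => ?_⟩
          rw [pow_succ] at h4
          obtain ⟨k, rfl⟩ := Nat.exists_eq_add_of_le (show 2 ^ m ≤ i by omega)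
          rw [add_comm]
          exact h2 k (by omega) (by omega)
        · refine ⟨j, by rw [pow_succ]; omega, h1, fun i h4 h5 => ?_⟩
          rw [pow_succ] at h5
          by_cases hi' : i < 2 ^ m
          · exact h2 i h4 hi'
          · obtain ⟨k, rfl⟩ := Nat.exists_eq_add_of_le (not_lt.1 hi')
            rw [add_comm]
            exact h3 k (by omega)
    · have : 2 ^ m ≤ 4 ^ m := Nat.pow_le_pow_left (by norm_num) m
      rw [pow_succ, pow_succ]
      omega

/-- The padding positions from `k` on impose no condition and can never be the deciding ones, so it
does no harm that `2 ^ m` may exceed `ℓ` and indices wrap around. -/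
theorem predCost_lex (k : ℕ) (hk : k ≤ ℓ) (E G : ℕ → Finset (Fin 3))
    (hd : ∀ j, Disjoint (E j) (G j)) :
    PredCost (ℓ := ℓ) (fun v => ∃ j < k, v (j : ℕ) ∈ G j ∧ ∀ i, j < i → i < k → v (i : ℕ) ∈ E i)
      (4000 * ℓ ^ 2) := by
  obtain ⟨m, h1, h2⟩ := exists_two_pow (ℓ := ℓ) (by have := Fact.out (p := 1 < ℓ); omega)
  refine ((predCost_lex_two_pow m (fun i => if i < k then E i else Finset.univ)
    (fun i => if i < k then G i else ∅) fun j => ?_).congr fun v => ?_).mono (by omega)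
  · split_ifs
    exacts [hd j, by simp]
  · constructor
    · rintro ⟨j, hj, h3, h4⟩
      refine ⟨j, by omega, by simpa [hj] using h3, fun i h5 h6 => ?_⟩
      split_ifs with h'
      exacts [h4 i h5 h', by simp]
    · rintro ⟨j, hj, h3, h4⟩
      by_cases h' : j < k
      · refine ⟨j, h', by simpa [h'] using h3, fun i h5 h6 => ?_⟩
        simpa [h6] using h4 i h5 (by omega)
      · simp [h'] at h3

end

end TM

namespace TM

/-! ## Controlled gates -/

/-- Three-cycles generate the alternating group; the bound on the length is uniform because the
group is finite. -/
theorem exists_threeCycle_factors (α : Type) [Fintype α] [DecidableEq α] :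
    ∃ K : ℕ, ∀ g : Equiv.Perm α, Equiv.Perm.sign g = 1 →
      ∃ w : List (Equiv.Perm α), (∀ s ∈ w, s.IsThreeCycle) ∧ w.prod = g ∧ w.length ≤ K := by
  have key : ∀ g : Equiv.Perm α, ∃ w : List (Equiv.Perm α), Equiv.Perm.sign g = 1 →
      (∀ s ∈ w, s.IsThreeCycle) ∧ w.prod = g := by
    intro g
    by_cases hg : Equiv.Perm.sign g = 1
    · have : g ∈ Subgroup.closure {σ : Equiv.Perm α | σ.IsThreeCycle} := by
        rw [Equiv.Perm.closure_three_cycles_eq_alternating]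
        exact Equiv.Perm.mem_alternatingGroup.2 hg
      suffices h : ∃ w : List (Equiv.Perm α), (∀ s ∈ w, s.IsThreeCycle) ∧ w.prod = g from
        h.imp fun w hw _ => hw
      induction this using Subgroup.closure_induction with
      | mem s hs => exact ⟨[s], by simpa using hs, by simp⟩
      | one => exact ⟨[], by simp⟩
      | mul f g hf hg' ihf ihg =>
        obtain ⟨w, hw, rfl⟩ := ihf (Equiv.Perm.mem_alternatingGroup.1
          (by rwa [← Equiv.Perm.closure_three_cycles_eq_alternating]))
        obtain ⟨w', hw', rfl⟩ := ihg (Equiv.Perm.mem_alternatingGroup.1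
          (by rwa [← Equiv.Perm.closure_three_cycles_eq_alternating]))
        exact ⟨w ++ w', fun s hs => (List.mem_append.1 hs).elim (hw s) (hw' s), List.prod_append⟩
      | inv f hf ih =>
        obtain ⟨w, hw, rfl⟩ := ih (Equiv.Perm.mem_alternatingGroup.1
          (by rwa [← Equiv.Perm.closure_three_cycles_eq_alternating]))
        refine ⟨(w.map (·⁻¹)).reverse, fun s hs => ?_, (List.prod_inv_reverse w).symm⟩
        simp only [List.mem_reverse, List.mem_map] at hs
        obtain ⟨t, ht, rfl⟩ := hs
        exact (hw t ht).inv
    · exact ⟨[], fun h => absurd h hg⟩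
  choose w hw using key
  exact ⟨Finset.univ.sup fun g => (w g).length, fun g hg =>
    ⟨w g, (hw g hg).1, (hw g hg).2,
      Finset.le_sup (f := fun g => (w g).length) (Finset.mem_univ g)⟩⟩

/-- `P` depends only on the letters outside of `S`. -/
def IndepOf {ℓ : ℕ} (P : (ZMod ℓ → Fin 3) → Prop) (S : Set (ZMod ℓ)) : Prop :=
  ∀ v v', (∀ i, i ∉ S → v i = v' i) → (P v ↔ P v')

open Classical in
/-- `gateAt i g`, applied if the letters satisfy `P`. -/
noncomputable def condGate {ℓ : ℕ} (P : (ZMod ℓ → Fin 3) → Prop) (i : ZMod ℓ)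
    (g : Equiv.Perm (DecState × Fin 3)) (c : View ℓ) : View ℓ :=
  if P c.2.1 then gateAt i g c else c

theorem gateAt_mul {ℓ : ℕ} (i : ZMod ℓ) (f g : Equiv.Perm (DecState × Fin 3)) (c : View ℓ) :
    gateAt i (f * g) c = gateAt i f (gateAt i g c) := by
  simp [gateAt]

theorem gateAt_one {ℓ : ℕ} (i : ZMod ℓ) (c : View ℓ) : gateAt i 1 c = c := by
  simp [gateAt]

theorem IndepOf.gateAt_iff {ℓ : ℕ} {P : (ZMod ℓ → Fin 3) → Prop} {i : ZMod ℓ}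
    (h : IndepOf P {i}) (g : Equiv.Perm (DecState × Fin 3)) (c : View ℓ) :
    P (gateAt i g c).2.1 ↔ P c.2.1 :=
  h _ _ fun j hj => by
    have : j ≠ i := hj
    simp [gateAt, this]

theorem condGate_mul {ℓ : ℕ} {P : (ZMod ℓ → Fin 3) → Prop} {i : ZMod ℓ} (h : IndepOf P {i})
    (f g : Equiv.Perm (DecState × Fin 3)) :
    condGate P i (f * g) = condGate P i f ∘ condGate P i g := by
  funext c
  by_cases hc : P c.2.1
  · simp [condGate, hc, gateAt_mul, h.gateAt_iff]
  · simp [condGate, hc]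

theorem condState_mul {ℓ : ℕ} (P : (ZMod ℓ → Fin 3) → Prop) (σ τ : Equiv.Perm DecState) :
    condState P (σ * τ) = condState P σ ∘ condState P τ := by
  funext c
  by_cases hc : P c.2.1 <;> simp [condState, hc]

section

variable {ℓ : ℕ} [Fact (1 < ℓ)]

/-- The commutator of `σ` with a transposition is the product of two transpositions. They share
exactly one point because `σ` fixes one of the two states involved and moves the other. -/
theorem exists_commutator_gate : ∃ (σ : Equiv.Perm DecState) (h : Equiv.Perm (DecState × Fin 3)),
    σ.IsThreeCycle ∧
    Equiv.Perm.IsThreeCycle ((Equiv.prodCongrLeft fun _ => σ : Equiv.Perm (DecState × Fin 3)) * h *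
      (Equiv.prodCongrLeft fun _ => σ : Equiv.Perm (DecState × Fin 3))⁻¹ * h⁻¹) := by
  let s : Fin 4 → DecState := fun i => ((.filledRight, .one), (0, i.castLE (by norm_num)))
  have hs : ∀ i j, s i = s j ↔ i = j := by decide
  let σ : Equiv.Perm DecState := Equiv.swap (s 0) (s 1) * Equiv.swap (s 0) (s 2)
  have hσ : σ.IsThreeCycle := Equiv.Perm.isThreeCycle_swap_mul_swap_same
    (by rw [Ne, hs]; decide) (by rw [Ne, hs]; decide) (by rw [Ne, hs]; decide)
  refine ⟨σ, Equiv.swap (s 3, 0) (s 0, 0), hσ, ?_⟩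
  rw [← Equiv.swap_apply_apply, Equiv.swap_inv]
  have e1 : Equiv.prodCongrLeft (fun _ : Fin 3 => σ) (s 3, 0) = (s 3, 0) := by
    simp only [Equiv.prodCongrLeft_apply, σ, Equiv.Perm.mul_apply]
    have h4 : Equiv.swap (s 0) (s 2) (s 3) = s 3 := Equiv.swap_apply_of_ne_of_ne
      (by rw [Ne, hs]; decide) (by rw [Ne, hs]; decide)
    rw [h4, Equiv.swap_apply_of_ne_of_ne] <;> rw [Ne, hs] <;> decide
  have e2 : Equiv.prodCongrLeft (fun _ : Fin 3 => σ) (s 0, 0) = (s 2, 0) := by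
    simp only [Equiv.prodCongrLeft_apply, σ, Equiv.Perm.mul_apply]
    rw [Equiv.swap_apply_left, Equiv.swap_apply_of_ne_of_ne] <;> rw [Ne, hs] <;> decide
  rw [e1, e2]
  refine Equiv.Perm.isThreeCycle_swap_mul_swap_same ?_ ?_ ?_ <;>
    rw [Ne, Prod.mk.injEq, hs] <;> decide

/-- Only the state permutation in the commutator is controlled; if `P` fails, the uncontrolled gates
cancel. Independence of the `i`-th letter keeps the truth value of `P` constant meanwhile. Four
gates at distance cost `4 * 193 * ℓ`. -/
theorem PredCost.condGate_threeCycle {P : (ZMod ℓ → Fin 3) → Prop} {n : ℕ} (hP : PredCost P n)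
    {i : ZMod ℓ} (hi : IndepOf P {i}) {g : Equiv.Perm (DecState × Fin 3)} (hg : g.IsThreeCycle) :
    CostLE (condGate P i g) (2 * n + 772 * ℓ) := by
  obtain ⟨σ, h, hσ, h3⟩ := exists_commutator_gate
  obtain ⟨f, rfl⟩ := isConj_iff.1 (Equiv.Perm.isConj_iff_cycleType_eq.2 (h3.trans hg.symm))
  have := (((((costLE_gateAt i f).comp (hP σ hσ)).comp (costLE_gateAt i h)).comp
    (hP σ⁻¹ hσ.inv)).comp (costLE_gateAt i h⁻¹)).comp (costLE_gateAt i f⁻¹)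
  convert this.mono (m := 2 * n + 772 * ℓ) (by omega) using 1
  have hs : ∀ τ : Equiv.Perm DecState,
      condState P τ = condGate P i (Equiv.prodCongrLeft fun _ => τ) := by
    intro τ
    funext c
    by_cases hc : P c.2.1 <;> simp [condState, condGate, hc, gateAt]
  have hinv : (Equiv.prodCongrLeft fun _ => σ⁻¹ : Equiv.Perm (DecState × Fin 3)) =
    (Equiv.prodCongrLeft fun _ => σ : Equiv.Perm (DecState × Fin 3))⁻¹ := rfl
  rw [hs, hs, hinv]
  funext c
  by_cases hc : P c.2.1
  · simp only [condGate, hc, Function.comp, hi.gateAt_iff, if_true, gateAt_mul]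
  · simp only [condGate, hc, Function.comp, hi.gateAt_iff, if_false, ← gateAt_mul]
    simp [gateAt_one]

end

/-- The permutation of the decorated states that does not read the decorations. -/
def liftState (τ : Equiv.Perm SmartState) : Equiv.Perm DecState := Equiv.prodCongrLeft fun _ => τ

/-- The gate that does not read the decorations. -/
def liftGate (g : Equiv.Perm (SmartState × Fin 3)) : Equiv.Perm (DecState × Fin 3) :=
  Equiv.permCongr (⟨fun x => ((x.1.1, x.2), x.1.2), fun y => ((y.1.1, y.2), y.1.2),
    fun _ => rfl, fun _ => rfl⟩ : (SmartState × Fin 3) × Decoration ≃ DecState × Fin 3)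
    (Equiv.prodCongrLeft fun _ => g)

/-- This is what the decorations are for: `τ` acts on twelve disjoint copies of the states, and the
twelfth power of a sign is `1`. -/
theorem sign_liftState (τ : Equiv.Perm SmartState) : Equiv.Perm.sign (liftState τ) = 1 := by
  rw [liftState, Equiv.Perm.sign_prodCongrLeft, Finset.prod_const]
  rcases Int.units_eq_one_or (Equiv.Perm.sign τ) with h | h <;> rw [h] <;> decide

theorem sign_liftGate (g : Equiv.Perm (SmartState × Fin 3)) :
    Equiv.Perm.sign (liftGate g) = 1 := by
  rw [liftGate, Equiv.Perm.sign_permCongr, Equiv.Perm.sign_prodCongrLeft, Finset.prod_const]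
  rcases Int.units_eq_one_or (Equiv.Perm.sign g) with h | h <;> rw [h] <;> decide

/-- Arbitrary permutations that ignore the decorations are factored into boundedly many
three-cycles. The constant depends on the alphabet and the states only, not on the length of the
tape. -/
theorem exists_gateConst : ∃ K : ℕ, ∀ (ℓ : ℕ) [Fact (1 < ℓ)] (P : (ZMod ℓ → Fin 3) → Prop) (n : ℕ),
    PredCost P n → (∀ τ, CostLE (condState P (liftState τ)) (K * n)) ∧
      ∀ i, IndepOf P {i} → ∀ g, CostLE (condGate P i (liftGate g)) (K * (n + ℓ)) := by
  obtain ⟨K, hK⟩ := exists_threeCycle_factors DecState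
  obtain ⟨L, hL⟩ := exists_threeCycle_factors (DecState × Fin 3)
  refine ⟨max K (772 * L), fun ℓ _ P n hP => ⟨fun τ => ?_, fun i hi g => ?_⟩⟩
  · obtain ⟨w, hw, h, hl⟩ := hK _ (sign_liftState τ)
    rw [← h]
    have : CostLE (condState P w.prod) (w.length * n) := by
      clear h hl
      induction w with
      | nil =>
        rw [show condState P [].prod = id from funext fun c => by simp [condState]]
        exact CostLE.id.mono (Nat.zero_le _)
      | cons s w ih =>
        rw [List.prod_cons, condState_mul]
        refine ((hP s (hw s (by simp))).comp (ih fun t ht => hw t (by simp [ht]))).mono ?_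
        simp only [List.length_cons]
        linarith
    exact this.mono (Nat.mul_le_mul_right _ (hl.trans (le_max_left _ _)))
  · obtain ⟨w, hw, h, hl⟩ := hL _ (sign_liftGate g)
    rw [← h]
    have : CostLE (condGate P i w.prod) (w.length * (2 * n + 772 * ℓ)) := by
      clear h hl
      induction w with
      | nil =>
        rw [show condGate P i [].prod = id from funext fun c => by simp [condGate, gateAt_one]]
        exact CostLE.id.mono (Nat.zero_le _)
      | cons s w ih =>
        rw [List.prod_cons, condGate_mul hi]
        refine ((hP.condGate_threeCycle hi (hw s (by simp))).comp
          (ih fun t ht => hw t (by simp [ht]))).mono ?_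
        simp only [List.length_cons]
        linarith
    refine this.mono ?_
    calc w.length * (2 * n + 772 * ℓ) ≤ L * (772 * (n + ℓ)) := Nat.mul_le_mul hl (by omega)
      _ = 772 * L * (n + ℓ) := by ring
      _ ≤ _ := Nat.mul_le_mul_right _ (le_max_right _ _)

noncomputable def gateConst : ℕ := exists_gateConst.choose

section

variable {ℓ : ℕ} [Fact (1 < ℓ)] {P : (ZMod ℓ → Fin 3) → Prop} {n : ℕ}

open Classical in
/-- The permutation `f q` is applied to the `i`-th letter if `P` holds. -/
noncomputable def condCell (P : (ZMod ℓ → Fin 3) → Prop) (i : ZMod ℓ)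
    (f : SmartState → Equiv.Perm (Fin 3)) (c : View ℓ) : View ℓ :=
  if P c.2.1 then (c.1, Function.update c.2.1 i (f c.1.1 (c.2.1 i)), c.2.2) else c

theorem PredCost.condState (hP : PredCost P n) (τ : Equiv.Perm SmartState) :
    CostLE (condState P (liftState τ)) (gateConst * n) :=
  (exists_gateConst.choose_spec ℓ P n hP).1 τ

theorem PredCost.condCell (hP : PredCost P n) {i : ZMod ℓ} (hi : IndepOf P {i})
    (f : SmartState → Equiv.Perm (Fin 3)) : CostLE (condCell P i f) (gateConst * (n + ℓ)) := by
  have h : CostLE _ (gateConst * (n + ℓ)) :=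
    (exists_gateConst.choose_spec ℓ P n hP).2 i hi (Equiv.prodCongrRight f)
  convert h using 1
  funext c
  by_cases hc : P c.2.1 <;> simp [TM.condCell, condGate, gateAt, liftGate, hc, Equiv.permCongr_apply]

theorem predCost_apply_mem (i : ZMod ℓ) (A : Finset (Fin 3)) :
    PredCost (fun v : ZMod ℓ → Fin 3 => v i ∈ A) (193 * ℓ) := by
  have : NeZero ℓ := ⟨by have := Fact.out (p := 1 < ℓ); omega⟩
  refine (((predCost_mem A).translate i.val).congr fun v => by simp).mono ?_
  have := ZMod.val_lt i
  omega

theorem predCost_true : PredCost (fun _ : ZMod ℓ → Fin 3 => True) 1 :=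
  (predCost_mem Finset.univ).congr fun v => by simp

open Classical in
/-- The letters are permuted by `π` if `P` holds and the state is in `A`. -/
noncomputable def condPerm (P : (ZMod ℓ → Fin 3) → Prop) (A : Finset SmartState)
    (π : Equiv.Perm (ZMod ℓ)) (c : View ℓ) : View ℓ :=
  if P c.2.1 ∧ c.1.1 ∈ A then (c.1, c.2.1 ∘ π, c.2.2) else c

/-- The `j`-th letter is added to the `i`-th one, if `P` holds and the state is in `A`. -/
theorem PredCost.add_letter (hP : PredCost P n) {i j : ZMod ℓ} (hij : i ≠ j)
    (hi : IndepOf P {i}) (A : Finset SmartState) (s : Fin 3) [DecidablePred P] :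
    CostLE (fun c : View ℓ => if P c.2.1 ∧ c.1.1 ∈ A then
      (c.1, Function.update c.2.1 i (c.2.1 i + s * c.2.1 j), c.2.2) else c)
      (gateConst * (4 * n + 774 * ℓ)) := by
  have h : ∀ b : Fin 3, IndepOf (fun v => P v ∧ v j ∈ ({b} : Finset (Fin 3))) {i} := by
    intro b v v' hv
    simp only [hi v v' hv, hv j fun h => hij h.symm]
  -- One controlled addition for each nonzero value of the `j`-th letter.
  have h' : ∀ b : Fin 3, CostLE (TM.condCell (fun v => P v ∧ v j ∈ ({b} : Finset (Fin 3))) i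
      fun q => if q ∈ A then Equiv.addRight (s * b) else 1)
      (gateConst * (2 * n + 2 * (193 * ℓ) + ℓ)) :=
    fun b => (hP.and (predCost_apply_mem j {b})).condCell (h b) _
  convert ((h' 1).comp (h' 2)).mono (m := gateConst * (4 * n + 774 * ℓ)) (by
    rw [← mul_add]; exact Nat.mul_le_mul_left _ (by omega)) using 1
  funext c
  obtain ⟨q, v, p⟩ := c
  have e : ∀ x, P (Function.update v i x) ↔ P v := fun x => hi _ _ fun k hk => by
    have : k ≠ i := hk
    simp [this]
  by_cases hc : P v
  · by_cases hq : q.1 ∈ A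
    · have hji : j ≠ i := hij.symm
      have h3 : v j = 0 ∨ v j = 1 ∨ v j = 2 := by
        generalize v j = x; revert x; decide
      rcases h3 with h3 | h3 | h3 <;>
        simp [TM.condCell, hc, hq, h3, e, hji]
    · simp [TM.condCell, hc, hq]
  · simp [TM.condCell, hc]

end

end TM

/-! ### Controlled permutations of the cells and controlled shifts of the position -/

namespace TM

section

variable {ℓ : ℕ} [Fact (1 < ℓ)] {P : (ZMod ℓ → Fin 3) → Prop} {n : ℕ}

theorem IndepOf.mono {ℓ : ℕ} {P : (ZMod ℓ → Fin 3) → Prop} {S T : Set (ZMod ℓ)}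
    (h : IndepOf P S) (hT : T ⊆ S) : IndepOf P T :=
  fun v v' hv => h v v' fun i hi => hv i fun h' => hi (hT h')

theorem IndepOf.and {ℓ : ℕ} {P P' : (ZMod ℓ → Fin 3) → Prop} {S : Set (ZMod ℓ)}
    (h : IndepOf P S) (h' : IndepOf P' S) : IndepOf (fun v => P v ∧ P' v) S :=
  fun v v' hv => and_congr (h v v' hv) (h' v v' hv)

theorem indepOf_true {ℓ : ℕ} (S : Set (ZMod ℓ)) : IndepOf (fun _ => True) S :=
  fun _ _ _ => Iff.rfl

theorem indepOf_apply_mem {ℓ : ℕ} {i : ZMod ℓ} {S : Set (ZMod ℓ)} (h : i ∉ S)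
    (A : Finset (Fin 3)) : IndepOf (fun v => v i ∈ A) S :=
  fun v v' hv => by simp only [hv i h]

/-- Modulo three, `(x, y) ↦ (x + y, y) ↦ (x + y, -x) ↦ (y, -x) ↦ (y, x)`: three additions of one
letter to the other and a negation. -/
theorem PredCost.condSwap (hP : PredCost P n) {i j : ZMod ℓ} (hij : i ≠ j)
    (h : IndepOf P {i, j}) (A : Finset SmartState) :
    CostLE (condPerm P A (Equiv.swap i j)) (gateConst * (2400 * (n + ℓ))) := by
  classical
  have hi : IndepOf P {i} := h.mono (by simp)
  have hj : IndepOf P {j} := h.mono (by simp)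
  have h1 := hP.add_letter hij hi A 1
  have h2 := hP.add_letter hij.symm hj A 2
  have h3 := hP.condCell hj fun q => if q ∈ A then Equiv.neg _ else 1
  convert (((h3.comp h1).comp h2).comp h1).mono (m := gateConst * (2400 * (n + ℓ))) (by
    simp only [← mul_add]; exact Nat.mul_le_mul_left _ (by omega)) using 1
  funext c
  obtain ⟨q, v, p⟩ := c
  have ei : ∀ v x, P (Function.update v i x) ↔ P v := fun v x => hi _ _ fun k hk => by
    have : k ≠ i := hk
    simp [this]
  have ej : ∀ v x, P (Function.update v j x) ↔ P v := fun v x => hj _ _ fun k hk => by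
    have : k ≠ j := hk
    simp [this]
  by_cases hc : P v
  · by_cases hq : q.1 ∈ A
    · simp only [condPerm, hc, hq, and_self, if_true, Function.comp, TM.condCell, ei, ej,
        Prod.mk.injEq, true_and, and_true]
      funext k
      by_cases hki : k = i
      · subst hki
        simp only [Function.comp, Equiv.swap_apply_left, Function.update_self, ne_eq, hij,
          hij.symm, not_false_eq_true, Function.update_of_ne]
        generalize v k = x
        generalize v j = y
        revert x y
        decide
      · by_cases hkj : k = j
        · subst hkj
          simp only [Function.comp, Equiv.swap_apply_right, Function.update_self, ne_eq, hij,
            hij.symm, not_false_eq_true, Function.update_of_ne, Equiv.neg_apply]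
          generalize v k = x
          generalize v i = y
          revert x y
          decide
        · simp [hki, hkj, Equiv.swap_apply_of_ne_of_ne]
    · simp [condPerm, TM.condCell, hc, hq]
  · simp [condPerm, TM.condCell, hc]

/-- At most `ℓ` transpositions are needed, since each one shrinks the support. They stay inside the
support of `π`, on which `P` does not depend. -/
theorem PredCost.condPerm (hP : PredCost P n) (π : Equiv.Perm (ZMod ℓ))
    (h : IndepOf P {i | π i ≠ i}) (A : Finset SmartState) :
    CostLE (condPerm P A π) (gateConst * (2400 * (n + ℓ)) * ℓ) := by
  have : NeZero ℓ := ⟨by have := Fact.out (p := 1 < ℓ); omega⟩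
  suffices H : ∀ m, ∀ π : Equiv.Perm (ZMod ℓ), π.support.card ≤ m → IndepOf P {i | π i ≠ i} →
      CostLE (TM.condPerm P A π) (gateConst * (2400 * (n + ℓ)) * m) from
    H ℓ π ((Finset.card_le_univ _).trans (ZMod.card ℓ).le) h
  intro m
  induction m with
  | zero =>
    intro π hπ _
    have : π = 1 := by simpa using hπ
    subst this
    rw [show TM.condPerm P A 1 = id from funext fun c => by simp [TM.condPerm]]
    exact CostLE.id.mono (Nat.zero_le _)
  | succ m ih =>
    intro π hπ hS
    by_cases h1 : π = 1
    · exact (ih π (by simp [h1]) hS).mono (Nat.mul_le_mul_left _ (Nat.le_succ m))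
    obtain ⟨x, hx⟩ : ∃ x, π x ≠ x := by
      by_contra! h
      exact h1 (Equiv.ext h)
    let π' := Equiv.swap x (π x) * π
    have hlt : π'.support.card < π.support.card := Equiv.Perm.card_support_swap_mul hx
    have hsub : {i | π' i ≠ i} ⊆ {i | π i ≠ i} := fun y hy =>
      Equiv.Perm.mem_support.1
        (Equiv.Perm.mem_support_swap_mul_imp_mem_support_ne (Equiv.Perm.mem_support.2 hy)).1
    have ih' := ih π' (by omega) (hS.mono hsub)
    have hsw := hP.condSwap hx.symm (hS.mono (T := {x, π x}) fun y hy => by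
      rcases hy with rfl | rfl
      · exact hx
      · simpa using hx) A
    convert (ih'.comp hsw).mono (m := gateConst * (2400 * (n + ℓ)) * (m + 1)) (by
      rw [Nat.mul_succ]) using 1
    funext c
    obtain ⟨q, v, p⟩ := c
    have e : P (v ∘ Equiv.swap x (π x)) ↔ P v := hS _ _ fun k hk => by
      have hk' : π k = k := by simpa using hk
      have h2 : k ≠ x := by rintro rfl; exact hx hk'
      have h3 : k ≠ π x := by
        rintro rfl
        exact hx (π.injective hk')
      simp [Equiv.swap_apply_of_ne_of_ne h2 h3]
    by_cases hc : P v
    · by_cases hq : q.1 ∈ A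
      · have e2 : ⇑(Equiv.swap x (π x)) ∘ ⇑π' = π := by
          funext k
          simp [π']
        simp [TM.condPerm, hc, hq, e, Function.comp_assoc, e2]
      · simp [TM.condPerm, hc, hq]
    · simp [TM.condPerm, hc]

/-- The position is shifted by one if the state is in `A`, and the letters are not changed. -/
def shiftIn (A : Finset SmartState) (c : View ℓ) : View ℓ :=
  (c.1, c.2.1, if c.1.1 ∈ A then c.2.2 + 1 else c.2.2)

/-- Otherwise a nontrivial permutation of the states would be the empty product. Positivity serves
to absorb additive constants. -/
theorem gateConst_pos : 0 < gateConst := by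
  by_contra h0
  have h0 : gateConst = 0 := by omega
  have : Fact (1 < 2) := ⟨by norm_num⟩
  have h := (predCost_true (ℓ := 2)).condState (Equiv.swap (.filledRight, .one) (.filledLeft, .one))
  rw [h0, zero_mul] at h
  obtain ⟨g, hg, w, -, hw, hl⟩ := h
  have : w = [] := by simpa using hl
  rw [this] at hw
  have := hg.1 (((.filledRight, .one), (0, 0)), 0, 0)
  rw [← hw] at this
  have := congrArg (fun c => c.1.1) (View.toTape_injective this)
  simp [TM.condState, liftState] at this

/-- The head moves one cell, and the letters are then rotated so that it sees the same ones as
before. -/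
theorem costLE_shiftIn (A : Finset SmartState) :
    CostLE (shiftIn (ℓ := ℓ) A) (gateConst * 5000 * ℓ ^ 2) := by
  have h1 := costLE_moveIn (ℓ := ℓ) (A ×ˢ Finset.univ)
  have h2 := (predCost_true (ℓ := ℓ)).condPerm (Equiv.addRight (-1)) (indepOf_true _) A
  convert (h2.comp h1).mono (m := gateConst * 5000 * ℓ ^ 2) ?_ using 1
  · funext c
    by_cases hc : c.1.1 ∈ A
    · simp only [shiftIn, moveIn, TM.condPerm, hc, Function.comp_apply,
        Finset.mem_product, Finset.mem_univ, and_self, if_true, Prod.mk.injEq, true_and, and_true]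
      funext j
      simp
    · simp [shiftIn, moveIn, TM.condPerm, hc]
  · have h3 := card_le_96 (A ×ˢ Finset.univ)
    have h4 := gateConst_pos
    have h5 := Fact.out (p := 1 < ℓ)
    have h6 : 96 ≤ gateConst * 96 * ℓ ^ 2 := by
      calc 96 = 1 * 96 * 1 ^ 2 := by norm_num
        _ ≤ _ := by gcongr <;> omega
    calc _ ≤ gateConst * (2400 * (ℓ + ℓ)) * ℓ + gateConst * 96 * ℓ ^ 2 := by
          gcongr
          omega
      _ ≤ _ := by
          have : gateConst * (2400 * (ℓ + ℓ)) * ℓ = gateConst * 4800 * ℓ ^ 2 := by ring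
          rw [this, ← add_mul, ← mul_add]
          gcongr
          norm_num

open Classical in
/-- The position is shifted by `1` if the state is in `A` and by `-1` if its image under `τ` is in
`A`, provided that the letters satisfy `P`. -/
theorem PredCost.shift_commutator (hP : PredCost P n) (A : Finset SmartState)
    (τ : Equiv.Perm SmartState) :
    CostLE (fun c : View ℓ => (c.1, c.2.1, if P c.2.1 then
      c.2.2 + (if c.1.1 ∈ A then 1 else 0) - (if τ c.1.1 ∈ A then 1 else 0) else c.2.2))
      (gateConst * (2 * n + 10000 * ℓ ^ 2)) := by
  -- Shift, apply `τ` under `P`, shift back, undo `τ`. If `P` fails the shifts cancel; otherwise the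
  -- second one sees the state `τ q`. The shifts keep the letters seen from the head, hence also
  -- `P`.
  have h1 := costLE_shiftIn (ℓ := ℓ) A
  let k : View ℓ → View ℓ := fun c => (c.1, c.2.1, if c.1.1 ∈ A then c.2.2 - 1 else c.2.2)
  have h2 : CostLE k _ := h1.inv fun c => by
    by_cases hc : c.1.1 ∈ A <;> simp [k, shiftIn, hc]
  have h3 := hP.condState τ
  have h4 := hP.condState τ⁻¹
  convert (((h4.comp h2).comp h3).comp h1).mono (m := gateConst * (2 * n + 10000 * ℓ ^ 2)) ?_ using 1
  · funext c
    obtain ⟨⟨q, d⟩, v, p⟩ := c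
    by_cases hc : P v
    · by_cases hq : q ∈ A <;> by_cases hq' : τ q ∈ A <;>
        simp [TM.condState, liftState, k, shiftIn, hc, hq, hq']
    · by_cases hq : q ∈ A <;> simp [TM.condState, k, shiftIn, hc, hq]
  · apply le_of_eq
    ring

end

end TM

namespace TM

/-! ## Adding constants to the number that is written on the tape -/

/-- The highest digit at which the numbers differ decides. This brings comparisons into the form of
`predCost_lex`. -/
theorem sum_lt_sum_iff_lex (a b : ℕ → ℕ) (ha : ∀ i, a i < 3) (hb : ∀ i, b i < 3) (k : ℕ) :
    ∑ i ∈ Finset.range k, b i * 3 ^ i < ∑ i ∈ Finset.range k, a i * 3 ^ i ↔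
      ∃ j < k, b j < a j ∧ ∀ i, j < i → i < k → a i = b i := by
  have bound : ∀ (c : ℕ → ℕ), (∀ i, c i < 3) → ∀ k, ∑ i ∈ Finset.range k, c i * 3 ^ i < 3 ^ k := by
    intro c hc k
    induction k with
    | zero => simp
    | succ k ih =>
      rw [Finset.sum_range_succ, pow_succ]
      have := Nat.mul_le_mul_right (3 ^ k) (show c k ≤ 2 by have := hc k; omega)
      omega
  induction k with
  | zero => simp
  | succ k ih =>
    rw [Finset.sum_range_succ, Finset.sum_range_succ]
    have h1 := bound a ha k
    have h2 := bound b hb k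
    rcases lt_trichotomy (a k) (b k) with h | h | h
    · have := Nat.mul_le_mul_right (3 ^ k) (show a k + 1 ≤ b k from h)
      rw [add_mul, one_mul] at this
      refine iff_of_false (by omega) ?_
      rintro ⟨j, hj, h3, h4⟩
      rcases Nat.lt_succ_iff_lt_or_eq.1 hj with h5 | rfl
      · exact h.ne (h4 k h5 (by omega))
      · omega
    · rw [h, Nat.add_lt_add_iff_right]
      refine ih.trans ?_
      constructor
      · rintro ⟨j, hj, h3, h4⟩
        refine ⟨j, by omega, h3, fun i h5 h6 => ?_⟩
        rcases Nat.lt_succ_iff_lt_or_eq.1 h6 with h7 | rfl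
        exacts [h4 i h5 h7, h]
      · rintro ⟨j, hj, h3, h4⟩
        have : j ≠ k := by rintro rfl; omega
        exact ⟨j, by omega, h3, fun i h5 h6 => h4 i h5 (by omega)⟩
    · have := Nat.mul_le_mul_right (3 ^ k) (show b k + 1 ≤ a k from h)
      rw [add_mul, one_mul] at this
      exact iff_of_true (by omega) ⟨k, by omega, h, fun i h3 h4 => by omega⟩

/-- The number written on the first `k` cells, where the letters `2, 0, 1` are the digits
`0, 1, 2`. -/
def num {ℓ : ℕ} (v : ZMod ℓ → Fin 3) (k : ℕ) : ℕ :=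
  ∑ i ∈ Finset.range k, (v (i : ZMod ℓ) + 1).val * 3 ^ i

theorem num_succ {ℓ : ℕ} (v : ZMod ℓ → Fin 3) (k : ℕ) :
    num v (k + 1) = num v k + (v k + 1).val * 3 ^ k := Finset.sum_range_succ _ _

theorem num_congr {ℓ : ℕ} {v w : ZMod ℓ → Fin 3} {k : ℕ}
    (h : ∀ i < k, v (i : ℕ) = w (i : ℕ)) : num v k = num w k :=
  Finset.sum_congr rfl fun i hi => by rw [h i (Finset.mem_range.1 hi)]

theorem num_lt {ℓ : ℕ} (v : ZMod ℓ → Fin 3) (k : ℕ) : num v k < 3 ^ k := by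
  induction k with
  | zero => simp [num]
  | succ k ih =>
    rw [num_succ, pow_succ]
    have := Nat.mul_le_mul_right (3 ^ k) (show (v k + 1).val ≤ 2 by omega)
    omega

theorem natCast_ne {ℓ i j : ℕ} (hi : i < ℓ) (hj : j < ℓ) (h : i ≠ j) : (i : ZMod ℓ) ≠ j := by
  intro e
  rw [ZMod.natCast_eq_natCast_iff', Nat.mod_eq_of_lt hi, Nat.mod_eq_of_lt hj] at e
  exact h e

/-- Complementing the digits gives `3 ^ k - 1 - n % 3 ^ k`; a carry occurs exactly if the number on
the tape exceeds this. -/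
theorem sum_two_sub_digit (n k : ℕ) :
    ∑ i ∈ Finset.range k, (2 - n / 3 ^ i % 3) * 3 ^ i + n % 3 ^ k + 1 = 3 ^ k := by
  induction k with
  | zero => simp [Nat.mod_one]
  | succ k ih =>
    rw [Finset.sum_range_succ, Nat.mod_pow_succ, pow_succ]
    have h : n / 3 ^ k % 3 < 3 := Nat.mod_lt _ (by norm_num)
    generalize n / 3 ^ k % 3 = x at *
    interval_cases x <;> omega

theorem predCost_lt_num {ℓ : ℕ} [Fact (1 < ℓ)] {k : ℕ} (hk : k ≤ ℓ) (n : ℕ) :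
    PredCost (fun v : ZMod ℓ → Fin 3 => 3 ^ k ≤ num v k + n % 3 ^ k) (4000 * ℓ ^ 2) := by
  refine (predCost_lex k hk (fun i => {x | (x + 1).val = 2 - n / 3 ^ i % 3})
    (fun i => {x | 2 - n / 3 ^ i % 3 < (x + 1).val}) fun j => ?_).congr fun v => ?_
  · rw [Finset.disjoint_left]
    intro x hx hx'
    simp only [Finset.mem_filter, Finset.mem_univ, true_and] at hx hx'
    omega
  · have h := sum_lt_sum_iff_lex (fun i => (v (i : ZMod ℓ) + 1).val)
      (fun i => 2 - n / 3 ^ i % 3) (fun i => Fin.is_lt _) (fun i => by omega) k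
    have h' := sum_two_sub_digit n k
    simp only [Finset.mem_filter, Finset.mem_univ, true_and]
    rw [← h, num]
    omega

/-- The letters after `n` has been added to the number on the first `k` cells. -/
def addCells {ℓ : ℕ} (n : ℕ) : ℕ → (ZMod ℓ → Fin 3) → ZMod ℓ → Fin 3
  | 0, v => v
  | k + 1, v => addCells n k (Function.update v k
      (v k + Fin.ofNat 3 (n / 3 ^ k) + if 3 ^ k ≤ num v k + n % 3 ^ k then 1 else 0))

theorem addCells_apply_of_le {ℓ : ℕ} (n : ℕ) {k j : ℕ} (hkj : k ≤ j) (hj : j < ℓ)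
    (v : ZMod ℓ → Fin 3) : addCells n k v j = v j := by
  induction k generalizing v with
  | zero => rfl
  | succ k ih =>
    rw [addCells, ih (by omega), Function.update_of_ne (natCast_ne hj (by omega) (by omega))]

/-- The top digit is treated first, while the lower digits still have the values that determine its
carry. No auxiliary cell for carries is needed. -/
theorem num_addCells {ℓ : ℕ} (n : ℕ) {k : ℕ} (hk : k ≤ ℓ) (v : ZMod ℓ → Fin 3) :
    num (addCells n k v) k = (num v k + n) % 3 ^ k := by
  induction k generalizing v with
  | zero => simp [num, Nat.mod_one]
  | succ k ih =>
    rw [addCells, num_succ, ih (by omega), addCells_apply_of_le n le_rfl (by omega),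
      Function.update_self, num_succ]
    rw [num_congr (w := v) fun i hi => Function.update_of_ne
      (natCast_ne (ℓ := ℓ) (by omega) (by omega) (by omega)) _ _]
    have h1 := num_lt v k
    generalize num v k = a at *
    generalize v k = x
    have h2 := Nat.div_add_mod n (3 ^ k)
    generalize n / 3 ^ k = d at *
    have h3 : n % 3 ^ k < 3 ^ k := Nat.mod_lt _ (by positivity)
    generalize n % 3 ^ k = r at *
    subst h2
    have e : ∀ y : Fin 3, (x + Fin.ofNat 3 d + y + 1).val = ((x + 1).val + d + y.val) % 3 := by
      intro y
      simp only [Fin.val_add, Fin.val_ofNat, Fin.val_one]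
      omega
    have m1 : (a + (3 ^ k * d + r)) % 3 ^ k = (a + r) % 3 ^ k := by
      rw [show a + (3 ^ k * d + r) = a + r + 3 ^ k * d by ring, Nat.add_mul_mod_self_left]
    rw [m1]
    by_cases hc : 3 ^ k ≤ a + r
    · have e1 := e 1
      rw [Fin.val_one] at e1
      rw [if_pos hc, e1, show a + (x + 1).val * 3 ^ k + (3 ^ k * d + r) =
        (a + r - 3 ^ k) + 3 ^ k * ((x + 1).val + d + 1) by
          obtain ⟨s, hs⟩ := Nat.exists_eq_add_of_le hc
          rw [hs, Nat.add_sub_cancel_left]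
          linear_combination hs, Nat.mod_pow_succ, Nat.add_mul_mod_self_left,
        Nat.mod_eq_of_lt (show a + r - 3 ^ k < 3 ^ k by omega),
        Nat.mod_eq_sub_mod hc, Nat.mod_eq_of_lt (show a + r - 3 ^ k < 3 ^ k by omega),
        Nat.add_mul_div_left _ _ (by positivity),
        Nat.div_eq_of_lt (show a + r - 3 ^ k < 3 ^ k by omega)]
      ring
    · have e1 := e 0
      rw [Fin.val_zero] at e1
      rw [if_neg hc, e1, show a + (x + 1).val * 3 ^ k + (3 ^ k * d + r) =
        (a + r) + 3 ^ k * ((x + 1).val + d + 0) by ring, Nat.mod_pow_succ,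
        Nat.add_mul_mod_self_left,
        Nat.mod_eq_of_lt (show a + r < 3 ^ k by omega),
        Nat.add_mul_div_left _ _ (by positivity),
        Nat.div_eq_of_lt (show a + r < 3 ^ k by omega)]
      ring

theorem eq_of_num_eq {ℓ k : ℕ} {v w : ZMod ℓ → Fin 3} (h : num v k = num w k) :
    ∀ i < k, v (i : ℕ) = w (i : ℕ) := by
  induction k with
  | zero => intro i hi; omega
  | succ k ih =>
    rw [num_succ, num_succ] at h
    have h1 := num_lt v k
    have h2 := num_lt w k
    have h3 := congrArg (· / 3 ^ k) h
    rw [Nat.add_mul_div_right _ _ (by positivity), Nat.add_mul_div_right _ _ (by positivity),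
      Nat.div_eq_of_lt h1, Nat.div_eq_of_lt h2, zero_add, zero_add] at h3
    rw [h3] at h
    intro i hi
    rcases Nat.lt_succ_iff_lt_or_eq.1 hi with h4 | rfl
    · exact ih (by omega) i h4
    · exact add_right_cancel (Fin.ext h3)

theorem indepOf_num {ℓ : ℕ} {k : ℕ} (Q : ℕ → Prop) {S : Set (ZMod ℓ)}
    (hS : ∀ i < k, (i : ZMod ℓ) ∉ S) : IndepOf (fun v : ZMod ℓ → Fin 3 => Q (num v k)) S :=
  fun v v' hv => by
    change Q _ ↔ Q _
    rw [num_congr (v := v) (w := v') fun i hi => hv _ (hS i hi)]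

/-- Adding `n` to the number on the first `k` cells, if `P` holds and the state is in `A`. -/
theorem PredCost.addCells {ℓ : ℕ} [Fact (1 < ℓ)] {P : (ZMod ℓ → Fin 3) → Prop} [DecidablePred P]
    {c : ℕ} (hP : PredCost P c) (n : ℕ) {k : ℕ} (hk : k ≤ ℓ)
    (h : IndepOf P {i | ∃ j < k, (j : ZMod ℓ) = i}) (A : Finset SmartState) :
    CostLE (fun x : View ℓ => if P x.2.1 ∧ x.1.1 ∈ A then
      (x.1, addCells n k x.2.1, x.2.2) else x) (gateConst * (3 * c + 8002 * ℓ ^ 2) * k) := by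
  induction k with
  | zero =>
    refine (CostLE.id (ℓ := ℓ)).mono (Nat.zero_le _) |> (cast (congrArg (CostLE · _) ?_))
    funext x
    split_ifs <;> rfl
  | succ k ih =>
    have hkk : IndepOf P {(k : ZMod ℓ)} := h.mono (by
      rintro _ rfl
      exact ⟨k, by omega, rfl⟩)
    have hcar : IndepOf (fun v : ZMod ℓ → Fin 3 => 3 ^ k ≤ num v k + n % 3 ^ k) {(k : ZMod ℓ)} :=
      indepOf_num (fun a => 3 ^ k ≤ a + n % 3 ^ k) fun i hi h' =>
        natCast_ne (by omega) (by omega) (by omega) h'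
    have h1 := hP.condCell hkk fun q => if q ∈ A then Equiv.addRight (Fin.ofNat 3 (n / 3 ^ k)) else 1
    -- The carry into the `k`-th digit depends on the lower digits only, so it may control a change
    -- of the `k`-th letter.
    have h2 := (hP.and (predCost_lt_num (by omega) n)).condCell (hkk.and hcar)
      fun q => if q ∈ A then Equiv.addRight (1 : Fin 3) else 1
    have h3 := ih (by omega) (h.mono fun i ⟨j, hj, e⟩ => ⟨j, by omega, e⟩)
    convert ((h3.comp h1).comp h2).mono
      (m := gateConst * (3 * c + 8002 * ℓ ^ 2) * (k + 1)) ?_ using 1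
    · funext x
      obtain ⟨q, v, p⟩ := x
      have e : ∀ y, P (Function.update v k y) ↔ P v := fun y => hkk _ _ fun j hj => by
        have : j ≠ k := hj
        simp [this]
      by_cases hc : P v
      · by_cases hq : q.1 ∈ A
        · by_cases hn : 3 ^ k ≤ num v k + n % 3 ^ k
          · simp [TM.condCell, hc, hq, hn, e, TM.addCells, add_right_comm]
          · simp [TM.condCell, hc, hq, hn, e, TM.addCells]
        · by_cases hn : 3 ^ k ≤ num v k + n % 3 ^ k <;>
          simp [TM.condCell, hc, hq, hn]
      · simp [TM.condCell, hc]
    · have : ℓ ≤ ℓ ^ 2 := Nat.le_self_pow (by norm_num) ℓ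
      rw [Nat.mul_succ, add_assoc, ← mul_add]
      exact Nat.add_le_add_left (Nat.mul_le_mul_left _ (by omega)) _

end TM

namespace TM

/-! ## A counter on words that is incremented by SMART -/

theorem eq_one_or_two {a : Fin 3} (ha : a ≠ 0) : a = 1 ∨ a = 2 := by
  revert ha; revert a; decide

/-- The number `(3 ^ k - 1) / 2 = 1 + 3 + ⋯ + 3 ^ (k - 1)`. -/
def half (k : ℕ) : ℕ := (3 ^ k - 1) / 2

theorem two_mul_half (k : ℕ) : 2 * half k + 1 = 3 ^ k := by
  have h : 3 ^ k % 2 = 1 := by simp [Nat.pow_mod]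
  unfold half
  generalize 3 ^ k = x at *
  omega

theorem half_succ (k : ℕ) : half (k + 1) = 3 ^ k + half k := by
  have h1 := two_mul_half k
  have h2 := two_mul_half (k + 1)
  rw [pow_succ] at h2
  omega

theorem half_zero : half 0 = 0 := rfl

def sg (b : Bool) : ℤ := if b then 1 else -1

/-- The value of a letter as a digit of a balanced ternary number. -/
def bal (a : Fin 3) : ℤ := if a = 0 then 0 else if a = 1 then 1 else -1

theorem bal_eq {a : Fin 3} (ha : a ≠ 0) : bal a = 1 ∨ bal a = -1 := by
  revert ha; revert a; decide

def ind {R : Type} [CommRing R] (b : Bool) : R := if b then 1 else 0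

/-- The representative of `Y + half k` modulo `3 ^ k` of least absolute value, if
`|Y| ≤ half k`. -/
def balRem (k : ℕ) (Y : ℤ) : ℤ := if Y ≤ 0 then Y + half k else Y - half k - 1

/-- The type `b` if `Y` is not negative, and the other type otherwise. -/
def turn (b : Bool) (Y : ℤ) : Bool := if 0 ≤ Y then b else !b

theorem turn_of_nonneg (b : Bool) {Y : ℤ} (h : 0 ≤ Y) : turn b Y = b := if_pos h

theorem turn_of_neg (b : Bool) {Y : ℤ} (h : Y < 0) : turn b Y = !b := if_neg (not_le.2 h)

section

variable {R : Type} [CommRing R]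

/-- The letters of the word are read one after another, and the rest of the word is reversed after
each letter that is not `0`. -/
def enc (t χ : Bool) (κ : R) (Y : ℤ) (k : ℕ) : List (Fin 3) → Bool × Bool × R × ℤ
  | [] => (turn t Y, χ, κ, Y)
  | a :: L => if a = 0 then enc t χ (κ + ind χ) Y (k + 1) L else
      enc (turn t Y) (!χ) (κ + ind χ) (sg (turn t Y) * bal a * (3 ^ k + balRem k Y)) (k + 1)
        L.reverse
termination_by L => L.length
decreasing_by all_goals simp

theorem enc_nil (t χ : Bool) (κ : R) (Y : ℤ) (k : ℕ) : enc t χ κ Y k [] = (turn t Y, χ, κ, Y) := by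
  rw [enc]

theorem enc_zero (t χ : Bool) (κ : R) (Y : ℤ) (k : ℕ) (L : List (Fin 3)) :
    enc t χ κ Y k (0 :: L) = enc t χ (κ + ind χ) Y (k + 1) L := by
  rw [enc, if_pos rfl]

theorem enc_cons (t χ : Bool) (κ : R) (Y : ℤ) (k : ℕ) {a : Fin 3} (ha : a ≠ 0)
    (L : List (Fin 3)) : enc t χ κ Y k (a :: L) =
      enc (turn t Y) (!χ) (κ + ind χ) (sg (turn t Y) * bal a * (3 ^ k + balRem k Y)) (k + 1)
        L.reverse := by
  rw [enc, if_neg ha]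

theorem enc_replicate (t χ : Bool) (κ : R) (Y : ℤ) (k j : ℕ) (L : List (Fin 3)) :
    enc t χ κ Y k (List.replicate j 0 ++ L) = enc t χ (κ + j * ind χ) Y (k + j) L := by
  induction j generalizing κ k with
  | zero => simp
  | succ j ih =>
    rw [List.replicate_succ, List.cons_append, enc_zero, ih, show k + 1 + j = k + (j + 1) by ring]
    congr 1
    push_cast
    ring

theorem enc_replicate_nil (t χ : Bool) (κ : R) (Y : ℤ) (k j : ℕ) :
    enc t χ κ Y k (List.replicate j 0) = (turn t Y, χ, κ + j * ind χ, Y) := by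
  have := enc_replicate t χ κ Y k j []
  rwa [List.append_nil, enc_nil] at this

/-- `Y'` is the successor of `Y` in the direction of `t` if `Y` is positive, and in the opposite
direction if `Y` is negative. -/
def Succ (t : Bool) (Y Y' : ℤ) : Prop :=
  (0 < Y ∧ 0 < Y' ∧ Y' = Y + sg t) ∨ (Y < 0 ∧ Y' < 0 ∧ Y' = Y - sg t)

/-- The number `3 ^ k + balRem k Y` is positive and grows by one with `Y`, except for a jump from `Y
= 0` to `Y = 1`, which `Succ` excludes. For negative `Y` the change of type compensates the opposite
direction of counting. -/
theorem Succ.cons {t : Bool} {Y Y' : ℤ} (h : Succ t Y Y') {k : ℕ} (hY : |Y| ≤ half k)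
    (hY' : |Y'| ≤ half k) {a : Fin 3} (ha : a ≠ 0) :
    turn t Y' = turn t Y ∧ Succ (turn t Y) (sg (turn t Y) * bal a * (3 ^ k + balRem k Y))
      (sg (turn t Y) * bal a * (3 ^ k + balRem k Y')) := by
  have h3 : (2 * half k + 1 : ℤ) = 3 ^ k := by exact_mod_cast two_mul_half k
  rw [abs_le] at hY hY'
  rcases h with ⟨h1, h2, rfl⟩ | ⟨h1, h2, rfl⟩
  · refine ⟨by rw [turn_of_nonneg t h1.le, turn_of_nonneg t h2.le], ?_⟩
    rw [turn_of_nonneg t h1.le, balRem, balRem, if_neg (by omega), if_neg (by omega)]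
    rcases bal_eq ha with hb | hb <;> cases t <;> simp only [hb, sg, Succ] at * <;> simp at * <;>
      omega
  · refine ⟨by rw [turn_of_neg t h1, turn_of_neg t h2], ?_⟩
    rw [turn_of_neg t h1, balRem, balRem, if_pos (by omega), if_pos (by omega)]
    rcases bal_eq ha with hb | hb <;> cases t <;> simp only [hb, sg, Succ] at * <;> simp at * <;>
      omega

theorem abs_cons_le (t : Bool) {Y : ℤ} {k : ℕ} (hY : |Y| ≤ half k) {a : Fin 3} (ha : a ≠ 0) :
    |sg t * bal a * (3 ^ k + balRem k Y)| ≤ half (k + 1) := by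
  have h3 : (2 * half k + 1 : ℤ) = 3 ^ k := by exact_mod_cast two_mul_half k
  rw [half_succ]
  push_cast
  rw [abs_le] at hY
  have : |sg t * bal a| = 1 := by
    rcases bal_eq ha with hb | hb <;> cases t <;> simp [hb, sg]
  rw [abs_mul, this, one_mul, abs_le, balRem]
  generalize (3 : ℤ) ^ k = x at *
  split_ifs <;> constructor <;> omega

theorem half_le_succ (k : ℕ) : half k ≤ half (k + 1) := by
  rw [half_succ]
  exact Nat.le_add_left _ _

/-- Once two encodings agree in everything but neighbouring counters, reading the rest of the word
preserves this. It suffices to follow a macro step until its two sides meet. -/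
theorem Succ.enc (n : ℕ) {t χ : Bool} {κ : R} {Y Y' : ℤ} {k : ℕ} {L : List (Fin 3)}
    (hn : L.length = n) (h : Succ t Y Y') (hY : |Y| ≤ half k) (hY' : |Y'| ≤ half k) :
    ∃ t' χ' κ' Z Z', enc t χ κ Y k L = (t', χ', κ', Z) ∧ enc t χ κ Y' k L = (t', χ', κ', Z') ∧
      Z' = Z + sg t' ∧ Z ≠ 0 ∧ Z' ≠ 0 ∧ |Z'| ≤ half (k + n) := by
  induction n generalizing t χ κ Y Y' k L with
  | zero =>
    obtain rfl := List.length_eq_zero_iff.1 hn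
    rw [enc_nil, enc_nil]
    rcases h with ⟨h1, h2, h3⟩ | ⟨h1, h2, h3⟩
    · rw [turn_of_nonneg t h1.le, turn_of_nonneg t h2.le]
      exact ⟨_, _, _, _, _, rfl, rfl, h3, h1.ne', h2.ne', hY'⟩
    · rw [turn_of_neg t h1, turn_of_neg t h2]
      refine ⟨_, _, _, _, _, rfl, rfl, ?_, h1.ne, h2.ne, hY'⟩
      rw [h3]
      cases t <;> simp [sg, sub_eq_add_neg]
  | succ n ih =>
    rcases L with _ | ⟨a, L⟩
    · simp at hn
    rw [show k + (n + 1) = k + 1 + n by ring]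
    have hn' : L.length = n := by simpa using hn
    by_cases ha : a = 0
    · subst ha
      rw [enc_zero, enc_zero]
      have := half_le_succ k
      exact ih hn' h (hY.trans (by exact_mod_cast this)) (hY'.trans (by exact_mod_cast this))
    · obtain ⟨h1, h2⟩ := h.cons hY hY' ha
      rw [enc_cons _ _ _ _ _ ha, enc_cons _ _ _ _ _ ha, h1]
      exact ih (by simpa using hn') h2 (abs_cons_le _ hY ha) (abs_cons_le _ hY' ha)

/-- The effect of one macro step on the result of `enc`. -/
def encStep (ℓ : ℕ) (x : Bool × Bool × R × ℤ) : Bool × Bool × R × ℤ :=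
  (x.1, x.2.1,
    if x.1 = true ∧ x.2.2.2 = 0 then x.2.2.1 - (sg x.2.1 : R)
    else if x.1 = false ∧ x.2.2.2 = 1 then x.2.2.1 + (sg x.2.1 : R) else x.2.2.1,
    if |x.2.2.2 + sg x.1| ≤ half ℓ then x.2.2.2 + sg x.1 else -(sg x.1 * half ℓ))

/-- Since neither final counter is `0` and the new one stays in range, there is no change of `κ` and
no wrap-around. -/
theorem encStep_of_succ {ℓ : ℕ} {t χ : Bool} {κ : R} {Y Y' : ℤ} {k : ℕ} {L : List (Fin 3)}
    {x x' : Bool × Bool × R × ℤ} (hx : x = enc t χ κ Y k L) (hx' : x' = enc t χ κ Y' k L)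
    (hl : k + L.length = ℓ) (h : Succ t Y Y') (hY : |Y| ≤ half k) (hY' : |Y'| ≤ half k) :
    encStep ℓ x = x' := by
  obtain ⟨t', χ', κ', Z, Z', h1, h2, rfl, h4, h5, h6⟩ := h.enc (χ := χ) (κ := κ) _ rfl hY hY'
  rw [hx, hx', h1, h2]
  rw [hl] at h6
  have h7 : ¬ (t' = true ∧ Z = 0) := fun h => h4 h.2
  have h8 : ¬ (t' = false ∧ Z = 1) := by
    rintro ⟨rfl, rfl⟩
    simp [sg] at h5
  simp only [encStep, if_neg h7, if_neg h8, if_pos h6]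

theorem exists_replicate_zero (L : List (Fin 3)) : L = List.replicate L.length 0 ∨
    ∃ j a M, a ≠ 0 ∧ L = List.replicate j 0 ++ a :: M := by
  induction L with
  | nil => simp
  | cons b L ih =>
    by_cases hb : b = 0
    · subst hb
      rcases ih with h | ⟨j, a, M, ha, rfl⟩
      · left
        rw [List.length_cons, List.replicate_succ, ← h]
      · exact .inr ⟨j + 1, a, M, ha, by simp [List.replicate_succ]⟩
    · exact .inr ⟨0, b, L, hb, by simp⟩

/-- From `Y = 0`, the first nonzero letter leads to one of the two extreme values, because `balRem k
0 = half k`. -/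
theorem enc_start (t χ : Bool) (κ : R) (j k : ℕ) {a : Fin 3} (ha : a ≠ 0) (L : List (Fin 3)) :
    enc t χ κ 0 k (List.replicate j 0 ++ a :: L) =
      enc t (!χ) (κ + (j + 1) * ind χ) (sg t * bal a * half (k + j + 1)) (k + j + 1) L.reverse := by
  rw [enc_replicate, enc_cons _ _ _ _ _ ha, turn_of_nonneg t le_rfl, balRem, if_pos le_rfl,
    zero_add, half_succ]
  push_cast
  congr 1
  ring

/-- Reading zeros and a further letter after the word has begun with `b`. -/
theorem enc_start_cons (t χ : Bool) (κ : R) (j : ℕ) {a b : Fin 3} (hb : b ≠ 0) (ha : a ≠ 0)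
    (L : List (Fin 3)) :
    enc t χ κ 0 0 (b :: (List.replicate j 0 ++ a :: L).reverse) =
      enc (turn t (sg t * bal b)) χ (κ + ind χ + (j + 1) * ind (!χ))
        (sg (turn t (sg t * bal b)) * bal a * (3 ^ (j + 1) + balRem (j + 1) (sg t * bal b)))
        (j + 2) L.reverse := by
  have h := enc_start t χ κ 0 0 hb (List.replicate j 0 ++ a :: L).reverse
  rw [List.replicate_zero, List.nil_append, List.reverse_reverse] at h
  have h1 : half (0 + 0 + 1) = 1 := rfl
  rw [h, enc_replicate, enc_cons _ _ _ _ _ ha, h1, Bool.not_not,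
    show 0 + 0 + 1 + j = j + 1 by ring]
  push_cast
  rw [mul_one]
  congr 1
  ring

theorem enc_start_replicate (t χ : Bool) (κ : R) (j : ℕ) {b : Fin 3} (hb : b ≠ 0) :
    enc t χ κ 0 0 (b :: List.replicate j 0) =
      (turn t (sg t * bal b), !χ, κ + ind χ + j * ind (!χ), sg t * bal b) := by
  have h := enc_start t χ κ 0 0 hb (List.replicate j 0)
  rw [List.replicate_zero, List.nil_append, List.reverse_replicate, enc_replicate_nil] at h
  have h1 : half (0 + 0 + 1) = 1 := rfl
  rw [h, h1]
  push_cast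
  simp

theorem ind_not (χ : Bool) : (ind (!χ) : R) = 1 - ind χ := by cases χ <;> simp [ind]

theorem sg_cast (χ : Bool) : (sg χ : R) = 2 * ind χ - 1 := by
  cases χ <;> simp [ind, sg]; norm_num

theorem half_cast (k : ℕ) : (2 * half k + 1 : ℤ) = 3 ^ k := by exact_mod_cast two_mul_half k

/-- The two signs of `t` cancel, so the corrected type is determined by the last nonzero letter: `1`
gives filled and `2` gives hollow. -/
theorem turn_sg_bal {a : Fin 3} (ha : a ≠ 0) (t : Bool) {x : ℤ} (hx : 0 < x) :
    turn t (sg t * bal a * x) = decide (a = 1) := by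
  have h := eq_one_or_two ha
  rcases h with rfl | rfl <;> cases t <;>
    simp [turn, sg, bal, hx.le, hx, not_le.2]

theorem half_pos {k : ℕ} (hk : 0 < k) : (1 : ℤ) ≤ half k := by
  obtain ⟨j, rfl⟩ := Nat.exists_eq_succ_of_ne_zero hk.ne'
  rw [Nat.succ_eq_add_one, half_succ]
  have : 0 < 3 ^ j := by positivity
  push_cast
  have : (1 : ℤ) ≤ 3 ^ j := by exact_mod_cast this
  omega

/-- The five lemmas on `encStep` treat the matching transitions in the same way: the words before
and after are read until the same unread word remains. If all other letters vanish, the counter here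
passes from `0` to `1`, where `κ` changes in the filled type. -/
theorem encStep_filled_zero {ℓ : ℕ} (χ : Bool) (κ : R) (L : List (Fin 3)) (hL : L.length + 1 = ℓ) :
    encStep ℓ (enc true χ κ 0 0 (L.reverse ++ [0])) = enc true (!χ) κ 0 0 (1 :: L) := by
  obtain ⟨M, rfl⟩ : ∃ M, L = M.reverse := ⟨L.reverse, by simp⟩
  rw [List.reverse_reverse]
  rcases exists_replicate_zero M with h | ⟨j, a, M, ha, rfl⟩
  · rw [h, List.reverse_replicate, enc_start_replicate _ _ _ _ (by decide),
      show List.replicate M.length (0 : Fin 3) ++ [0] = List.replicate (M.length + 1) 0 by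
        rw [List.replicate_succ'], enc_replicate_nil]
    have h1 := half_pos (k := ℓ) (by omega)
    cases χ <;> simp [encStep, turn, sg, bal, ind, h1]
    ring
  · have e1 := enc_start true χ κ j 0 ha (M ++ [0])
    rw [List.append_assoc, List.cons_append, e1, List.reverse_append, List.reverse_singleton,
      List.singleton_append, enc_zero,
      enc_start_cons _ _ _ _ (by decide) ha]
    have h1 := half_pos (k := 0 + j + 1) (by omega)
    have h3 := half_cast (j + 1)
    have hs : half (j + 2) = _ := half_succ (j + 1)
    simp only [zero_add] at *
    have hs' : (half (j + 2) : ℤ) = 3 ^ (j + 1) + half (j + 1) := by rw [hs]; push_cast; rfl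
    -- Both readings have consumed the `j` zeros, the letter `a` and the rewritten letter, and the
    -- extreme value `half (j + 1)` faces its successor in absolute value.
    refine encStep_of_succ (t := true) (χ := !χ) (κ := κ + (j + 1) * ind χ + ind !χ)
      (Y := sg true * bal a * half (j + 1))
      (Y' := sg true * bal a * (half (j + 1) + 1)) (k := j + 2) (L := M.reverse) ?_ ?_ ?_ ?_ ?_ ?_
    · rfl
    · have e2 : turn true (sg true * bal 1) = true := rfl
      have e3 : (3 ^ (j + 1) + balRem (j + 1) (sg true * bal 1) : ℤ) = half (j + 1) + 1 := by
        rw [balRem, if_neg (by decide), show sg true * bal 1 = 1 by rfl]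
        omega
      rw [e2, e3, Bool.not_not]
      congr 1
      ring
    · simp at hL ⊢
      omega
    · rcases bal_eq ha with hb | hb <;> simp [Succ, sg, hb] <;> omega
    · rcases bal_eq ha with hb | hb <;> simp [sg, hb] <;> omega
    · rcases bal_eq ha with hb | hb <;> simp only [sg, hb, abs_le] <;> simp <;> omega

/-- The word stays and only the initial type changes, which exchanges the extreme values `half` and
`-half` at the first nonzero letter. These are neighbours after the rotation in `balRem`, as the
next letter `c` shows. If `c` is the only nonzero letter, this is the wrap-around of the whole
counter. -/
theorem encStep_filled_ne {ℓ : ℕ} (χ : Bool) (κ : R) (L : List (Fin 3)) {c : Fin 3} (hc : c ≠ 0)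
    (hL : L.length + 1 = ℓ) :
    encStep ℓ (enc true χ κ 0 0 (L ++ [c])) = enc false χ κ 0 0 (L ++ [c]) := by
  have main : ∀ j (a : Fin 3), a ≠ 0 → ∀ M, j + 1 + M.length + 1 = ℓ →
      encStep ℓ (enc true χ κ 0 0 (List.replicate j 0 ++ a :: (M ++ [c]))) =
        enc false χ κ 0 0 (List.replicate j 0 ++ a :: (M ++ [c])) := by
    intro j a ha M hl
    have h1 := half_pos (k := 0 + j + 1) (by omega)
    have h3 := half_cast (j + 1)
    have hs' : (half (j + 2) : ℤ) = 3 ^ (j + 1) + half (j + 1) := by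
      rw [half_succ (j + 1)]; push_cast; rfl
    have et : ∀ t, turn t (sg t * bal a * half (0 + j + 1)) = decide (a = 1) := fun t =>
      turn_sg_bal ha t (by omega)
    rw [enc_start _ _ _ _ _ ha, enc_start _ _ _ _ _ ha, List.reverse_append,
      List.reverse_singleton, List.singleton_append, enc_cons _ _ _ _ _ hc,
      enc_cons _ _ _ _ _ hc, et, et]
    simp only [zero_add] at *
    refine encStep_of_succ rfl rfl (by simp; omega) ?_ ?_ ?_
    · have h := eq_one_or_two ha
      rcases bal_eq hc with hb | hb <;> rcases h with rfl | rfl <;>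
        simp [Succ, balRem, sg, bal] <;> split_ifs <;> omega
    · refine abs_cons_le _ ?_ hc
      rcases bal_eq ha with hb | hb <;> simp [sg, hb]
    · refine abs_cons_le _ ?_ hc
      rcases bal_eq ha with hb | hb <;> simp [sg, hb]
  rcases exists_replicate_zero L with h | ⟨j, a, M, ha, rfl⟩
  · obtain ⟨j, rfl⟩ : ∃ j, L = List.replicate j 0 := ⟨_, h⟩
    have h1 := half_pos (k := 0 + j + 1) (by omega)
    have et : ∀ t, turn t (sg t * bal c * half (0 + j + 1)) = decide (c = 1) := fun t =>
      turn_sg_bal hc t (by omega)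
    rw [enc_start _ _ _ _ _ hc, enc_start _ _ _ _ _ hc, List.reverse_nil, enc_nil, enc_nil, et, et]
    have hl : 0 + j + 1 = ℓ := by simpa using hL
    rw [hl] at h1 ⊢
    have h := eq_one_or_two hc
    rcases h with rfl | rfl
    · simp [encStep, sg, bal]
      refine ⟨fun h => by omega, fun h => ?_⟩
      rw [abs_of_nonneg (by omega)] at h
      omega
    · simp [encStep, sg, bal]
      refine ⟨fun h => by omega, fun h => ?_⟩
      rw [abs_of_neg (by omega)] at h
      omega
  · rw [List.append_assoc, List.cons_append]
    exact main j a ha M (by simp at hL; omega)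

theorem encStep_hollow_zero {ℓ : ℕ} (χ : Bool) (κ : R) (L : List (Fin 3)) (hL : L.length + 1 = ℓ) :
    encStep ℓ (enc false χ κ 0 0 (0 :: L)) =
      enc true (!χ) (κ + (sg χ : R)) 0 0 (2 :: L.reverse) := by
  have h1 := half_pos (k := ℓ) (by omega)
  rcases exists_replicate_zero L with h | ⟨j, a, M, ha, rfl⟩
  · rw [enc_zero, h, List.reverse_replicate, enc_start_replicate _ _ _ _ (by decide),
      enc_replicate_nil]
    cases χ <;> simp [encStep, turn, sg, bal, ind, h1]
  · have e1 := enc_start false χ κ (j + 1) 0 ha M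
    rw [List.replicate_succ, List.cons_append] at e1
    rw [e1, enc_start_cons _ _ _ _ (by decide) ha]
    have h1 := half_pos (k := j + 1) (by omega)
    have h3 := half_cast (j + 1)
    have hs' : (half (j + 2) : ℤ) = 3 ^ (j + 1) + half (j + 1) := by
      rw [half_succ (j + 1)]; push_cast; rfl
    refine encStep_of_succ (t := false) (χ := !χ) (κ := κ + (j + 2) * ind χ)
      (Y := sg false * bal a * half (j + 2))
      (Y' := sg false * bal a * (half (j + 2) - 1)) (k := j + 2) (L := M.reverse) ?_ ?_ ?_ ?_ ?_ ?_
    · rw [show 0 + (j + 1) + 1 = j + 2 by ring]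
      congr 1
      push_cast
      ring
    · have e2 : turn true (sg true * bal 2) = false := rfl
      have e3 : (3 ^ (j + 1) + balRem (j + 1) (sg true * bal 2) : ℤ) = half (j + 2) - 1 := by
        rw [balRem, if_pos (by decide), show sg true * bal 2 = -1 by rfl]
        omega
      rw [e2, e3, Bool.not_not, ind_not, sg_cast]
      congr 1
      ring
    · simp at hL ⊢
      omega
    · rcases bal_eq ha with hb | hb <;> simp [Succ, sg, hb] <;> omega
    · rcases bal_eq ha with hb | hb <;> simp [sg, hb]
    · rcases bal_eq ha with hb | hb <;> simp only [sg, hb, abs_le] <;> simp <;> omega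

theorem encStep_hollow_one {ℓ : ℕ} (χ : Bool) (κ : R) (L : List (Fin 3)) (hL : L.length + 1 = ℓ) :
    encStep ℓ (enc false χ κ 0 0 (1 :: L)) =
      enc true (!χ) (κ + (sg χ : R)) 0 0 (0 :: L.reverse) := by
  have h1 := half_pos (k := ℓ) (by omega)
  obtain ⟨M, rfl⟩ : ∃ M, L = M.reverse := ⟨L.reverse, by simp⟩
  rw [List.reverse_reverse]
  rcases exists_replicate_zero M with h | ⟨j, a, M, ha, rfl⟩
  · rw [h, List.reverse_replicate, enc_start_replicate _ _ _ _ (by decide), enc_zero,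
      enc_replicate_nil]
    cases χ <;> simp [encStep, turn, sg, bal, ind]
  · have e1 := enc_start true (!χ) (κ + (sg χ : R)) (j + 1) 0 ha M
    rw [List.replicate_succ, List.cons_append] at e1
    rw [e1, enc_start_cons _ _ _ _ (by decide) ha]
    have h1 := half_pos (k := j + 1) (by omega)
    have h3 := half_cast (j + 1)
    have hs' : (half (j + 2) : ℤ) = 3 ^ (j + 1) + half (j + 1) := by
      rw [half_succ (j + 1)]; push_cast; rfl
    refine encStep_of_succ (t := true) (χ := χ) (κ := κ + ind χ + (j + 1) * ind !χ)
      (Y := sg true * bal a * (half (j + 2) - 1))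
      (Y' := sg true * bal a * half (j + 2)) (k := j + 2) (L := M.reverse) ?_ ?_ ?_ ?_ ?_ ?_
    · have e2 : turn false (sg false * bal 1) = true := rfl
      have e3 : (3 ^ (j + 1) + balRem (j + 1) (sg false * bal 1) : ℤ) = half (j + 2) - 1 := by
        rw [balRem, if_pos (by decide), show sg false * bal 1 = -1 by rfl]
        omega
      rw [e2, e3]
    · rw [show 0 + (j + 1) + 1 = j + 2 by ring, Bool.not_not, ind_not, sg_cast]
      congr 1
      push_cast
      ring
    · simp at hL ⊢
      omega
    · rcases bal_eq ha with hb | hb <;> simp [Succ, sg, hb] <;> omega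
    · rcases bal_eq ha with hb | hb <;> simp only [sg, hb, abs_le] <;> simp <;> omega
    · rcases bal_eq ha with hb | hb <;> simp [sg, hb]

/-- If all other letters vanish, the counter passes from `1` to `0`, where `κ` changes in the hollow
type. -/
theorem encStep_hollow_two {ℓ : ℕ} (χ : Bool) (κ : R) (L : List (Fin 3)) (hL : L.length + 1 = ℓ) :
    encStep ℓ (enc false χ κ 0 0 (2 :: L)) =
      enc false (!χ) κ 0 0 (L.reverse ++ [0]) := by
  have h1 := half_pos (k := ℓ) (by omega)
  obtain ⟨M, rfl⟩ : ∃ M, L = M.reverse := ⟨L.reverse, by simp⟩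
  rw [List.reverse_reverse]
  rcases exists_replicate_zero M with h | ⟨j, a, M, ha, rfl⟩
  · rw [h, List.reverse_replicate, enc_start_replicate _ _ _ _ (by decide),
      show List.replicate M.length (0 : Fin 3) ++ [0] = List.replicate (M.length + 1) 0 by
        rw [List.replicate_succ'], enc_replicate_nil]
    cases χ <;> simp [encStep, turn, sg, bal, ind]
    ring
  · have e1 := enc_start false (!χ) κ j 0 ha (M ++ [0])
    have e2 : (M ++ [0]).reverse = 0 :: M.reverse := by simp
    rw [List.append_assoc, List.cons_append, e1, e2, enc_zero,
      enc_start_cons _ _ _ _ (by decide) ha]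
    have h1 := half_pos (k := j + 1) (by omega)
    have h3 := half_cast (j + 1)
    have hs' : (half (j + 2) : ℤ) = 3 ^ (j + 1) + half (j + 1) := by
      rw [half_succ (j + 1)]; push_cast; rfl
    refine encStep_of_succ (t := false) (χ := χ) (κ := κ + ind χ + (j + 1) * ind !χ)
      (Y := sg false * bal a * (half (j + 1) + 1))
      (Y' := sg false * bal a * half (j + 1)) (k := j + 2) (L := M.reverse) ?_ ?_ ?_ ?_ ?_ ?_
    · have e2 : turn false (sg false * bal 2) = false := rfl
      have e3 : (3 ^ (j + 1) + balRem (j + 1) (sg false * bal 2) : ℤ) = half (j + 1) + 1 := by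
        rw [balRem, if_neg (by decide), show sg false * bal 2 = 1 by rfl]
        omega
      rw [e2, e3]
    · rw [show 0 + j + 1 = j + 1 by ring, Bool.not_not]
      congr 1
      ring
    · simp at hL ⊢
      omega
    · rcases bal_eq ha with hb | hb <;> simp [Succ, sg, hb] <;> omega
    · rcases bal_eq ha with hb | hb <;> simp only [sg, hb, abs_le] <;> simp <;> omega
    · rcases bal_eq ha with hb | hb <;> simp [sg, hb] <;> omega

end

end TM

namespace TM

/-! ## Computing the counter by gates -/

/-- The type of a triangle: filled or hollow. -/
def Triangle.typ : Triangle → Bool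
  | .filledRight => true
  | .filledLeft => true
  | .hollowRight => false
  | .hollowLeft => false

/-- The direction in which a word is read: filled triangles see its last letter, and hollow ones
its first letter. -/
def Triangle.chi : Triangle → Bool
  | .filledRight => false
  | .filledLeft => true
  | .hollowRight => true
  | .hollowLeft => false

def Triangle.flipTyp : Triangle → Triangle
  | .filledRight => .hollowLeft
  | .filledLeft => .hollowRight
  | .hollowRight => .filledLeft
  | .hollowLeft => .filledRight

def Triangle.flipChi : Triangle → Triangle
  | .filledRight => .filledLeft
  | .filledLeft => .filledRight
  | .hollowRight => .hollowLeft
  | .hollowLeft => .hollowRight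

theorem Triangle.ext_typ_chi {a b : Triangle} (h : a.typ = b.typ) (h' : a.chi = b.chi) : a = b := by
  cases a <;> cases b <;> simp_all [Triangle.typ, Triangle.chi]

/-- The permutation of the states that exchanges the types. -/
def flipTypPerm : Equiv.Perm SmartState := Function.Involutive.toPerm
  (fun q => (q.1.flipTyp, q.2)) fun ⟨q, i⟩ => by cases q <;> rfl

/-- The permutation of the states that reverses the directions. -/
def flipChiPerm : Equiv.Perm SmartState := Function.Involutive.toPerm
  (fun q => (q.1.flipChi, q.2)) fun ⟨q, i⟩ => by cases q <;> rfl

theorem Triangle.typ_flipTyp (a : Triangle) : a.flipTyp.typ = !a.typ := by cases a <;> rfl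
theorem Triangle.chi_flipTyp (a : Triangle) : a.flipTyp.chi = a.chi := by cases a <;> rfl
theorem Triangle.typ_flipChi (a : Triangle) : a.flipChi.typ = a.typ := by cases a <;> rfl
theorem Triangle.chi_flipChi (a : Triangle) : a.flipChi.chi = !a.chi := by cases a <;> rfl

section

variable {ℓ : ℕ}

/-- The word on the cells from `k` on. -/
def cells (v : ZMod ℓ → Fin 3) (k : ℕ) : List (Fin 3) :=
  (List.range' k (ℓ - k)).map fun i => v (i : ℕ)

theorem cells_cons (v : ZMod ℓ → Fin 3) {k : ℕ} (hk : k < ℓ) :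
    cells v k = v k :: cells v (k + 1) := by
  rw [cells, cells, show ℓ - k = (ℓ - (k + 1)) + 1 by omega, List.range'_succ, List.map_cons]

theorem cells_self (v : ZMod ℓ → Fin 3) : cells v ℓ = [] := by simp [cells]

theorem cells_congr {v w : ZMod ℓ → Fin 3} {k : ℕ} (h : ∀ i, k ≤ i → i < ℓ → v (i : ℕ) = w (i : ℕ)) :
    cells v k = cells w k :=
  List.map_congr_left fun i hi => by
    rw [List.mem_range'_1] at hi
    exact h i hi.1 (by omega)

/-- The reversal of the cells after the `k`-th one. -/
def revFun (k : ℕ) (i : ZMod ℓ) : ZMod ℓ := if k < i.val then ((ℓ + k - i.val : ℕ) : ZMod ℓ) else i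

theorem revFun_natCast_of_le {k i : ℕ} (hi : i ≤ k) (hk : k < ℓ) :
    revFun k (i : ZMod ℓ) = i := by
  rw [revFun, ZMod.val_natCast, Nat.mod_eq_of_lt (by omega), if_neg (by omega)]

theorem revFun_natCast_of_lt {k i : ℕ} (hi : k < i) (hl : i < ℓ) :
    revFun k (i : ZMod ℓ) = ((ℓ + k - i : ℕ) : ZMod ℓ) := by
  rw [revFun, ZMod.val_natCast, Nat.mod_eq_of_lt hl, if_pos hi]

theorem exists_natCast [NeZero ℓ] (i : ZMod ℓ) : ∃ j < ℓ, (j : ZMod ℓ) = i :=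
  ⟨i.val, ZMod.val_lt i, ZMod.natCast_zmod_val i⟩

def revPerm [NeZero ℓ] {k : ℕ} (hk : k < ℓ) : Equiv.Perm (ZMod ℓ) :=
  Function.Involutive.toPerm (revFun k) fun i => by
    obtain ⟨j, hj, rfl⟩ := exists_natCast i
    by_cases h : k < j
    · rw [revFun_natCast_of_lt h hj, revFun_natCast_of_lt (by omega) (by omega)]
      congr 1
      omega
    · rw [revFun_natCast_of_le (not_lt.1 h) hk, revFun_natCast_of_le (not_lt.1 h) hk]

theorem cells_comp_revPerm [NeZero ℓ] {k : ℕ} (hk : k < ℓ) (v : ZMod ℓ → Fin 3) :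
    cells (v ∘ revPerm hk) (k + 1) = (cells v (k + 1)).reverse := by
  refine List.ext_getElem (by simp [cells]) fun i h1 h2 => ?_
  simp only [cells, List.length_map, List.length_range'] at h1
  simp only [cells, List.getElem_map, List.getElem_range', List.getElem_reverse, List.length_map,
    List.length_range', Function.comp, one_mul]
  change v (revFun k _) = _
  rw [revFun_natCast_of_lt (by omega) (by omega)]
  congr 2
  omega

/-- The letters after those on the first `k` cells have been negated. -/
def negCells : ℕ → (ZMod ℓ → Fin 3) → ZMod ℓ → Fin 3
  | 0, v => v
  | k + 1, v => negCells k (Function.update v k (-v k))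

theorem negCells_apply_of_le {k j : ℕ} (hkj : k ≤ j) (hj : j < ℓ) (v : ZMod ℓ → Fin 3) :
    negCells k v j = v j := by
  induction k generalizing v with
  | zero => rfl
  | succ k ih =>
    rw [negCells, ih (by omega), Function.update_of_ne (natCast_ne hj (by omega) (by omega))]

/-- Negating letters exchanges the digits `0` and `2`, so the balanced value `num v k - half k`
changes its sign. -/
theorem num_negCells {k : ℕ} (hk : k ≤ ℓ) (v : ZMod ℓ → Fin 3) :
    num (negCells k v) k + num v k = 2 * half k := by
  induction k generalizing v with
  | zero => simp [num, half_zero]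
  | succ k ih =>
    have h := ih (by omega) (Function.update v k (-v k))
    rw [num_congr (v := Function.update v (k : ZMod ℓ) (-v k)) (w := v) fun i hi =>
      Function.update_of_ne (natCast_ne (ℓ := ℓ) (by omega) (by omega) (by omega)) _ _] at h
    rw [negCells, num_succ, num_succ, negCells_apply_of_le le_rfl (by omega), Function.update_self,
      half_succ]
    have e : ∀ x : Fin 3, (-x + 1).val + (x + 1).val = 2 := by decide
    have h1 := e (v k)
    have h2 : (-v k + 1).val * 3 ^ k + (v k + 1).val * 3 ^ k = 2 * 3 ^ k := by rw [← add_mul, h1]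
    omega

variable [Fact (1 < ℓ)]

theorem PredCost.negCells {P : (ZMod ℓ → Fin 3) → Prop} [DecidablePred P] {c : ℕ}
    (hP : PredCost P c) {k : ℕ} (hk : k ≤ ℓ) (h : IndepOf P {i | ∃ j < k, (j : ZMod ℓ) = i})
    (A : Finset SmartState) :
    CostLE (fun x : View ℓ => if P x.2.1 ∧ x.1.1 ∈ A then
      (x.1, negCells k x.2.1, x.2.2) else x) (gateConst * (c + ℓ) * k) := by
  induction k with
  | zero =>
    refine (CostLE.id (ℓ := ℓ)).mono (Nat.zero_le _) |> (cast (congrArg (CostLE · _) ?_))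
    funext x
    split_ifs <;> rfl
  | succ k ih =>
    have hkk : IndepOf P {(k : ZMod ℓ)} := h.mono (by
      rintro _ rfl
      exact ⟨k, by omega, rfl⟩)
    have h1 := hP.condCell hkk fun q => if q ∈ A then Equiv.neg _ else 1
    have h3 := ih (by omega) (h.mono fun i ⟨j, hj, e⟩ => ⟨j, by omega, e⟩)
    convert (h3.comp h1).mono (m := gateConst * (c + ℓ) * (k + 1)) (by rw [Nat.mul_succ]) using 1
    funext x
    obtain ⟨q, v, p⟩ := x
    have e : ∀ y, P (Function.update v k y) ↔ P v := fun y => hkk _ _ fun j hj => by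
      have : j ≠ k := hj
      simp [this]
    by_cases hc : P v
    · by_cases hq : q.1 ∈ A <;> simp [TM.condCell, hc, hq, e, TM.negCells]
    · simp [TM.condCell, hc]

/-- All digits of `half k` are `1`, the digit of the letter `0`. So the sign of the counter is
decided by the highest nonzero letter. -/
theorem predCost_num_lt_half {k : ℕ} (hk : k ≤ ℓ) :
    PredCost (fun v : ZMod ℓ → Fin 3 => num v k < half k) (4000 * ℓ ^ 2) := by
  refine (predCost_lex k hk (fun i => {0}) (fun i => {2}) fun j => by simp).congr fun v => ?_
  have h := sum_lt_sum_iff_lex (fun _ => 1) (fun i => (v (i : ZMod ℓ) + 1).val)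
    (fun i => by norm_num) (fun i => Fin.is_lt _) k
  have h' : ∑ i ∈ Finset.range k, 1 * 3 ^ i = half k := by
    clear hk h
    induction k with
    | zero => simp [half_zero]
    | succ k ih => rw [Finset.sum_range_succ, ih, half_succ]; ring
  rw [h'] at h
  rw [num, h]
  have e1 : ∀ x : Fin 3, x ∈ ({0} : Finset (Fin 3)) ↔ 1 = (x + 1).val := by decide
  have e2 : ∀ x : Fin 3, x ∈ ({2} : Finset (Fin 3)) ↔ (x + 1).val < 1 := by decide
  simp only [e1, e2]

/-- What is computed from the last letters, if the first `k` letters hold the counter. -/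
def dec (k : ℕ) (x : View ℓ) : Bool × Bool × ZMod ℓ × ℤ :=
  enc x.1.1.1.typ x.1.1.1.chi x.2.2 (num x.2.1 k - half k) k (cells x.2.1 k)

end

end TM

/-! ### Processing one letter of the counter in place -/

namespace TM

section

variable {ℓ : ℕ}

/-- The letters after the computation of one letter of the counter; `b` is the resulting type. -/
def stageCells [NeZero ℓ] {k : ℕ} (hk : k < ℓ) (b : Bool) (v : ZMod ℓ → Fin 3) : ZMod ℓ → Fin 3 :=
  let w := Function.update (addCells (half k) k (v ∘ revPerm hk)) k (if b then v k else -v k)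
  if w k ∈ ({2} : Finset (Fin 3)) then negCells k w else w

theorem comp_revPerm_natCast [NeZero ℓ] {k i : ℕ} (hk : k < ℓ) (hi : i ≤ k) (v : ZMod ℓ → Fin 3) :
    (v ∘ revPerm hk) (i : ZMod ℓ) = v i := congrArg v (revFun_natCast_of_le hi hk)

theorem cells_stageCells [NeZero ℓ] {k : ℕ} (hk : k < ℓ) (b : Bool) (v : ZMod ℓ → Fin 3) :
    cells (stageCells hk b v) (k + 1) = (cells v (k + 1)).reverse := by
  rw [← cells_comp_revPerm hk]
  refine cells_congr fun i hi hl => ?_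
  have e : Function.update (addCells (half k) k (v ∘ revPerm hk)) (k : ZMod ℓ)
      (if b then v k else -v k) (i : ZMod ℓ) = (v ∘ revPerm hk) i := by
    rw [Function.update_of_ne (natCast_ne hl hk (by omega)),
      addCells_apply_of_le _ (by omega) hl]
  unfold stageCells
  by_cases h : Function.update (addCells (half k) k (v ∘ revPerm hk)) (k : ZMod ℓ)
      (if b then v k else -v k) k ∈ ({2} : Finset (Fin 3))
  · rw [if_pos h, negCells_apply_of_le (by omega) hl, e]
  · rw [if_neg h, e]

/-- Adding `half k` modulo `3 ^ k` performs the rotation `balRem`. The `k`-th letter, negated for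
the hollow type, becomes the leading balanced digit; if it is `-1`, negating the lower digits too
multiplies the entire number by `-1`. -/
theorem num_stageCells [NeZero ℓ] {k : ℕ} (hk : k < ℓ) (b : Bool) {v : ZMod ℓ → Fin 3}
    (hv : v k ≠ 0) : (num (stageCells hk b v) (k + 1) - half (k + 1) : ℤ) =
      sg b * bal (v k) * (3 ^ k + balRem k (num v k - half k)) := by
  set w := Function.update (addCells (half k) k (v ∘ revPerm hk)) (k : ZMod ℓ)
    (if b then v k else -v k) with hw
  have hst : stageCells hk b v = if w k ∈ ({2} : Finset (Fin 3)) then negCells k w else w := rfl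
  have e1 : num w k = (num v k + half k) % 3 ^ k := by
    rw [hw, num_congr (w := addCells (half k) k (v ∘ revPerm hk)) fun i hi =>
      Function.update_of_ne (natCast_ne (ℓ := ℓ) (by omega) (by omega) (by omega)) _ _,
      num_addCells _ hk.le,
      num_congr (w := v) fun i hi => comp_revPerm_natCast hk hi.le v]
  have e2 : (num w k : ℤ) = balRem k (num v k - half k) + half k := by
    have h1 := num_lt v k
    have h2 := two_mul_half k
    rw [e1, balRem]
    by_cases h : num v k ≤ half k
    · rw [if_pos (by omega), Nat.mod_eq_of_lt (by omega)]
      push_cast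
      ring
    · rw [if_neg (by omega), Nat.mod_eq_sub_mod (by omega), Nat.mod_eq_of_lt (by omega)]
      omega
  have e3 : w k = if b then v k else -v k := Function.update_self _ _ _
  have h2 := half_cast k
  have h4 : (half (k + 1) : ℤ) = 3 ^ k + half k := by rw [half_succ]; push_cast; rfl
  rw [hst, num_succ, h4]
  have hw2 : w k = 1 ∨ w k = 2 := by
    refine eq_one_or_two ?_
    rw [e3]
    cases b <;> simpa using hv
  have hs : sg b * bal (v k) = bal (w k) := by
    rw [e3]
    have : ∀ (b : Bool) (a : Fin 3), sg b * bal a = bal (if b then a else -a) := by decide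
    exact this b _
  rw [hs]
  rcases hw2 with h | h
  · rw [if_neg (by rw [h]; decide), h, show bal 1 = 1 by rfl, show ((1 : Fin 3) + 1).val = 2 by rfl]
    push_cast
    rw [e2]
    ring
  · have h5 := num_negCells hk.le w
    have h6 : (num (negCells k w) k : ℤ) = 2 * half k - num w k := by omega
    rw [if_pos (by rw [h]; decide), negCells_apply_of_le le_rfl hk, h, show bal 2 = -1 by rfl,
      show ((2 : Fin 3) + 1).val = 0 by rfl]
    push_cast
    rw [h6, e2]
    ring

/-- The computation of one letter of the counter. -/
noncomputable def stageMap [NeZero ℓ] {k : ℕ} (hk : k < ℓ) (x : View ℓ) : View ℓ :=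
  if x.2.1 k = 0 then (x.1, x.2.1, x.2.2 + ind x.1.1.1.chi) else
    let τ := if num x.2.1 k < half k then x.1.1.1.flipTyp else x.1.1.1
    (((τ.flipChi, x.1.1.2), x.1.2), stageCells hk τ.typ x.2.1, x.2.2 + ind x.1.1.1.chi)

/-- A letter `0` may stay in place as it is the balanced digit `0`. At a nonzero letter the gates
perform the recursion of `enc`, including the reversal of the unread cells. -/
theorem dec_stageMap [NeZero ℓ] {k : ℕ} (hk : k < ℓ) (x : View ℓ) :
    dec (k + 1) (stageMap hk x) = dec k x := by
  obtain ⟨⟨⟨τ, ι⟩, d⟩, v, p⟩ := x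
  have h4 : (half (k + 1) : ℤ) = 3 ^ k + half k := by rw [half_succ]; push_cast; rfl
  by_cases hv : v k = 0
  · simp only [stageMap, hv, if_true, dec, cells_cons v hk, enc_zero, num_succ]
    congr 1
    rw [h4, show ((0 : Fin 3) + 1).val = 1 by rfl]
    push_cast
    ring
  · simp only [stageMap, hv, if_false, dec, cells_cons v hk, enc_cons _ _ _ _ _ hv,
      num_stageCells hk _ hv, cells_stageCells, Triangle.typ_flipChi, Triangle.chi_flipChi]
    by_cases hn : num v k < half k
    · rw [if_pos hn, turn_of_neg _ (by omega), Triangle.typ_flipTyp, Triangle.chi_flipTyp]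
    · rw [if_neg hn, turn_of_nonneg _ (by omega)]

variable [Fact (1 < ℓ)]

theorem costLE_stageMap [NeZero ℓ] {k : ℕ} (hk : k < ℓ) :
    CostLE (stageMap hk) (gateConst * 1000000 * ℓ ^ 3) := by
  let N : (ZMod ℓ → Fin 3) → Prop := fun v => v k ∈ ({1, 2} : Finset (Fin 3))
  have hN : PredCost N (193 * ℓ) := predCost_apply_mem _ _
  have hkc : (k : ZMod ℓ) ∉ {i : ZMod ℓ | ∃ j < k, (j : ZMod ℓ) = i} := fun ⟨j, hj, h⟩ =>
    natCast_ne (ℓ := ℓ) (by omega) hk (by omega) h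
  have hkr : (k : ZMod ℓ) ∉ {i : ZMod ℓ | revPerm hk i ≠ i} := fun h =>
    h (revFun_natCast_of_le le_rfl hk)
  have c1 := costLE_shiftIn (ℓ := ℓ) (Finset.univ.filter fun q : SmartState => q.1.chi)
  have c2 := hN.condPerm (revPerm hk) (indepOf_apply_mem hkr _) Finset.univ
  have c3 := (hN.and (predCost_num_lt_half hk.le)).condState flipTypPerm
  have c4 := hN.addCells (half k) hk.le (indepOf_apply_mem hkc _) Finset.univ
  have c5 := hN.condState flipChiPerm
  -- This changes the letter on which the other operations are conditioned, so it comes after them.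
  -- It needs no condition itself, because negation fixes `0`.
  have c6 := (predCost_true (ℓ := ℓ)).condCell (i := k) (indepOf_true _)
    fun q => if q.1.typ then 1 else Equiv.neg _
  have c7 := (predCost_apply_mem (k : ZMod ℓ) {2}).negCells hk.le (indepOf_apply_mem hkc _)
    Finset.univ
  convert (c7.comp (c6.comp (c5.comp (c4.comp (c3.comp (c2.comp c1)))))).mono
    (m := gateConst * 1000000 * ℓ ^ 3) ?_ using 1
  · funext x
    obtain ⟨⟨⟨τ, ι⟩, d⟩, v, p⟩ := x
    have e1 : ∀ w : View ℓ, shiftIn (Finset.univ.filter fun q : SmartState => q.1.chi) w =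
        (w.1, w.2.1, w.2.2 + ind w.1.1.1.chi) := by
      intro w
      by_cases h : w.1.1.1.chi <;> simp [shiftIn, ind, h]
    have e2 : ∀ (b : Bool) (a : Fin 3),
        (if b = true then (1 : Equiv.Perm (Fin 3)) else Equiv.neg _) a = if b then a else -a := by
      decide
    have e5 : ∀ τ : Triangle, liftState flipChiPerm ((τ, ι), d) = ((τ.flipChi, ι), d) := fun _ => rfl
    have e6 : ∀ τ : Triangle, liftState flipTypPerm ((τ, ι), d) = ((τ.flipTyp, ι), d) := fun _ => rfl
    by_cases hv : v k = 0
    · have hn : ¬ N v := by simp [N, hv]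
      have e : Function.update v (k : ZMod ℓ) 0 = v := by rw [← hv, Function.update_eq_self]
      simp [stageMap, hv, TM.condPerm, TM.condState, TM.condCell, hn, e1, e2, e]
    · have hn : N v := by simpa [N] using eq_one_or_two hv
      have hn1 : N (v ∘ revPerm hk) := by
        change (v ∘ revPerm hk) k ∈ _
        rwa [comp_revPerm_natCast hk le_rfl]
      have hn2 : N (addCells (half k) k (v ∘ revPerm hk)) := by
        change addCells (half k) k (v ∘ revPerm hk) k ∈ _
        rwa [addCells_apply_of_le _ le_rfl hk, comp_revPerm_natCast hk le_rfl]
      have e3 : num (v ∘ revPerm hk) k = num v k :=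
        num_congr fun i hi => comp_revPerm_natCast hk hi.le v
      have e4 : addCells (half k) k (v ∘ revPerm hk) k = v k := by
        rw [addCells_apply_of_le _ le_rfl hk, comp_revPerm_natCast hk le_rfl]
      by_cases hl : num v k < half k <;>
      · simp only [stageMap, hv, if_false, TM.condPerm, TM.condState, TM.condCell, hn, hn1, hn2, e1,
          e2, e3, e4, e5, e6, hl, Function.comp_apply, if_true, and_true, and_self,
          Finset.mem_univ, Triangle.typ_flipChi, stageCells, and_false]
        split_ifs <;> rfl
  · have h1 : 1 ≤ ℓ := by omega
    have h2 : ℓ ≤ ℓ ^ 3 := Nat.le_self_pow (by norm_num) ℓ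
    have h3 : ℓ ^ 2 ≤ ℓ ^ 3 := Nat.pow_le_pow_right h1 (by norm_num)
    have b2 : 2400 * (193 * ℓ + ℓ) * ℓ = 465600 * ℓ ^ 2 := by ring
    have b4 : (3 * (193 * ℓ) + 8002 * ℓ ^ 2) * k ≤ 8581 * ℓ ^ 3 :=
      calc _ ≤ (579 * ℓ ^ 2 + 8002 * ℓ ^ 2) * ℓ := by
            have : ℓ ≤ ℓ ^ 2 := Nat.le_self_pow (by norm_num) ℓ
            exact Nat.mul_le_mul (by omega) hk.le
        _ = _ := by ring
    have b7 : (193 * ℓ + ℓ) * k ≤ 194 * ℓ ^ 2 :=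
      calc _ ≤ (193 * ℓ + ℓ) * ℓ := Nat.mul_le_mul_left _ hk.le
        _ = _ := by ring
    calc _ = gateConst * ((193 * ℓ + ℓ) * k + ((1 + ℓ) + (193 * ℓ +
          ((3 * (193 * ℓ) + 8002 * ℓ ^ 2) * k + ((2 * (193 * ℓ) + 2 * (4000 * ℓ ^ 2)) +
            (2400 * (193 * ℓ + ℓ) * ℓ + 5000 * ℓ ^ 2)))))) := by ring
      _ ≤ gateConst * (1000000 * ℓ ^ 3) := Nat.mul_le_mul_left _ (by omega)
      _ = _ := by ring

end

end TM

/-! ### The counter as an odometer with carries into the position -/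

namespace TM

section

variable {ℓ : ℕ}

theorem stageMap_snd [NeZero ℓ] {k : ℕ} (hk : k < ℓ) (x : View ℓ) :
    (stageMap hk x).1.1.2 = x.1.1.2 ∧ (stageMap hk x).1.2 = x.1.2 := by
  unfold stageMap
  split_ifs <;> exact ⟨rfl, rfl⟩

/-- The number of macro steps since the counter was `0` in direction `true`, and `1` in direction
`false`. -/
def code (ℓ : ℕ) (b : Bool) (Y : ℤ) : ℤ := if b then (Y - 1) % 3 ^ ℓ else -Y % 3 ^ ℓ

/-- The type is corrected, and the counter is replaced by its code. -/
def finMap (x : View ℓ) : View ℓ :=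
  let τ := if num x.2.1 ℓ < half ℓ then x.1.1.1.flipTyp else x.1.1.1
  (((τ, x.1.1.2), x.1.2), if τ.typ = true then addCells (half ℓ) ℓ x.2.1
    else addCells (half ℓ + 1) ℓ (negCells ℓ x.2.1), x.2.2)

theorem typ_finMap (x : View ℓ) : (finMap x).1.1.1.typ = (dec ℓ x).1 := by
  rw [dec, cells_self, enc_nil]
  simp only [finMap]
  by_cases h : num x.2.1 ℓ < half ℓ
  · rw [if_pos h, turn_of_neg _ (by omega), Triangle.typ_flipTyp]
  · rw [if_neg h, turn_of_nonneg _ (by omega)]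

theorem chi_finMap (x : View ℓ) : (finMap x).1.1.1.chi = (dec ℓ x).2.1 := by
  rw [dec, cells_self, enc_nil]
  simp only [finMap]
  by_cases h : num x.2.1 ℓ < half ℓ
  · rw [if_pos h, Triangle.chi_flipTyp]
  · rw [if_neg h]

theorem pos_finMap (x : View ℓ) : (finMap x).2.2 = (dec ℓ x).2.2.1 := by
  rw [dec, cells_self, enc_nil]
  rfl

/-- Since `3 ^ ℓ = 2 * half ℓ + 1`, adding `half ℓ` to `Y + half ℓ` gives `Y - 1`, and adding `half
ℓ + 1` to `-Y + half ℓ` gives `-Y`, modulo `3 ^ ℓ`. In both types a macro step now adds `1`. -/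
theorem num_finMap (x : View ℓ) :
    (num (finMap x).2.1 ℓ : ℤ) = code ℓ (dec ℓ x).1 (dec ℓ x).2.2.2 := by
  rw [← typ_finMap, dec, cells_self, enc_nil]
  have h2 := half_cast ℓ
  by_cases h : (finMap x).1.1.1.typ = true
  · have e : (finMap x).2.1 = addCells (half ℓ) ℓ x.2.1 := if_pos h
    rw [code, if_pos h, e, num_addCells _ le_rfl]
    push_cast
    rw [show (num x.2.1 ℓ + half ℓ : ℤ) = num x.2.1 ℓ - half ℓ - 1 + 3 ^ ℓ by rw [← h2]; ring]
    simp
  · have e : (finMap x).2.1 = addCells (half ℓ + 1) ℓ (negCells ℓ x.2.1) := if_neg h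
    rw [code, if_neg h, e, num_addCells _ le_rfl]
    have h3 := num_negCells le_rfl x.2.1
    push_cast
    have h4 : (num (negCells ℓ x.2.1) ℓ : ℤ) = 2 * half ℓ - num x.2.1 ℓ := by omega
    rw [h4, show (2 * half ℓ - num x.2.1 ℓ + (half ℓ + 1) : ℤ) =
      -(num x.2.1 ℓ - half ℓ) + 3 ^ ℓ by rw [← h2]; ring]
    simp

theorem abs_dec_le (x : View ℓ) : |(dec ℓ x).2.2.2| ≤ half ℓ := by
  rw [dec, cells_self, enc_nil]
  have h1 := num_lt x.2.1 ℓ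
  have h2 := two_mul_half ℓ
  rw [abs_le]
  constructor <;> push_cast <;> omega

theorem View.ext_num [NeZero ℓ] {x y : View ℓ} (h1 : x.1.1.1.typ = y.1.1.1.typ)
    (h2 : x.1.1.1.chi = y.1.1.1.chi) (h3 : x.1.1.2 = y.1.1.2) (h4 : x.1.2 = y.1.2)
    (h5 : num x.2.1 ℓ = num y.2.1 ℓ) (h6 : x.2.2 = y.2.2) : x = y := by
  obtain ⟨⟨⟨τ, ι⟩, d⟩, v, p⟩ := x
  obtain ⟨⟨⟨τ', ι'⟩, d'⟩, v', p'⟩ := y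
  have e1 := Triangle.ext_typ_chi h1 h2
  have e2 : v = v' := funext fun i => by
    obtain ⟨j, hj, rfl⟩ := exists_natCast i
    exact eq_of_num_eq h5 j hj
  simp only at e1 h3 h4 h6
  rw [e1, e2, h3, h4, h6]

/-- `m` is added to the code of a configuration of index two, and the position is shifted by the
number of carries. -/
def incMap (m : ℕ) (x : View ℓ) : View ℓ :=
  if x.1.1.2 = .two then (x.1, addCells m ℓ x.2.1,
    x.2.2 - (sg x.1.1.1.typ * sg x.1.1.1.chi : ℤ) * ((num x.2.1 ℓ + m) / 3 ^ ℓ : ℕ)) else x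

/-- The carries of successive additions add up, so the iterates of the increment are again of the
form `incMap m`. -/
theorem incMap_incMap [NeZero ℓ] (m n : ℕ) (x : View ℓ) :
    incMap m (incMap n x) = incMap (m + n) x := by
  by_cases h : x.1.1.2 = .two
  · have e : ∀ (a m n D : ℕ), (a + n) / D + ((a + n) % D + m) / D = (a + (m + n)) / D := by
      intro a m n D
      rcases Nat.eq_zero_or_pos D with rfl | hD
      · simp
      · conv_rhs => rw [show a + (m + n) = (a + n) % D + m + D * ((a + n) / D) by
          have := Nat.mod_add_div (a + n) D
          omega]
        rw [Nat.add_mul_div_left _ _ hD, add_comm]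
    refine View.ext_num ?_ ?_ ?_ ?_ ?_ ?_
    · simp [incMap, h]
    · simp [incMap, h]
    · simp [incMap, h]
    · simp [incMap, h]
    · simp only [incMap, h, if_true]
      rw [num_addCells _ le_rfl, num_addCells _ le_rfl, num_addCells _ le_rfl, Nat.mod_add_mod,
        add_assoc, add_comm n m]
    · simp only [incMap, h, if_true]
      rw [num_addCells _ le_rfl, ← e]
      push_cast
      ring
  · simp [incMap, h]

theorem incMap_zero [NeZero ℓ] (x : View ℓ) : incMap 0 x = x := by
  have h := num_lt x.2.1 ℓ
  by_cases hx : x.1.1.2 = .two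
  · refine View.ext_num ?_ ?_ ?_ ?_ ?_ ?_
    · simp [incMap, hx]
    · simp [incMap, hx]
    · simp [incMap, hx]
    · simp [incMap, hx]
    · simp only [incMap, hx, if_true]
      rw [num_addCells _ le_rfl, add_zero, Nat.mod_eq_of_lt h]
    · simp [incMap, hx, Nat.div_eq_of_lt h]
  · simp [incMap, hx]

theorem incMap_iterate [NeZero ℓ] (m : ℕ) : (incMap 1 : View ℓ → View ℓ)^[m] = incMap m := by
  induction m with
  | zero => funext x; rw [incMap_zero]; rfl
  | succ m ih =>
    rw [Function.iterate_succ', ih]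
    funext x
    rw [Function.comp, incMap_incMap, add_comm]

/-- One macro step increments the code. -/
theorem incMap_finMap [NeZero ℓ] {x y : View ℓ} (hx : x.1.1.2 = .two) (hy : y.1.1.2 = .two)
    (hd : x.1.2 = y.1.2) (h : encStep ℓ (dec ℓ x) = dec ℓ y) : incMap 1 (finMap x) = finMap y := by
  have hi : (finMap x).1.1.2 = .two := hx
  have h1 := typ_finMap x
  have h2 := chi_finMap x
  have h3 := pos_finMap x
  have h4 := num_finMap x
  have h5 := abs_dec_le x
  have h6 := half_cast ℓ
  have h7 := num_lt (finMap x).2.1 ℓ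
  have g1 := typ_finMap y
  have g2 := chi_finMap y
  have g3 := pos_finMap y
  have g4 := num_finMap y
  rw [← h] at g1 g2 g3 g4
  generalize dec ℓ x = r at *
  obtain ⟨t, χ, κ, Y⟩ := r
  simp only [encStep] at *
  rw [abs_le] at h5
  -- The wrap-around jumps by exactly `2 * half ℓ + 1 = 3 ^ ℓ`.
  have hY' : ∃ c : ℤ, (if |Y + sg t| ≤ half ℓ then Y + sg t else -(sg t * half ℓ)) =
      Y + sg t + 3 ^ ℓ * c := by
    split_ifs with h8
    · exact ⟨0, by ring⟩
    · refine ⟨-sg t, ?_⟩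
      rw [← h6]
      rw [abs_le] at h8
      cases t <;> simp [sg] at * <;> omega
  obtain ⟨c, hc⟩ := hY'
  rw [hc] at g4
  have key : (num (finMap x).2.1 ℓ + 1) % 3 ^ ℓ = num (finMap y).2.1 ℓ := by
    zify
    rw [h4, g4]
    cases t
    · refine (Int.ModEq.add_right 1 (Int.mod_modEq _ _)).trans (Int.modEq_iff_dvd.2 ⟨-c, ?_⟩)
      simp only [sg, Bool.false_eq_true, if_false]
      ring
    · refine (Int.ModEq.add_right 1 (Int.mod_modEq _ _)).trans (Int.modEq_iff_dvd.2 ⟨c, ?_⟩)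
      simp only [sg, if_true]
      ring
  -- The codes were chosen such that the overflow happens exactly where `encStep` changes `κ`.
  have carry : (num (finMap x).2.1 ℓ + 1) / 3 ^ ℓ =
      if (t = true ∧ Y = 0) ∨ (t = false ∧ Y = 1) then 1 else 0 := by
    have e : (num (finMap x).2.1 ℓ + 1) / 3 ^ ℓ =
        if num (finMap x).2.1 ℓ + 1 = 3 ^ ℓ then 1 else 0 := by
      split_ifs with h8
      · rw [h8, Nat.div_self (by positivity)]
      · exact Nat.div_eq_of_lt (by omega)
    rw [e]
    have h9 : (num (finMap x).2.1 ℓ + 1 = 3 ^ ℓ) ↔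
        ((num (finMap x).2.1 ℓ : ℤ) + 1 = 3 ^ ℓ) := by zify
    refine if_congr (h9.trans ?_) rfl rfl
    rw [h4, ← h6]
    have h10 := half_pos (NeZero.pos ℓ)
    cases t
    · simp only [code, Bool.false_eq_true, if_false, false_and, false_or, true_and, ← h6]
      by_cases hY : Y ≤ 0
      · rw [Int.emod_eq_of_lt (by omega) (by omega)]
        omega
      · rw [← Int.add_emod_right, Int.emod_eq_of_lt (by omega) (by omega)]
        omega
    · simp only [code, if_true, true_and, Bool.true_eq_false, false_and, or_false, ← h6]
      by_cases hY : 1 ≤ Y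
      · rw [Int.emod_eq_of_lt (by omega) (by omega)]
        omega
      · rw [← Int.add_emod_right, Int.emod_eq_of_lt (by omega) (by omega)]
        omega
  refine View.ext_num ?_ ?_ ?_ ?_ ?_ ?_
  · simp only [incMap, hi, if_true]
    rw [h1, g1]
  · simp only [incMap, hi, if_true]
    rw [h2, g2]
  · simp only [incMap, hi, if_true]
    exact hy.symm
  · simp only [incMap, hi, if_true]
    exact hd
  · simp only [incMap, hi, if_true]
    rw [num_addCells _ le_rfl, key]
  · simp only [incMap, hi, if_true]
    rw [h1, h2, h3, g3, carry]
    cases t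
    · by_cases hY : Y = 1 <;> cases χ <;> simp [hY, sg, sub_eq_add_neg]
    · by_cases hY : Y = 0 <;> cases χ <;> simp [hY, sg, sub_eq_add_neg]

variable [Fact (1 < ℓ)]

theorem le_gateConst_mul {a : ℕ} (b : ℕ) (h : a ≤ b * ℓ ^ 4) : a ≤ gateConst * b * ℓ ^ 4 := by
  rw [mul_assoc]
  exact h.trans (Nat.le_mul_of_pos_left _ gateConst_pos)

theorem pow_le_pow_four : 1 ≤ ℓ ^ 4 ∧ ℓ ≤ ℓ ^ 4 ∧ ℓ ^ 2 ≤ ℓ ^ 4 ∧ ℓ ^ 3 ≤ ℓ ^ 4 := by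
  have h : 1 ≤ ℓ := by have := Fact.out (p := 1 < ℓ); omega
  exact ⟨Nat.one_le_pow _ _ h, Nat.le_self_pow (by norm_num) ℓ,
    Nat.pow_le_pow_right h (by norm_num), Nat.pow_le_pow_right h (by norm_num)⟩

theorem costLE_finMap : CostLE (finMap (ℓ := ℓ)) (gateConst * 100000 * ℓ ^ 4) := by
  have hT := predCost_true (ℓ := ℓ)
  have c1 := (predCost_num_lt_half (le_refl ℓ)).condState flipTypPerm
  have c2 := hT.negCells le_rfl (indepOf_true _) (Finset.univ.filter fun q => q.1.typ = false)
  have c3 := hT.addCells (half ℓ + 1) le_rfl (indepOf_true _)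
    (Finset.univ.filter fun q => q.1.typ = false)
  have c4 := hT.addCells (half ℓ) le_rfl (indepOf_true _)
    (Finset.univ.filter fun q => q.1.typ = true)
  convert (c4.comp (c3.comp (c2.comp c1))).mono (m := gateConst * 100000 * ℓ ^ 4) ?_ using 1
  · funext x
    obtain ⟨⟨⟨τ, ι⟩, d⟩, v, p⟩ := x
    have e6 : ∀ τ : Triangle, liftState flipTypPerm ((τ, ι), d) = ((τ.flipTyp, ι), d) := fun _ => rfl
    by_cases hl : num v ℓ < half ℓ
    · cases hτ : τ.flipTyp.typ <;> simp [finMap, TM.condState, hl, e6, hτ]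
    · cases hτ : τ.typ <;> simp [finMap, TM.condState, hl, hτ]
  · obtain ⟨h1, h2, h3, h4⟩ := pow_le_pow_four (ℓ := ℓ)
    calc _ = gateConst * (16004 * ℓ ^ 3 + 4001 * ℓ ^ 2 + 7 * ℓ) := by ring
      _ ≤ gateConst * (100000 * ℓ ^ 4) := Nat.mul_le_mul_left _ (by omega)
      _ = _ := by ring

/-- The cost does not grow with `m`: the digits matter modulo `3 ^ ℓ` and the number of carries
modulo `ℓ`. The carries split into the constant `m / 3 ^ ℓ` and one more that depends on the tape
and is applied before the digits change. -/
theorem costLE_incMap (m : ℕ) : CostLE (incMap (ℓ := ℓ) m) (gateConst * 100000 * ℓ ^ 4) := by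
  have : NeZero ℓ := ⟨by have := Fact.out (p := 1 < ℓ); omega⟩
  have hT := predCost_true (ℓ := ℓ)
  -- Exchanging the types exchanges this set with the remaining states of index two, so
  -- `PredCost.shift_commutator` shifts by `-(sg typ * sg chi)` on index two and by `0` on index
  -- one.
  let A : Finset SmartState := Finset.univ.filter fun q => q.2 = .two ∧ q.1.typ ≠ q.1.chi
  have c1 := (hT.shift_commutator A flipTypPerm).iterate ((m / 3 ^ ℓ) % ℓ)
  have c2 := (predCost_lt_num (le_refl ℓ) m).shift_commutator A flipTypPerm
  have c3 := hT.addCells m le_rfl (indepOf_true _) (Finset.univ.filter fun q => q.2 = .two)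
  convert (c3.comp (c2.comp c1)).mono (m := gateConst * 100000 * ℓ ^ 4) ?_ using 1
  · have hA : ∀ q : SmartState, (if q ∈ A then (1 : ZMod ℓ) else 0) -
        (if flipTypPerm q ∈ A then 1 else 0) =
        if q.2 = .two then -((sg q.1.typ * sg q.1.chi : ℤ) : ZMod ℓ) else 0 := by
      have hm : ∀ q, q ∈ A ↔ q.2 = .two ∧ q.1.typ ≠ q.1.chi := fun q => by simp [A]
      have hf : ∀ q, flipTypPerm q = (q.1.flipTyp, q.2) := fun _ => rfl
      rintro ⟨_ | _ | _ | _, _ | _⟩ <;>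
        simp [hm, hf, Triangle.flipTyp, Triangle.typ, Triangle.chi, sg]
    simp only [add_sub_assoc, hA]
    have hit : ∀ (k : ℕ) (x : View ℓ), (fun c : View ℓ => (c.1, c.2.1, if True then
        c.2.2 + (if c.1.1.2 = .two then -((sg c.1.1.1.typ * sg c.1.1.1.chi : ℤ) : ZMod ℓ) else 0)
        else c.2.2))^[k] x = (x.1, x.2.1, x.2.2 + k * (if x.1.1.2 = .two then
          -((sg x.1.1.1.typ * sg x.1.1.1.chi : ℤ) : ZMod ℓ) else 0)) := by
      intro k x
      induction k with
      | zero => simp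
      | succ k ih =>
        rw [Function.iterate_succ_apply', ih]
        simp only [if_true, Prod.mk.injEq, true_and]
        push_cast
        ring
    funext x
    simp only [Function.comp_apply, hit]
    obtain ⟨⟨⟨τ, ι⟩, d⟩, v, p⟩ := x
    by_cases hι : ι = .two
    · have hdiv : (((num v ℓ + m) / 3 ^ ℓ : ℕ) : ZMod ℓ) =
          ((m / 3 ^ ℓ % ℓ : ℕ) : ZMod ℓ) + if 3 ^ ℓ ≤ num v ℓ + m % 3 ^ ℓ then 1 else 0 := by
        have h1 := num_lt v ℓ
        have h2 : m % 3 ^ ℓ < 3 ^ ℓ := Nat.mod_lt _ (by positivity)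
        have h3 : num v ℓ + m = num v ℓ + m % 3 ^ ℓ + 3 ^ ℓ * (m / 3 ^ ℓ) := by
          have := Nat.mod_add_div m (3 ^ ℓ)
          omega
        rw [h3, Nat.add_mul_div_left _ _ (by positivity), Nat.cast_add, ZMod.natCast_mod, add_comm]
        congr 1
        split_ifs with h4
        · rw [Nat.div_eq_sub_div (by positivity) h4, Nat.div_eq_of_lt (by omega)]
          simp
        · rw [Nat.div_eq_of_lt (by omega)]
          simp
      simp only [incMap, hι, if_true, hdiv, true_and, Finset.mem_filter, Finset.mem_univ,
        Prod.mk.injEq]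
      split_ifs <;> ring
    · simp [incMap, hι]
  · obtain ⟨h1, h2, h3, h4⟩ := pow_le_pow_four (ℓ := ℓ)
    have h5 : m / 3 ^ ℓ % ℓ ≤ ℓ := (Nat.mod_lt _ (NeZero.pos ℓ)).le
    calc _ ≤ gateConst * (3 * 1 + 8002 * ℓ ^ 2) * ℓ +
          (gateConst * (2 * (4000 * ℓ ^ 2) + 10000 * ℓ ^ 2) +
            ℓ * (gateConst * (2 * 1 + 10000 * ℓ ^ 2))) := by gcongr
      _ = gateConst * (18002 * ℓ ^ 3 + 18000 * ℓ ^ 2 + 5 * ℓ) := by ring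
      _ ≤ gateConst * (100000 * ℓ ^ 4) := Nat.mul_le_mul_left _ (by omega)
      _ = _ := by ring

/-- All stages of the computation of the counter. -/
theorem exists_stages [NeZero ℓ] (k : ℕ) (hk : k ≤ ℓ) : ∃ f : View ℓ → View ℓ,
    CostLE f (k * (gateConst * 1000000 * ℓ ^ 3)) ∧
      ∀ x, dec k (f x) = dec 0 x ∧ (f x).1.1.2 = x.1.1.2 ∧ (f x).1.2 = x.1.2 := by
  induction k with
  | zero => exact ⟨id, CostLE.id.mono (Nat.zero_le _), fun x => ⟨rfl, rfl, rfl⟩⟩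
  | succ k ih =>
    obtain ⟨f, hf, h⟩ := ih (by omega)
    have hk' : k < ℓ := hk
    refine ⟨stageMap hk' ∘ f, ((costLE_stageMap hk').comp hf).mono (by rw [Nat.succ_mul, add_comm]),
      fun x => ⟨?_, ?_, ?_⟩⟩
    · rw [Function.comp, dec_stageMap, (h x).1]
    · rw [Function.comp, (stageMap_snd hk' _).1, (h x).2.1]
    · rw [Function.comp, (stageMap_snd hk' _).2, (h x).2.2]

end

end TM

/-! ### A macro step on a cyclic tape increments the counter -/

namespace TM

section

variable {ℓ : ℕ}

/-- The view from the boundary between the letters that the head has in front of it and those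
behind it, where the letters are read in the direction of the counter. -/
def normMap (x : View ℓ) : View ℓ :=
  match x.1.1.1 with
  | .filledRight => (x.1, fun j => x.2.1 (-j), x.2.2 + 1)
  | .filledLeft => x
  | .hollowRight => (x.1, fun j => x.2.1 (j + 1), x.2.2 + 1)
  | .hollowLeft => (x.1, fun j => x.2.1 (-1 - j), x.2.2)

theorem normMap_fst (x : View ℓ) : (normMap x).1 = x.1 := by
  obtain ⟨⟨⟨_ | _ | _ | _, ι⟩, d⟩, v, p⟩ := x <;> rfl

def Triangle.toPair : Triangle → Bool × Dir
  | .filledRight => (true, .right)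
  | .filledLeft => (true, .left)
  | .hollowRight => (false, .right)
  | .hollowLeft => (false, .left)

theorem triangle_toPair (τ : Triangle) : triangle τ.toPair = τ := by cases τ <;> rfl

/-- Two steps of SMART from a configuration of index two. -/
def macroView (x : View ℓ) : View ℓ :=
  if x.1.1.2 = .two then
    (((triangle (smartWrite x.1.1.1.toPair (x.2.1 (x.1.1.1.toPair.2.val : ℤ))).1, .two), x.1.2),
      fun j => Function.update x.2.1 ((x.1.1.1.toPair.2.val : ℤ) : ZMod ℓ)
        (smartWrite x.1.1.1.toPair (x.2.1 (x.1.1.1.toPair.2.val : ℤ))).2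
        (j + (x.1.1.1.toPair.2.val : ℤ)),
      x.2.2 + (x.1.1.1.toPair.2.val : ℤ))
  else x

theorem dec_zero (x : View ℓ) :
    dec 0 x = enc x.1.1.1.typ x.1.1.1.chi x.2.2 0 0 (cells x.2.1 0) := by
  rw [dec, half_zero]
  simp [num]

theorem cells_zero_cons {m : ℕ} (hm : m + 1 = ℓ) (v : ZMod ℓ → Fin 3) :
    cells v 0 = v 0 :: (List.range m).map fun i => v ((i : ℕ) + 1 : ZMod ℓ) := by
  subst hm
  rw [cells, Nat.sub_zero, ← List.range_eq_range', List.range_succ_eq_map]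
  simp [Function.comp_def]

theorem natCast_eq_neg_one {m : ℕ} (hm : m + 1 = ℓ) : (m : ZMod ℓ) = -1 := by
  have : ((m + 1 : ℕ) : ZMod ℓ) = 0 := by rw [hm]; exact ZMod.natCast_self ℓ
  push_cast at this
  linear_combination this

theorem cells_zero_concat {m : ℕ} (hm : m + 1 = ℓ) (v : ZMod ℓ → Fin 3) :
    cells v 0 = ((List.range m).map fun i => v ((i : ℕ) : ZMod ℓ)) ++ [v (-1)] := by
  have h := natCast_eq_neg_one hm
  subst hm
  rw [cells, Nat.sub_zero, ← List.range_eq_range', List.range_succ, List.map_append,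
    List.map_cons, List.map_nil, h]

theorem map_range_reverse {m : ℕ} (hm : m + 1 = ℓ) (g : ZMod ℓ → Fin 3) :
    ((List.range m).map fun i => g ((i : ℕ) : ZMod ℓ)).reverse =
      (List.range m).map fun i => g (-2 - (i : ℕ) : ZMod ℓ) := by
  refine List.ext_getElem (by simp) fun i h1 h2 => ?_
  simp only [List.length_map, List.length_range] at h2
  simp only [List.getElem_reverse, List.getElem_map, List.getElem_range, List.length_map,
    List.length_range]
  congr 1
  have h := natCast_eq_neg_one hm
  rw [show m - 1 - i = m - (1 + i) by omega, Nat.cast_sub (by omega), h]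
  push_cast
  ring

theorem map_range_congr {m : ℕ} (hm : m + 1 = ℓ) {f g : ZMod ℓ → Fin 3}
    (h : ∀ i : ZMod ℓ, i + 1 ≠ 0 → f i = g i) :
    ((List.range m).map fun i => f ((i : ℕ) : ZMod ℓ)) =
      (List.range m).map fun i => g ((i : ℕ) : ZMod ℓ) :=
  List.map_congr_left fun i hi => h _ (by
    have hi := List.mem_range.1 hi
    have := natCast_ne (ℓ := ℓ) (i := i + 1) (j := 0) (by omega) (by omega) (by omega)
    simpa using this)

/-- After `normMap` the unread interval is the whole cycle cut beside the head, `κ` is its left end,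
and it is read from the left or the right end according to `chi`. A filled head rewrites the last
letter of this word and a hollow one the first; the four triangles thus reduce to the five lemmas on
`encStep`. -/
theorem encStep_dec_normMap [Fact (1 < ℓ)] (x : View ℓ) (hx : x.1.1.2 = .two) :
    encStep ℓ (dec 0 (normMap x)) = dec 0 (normMap (macroView x)) := by
  obtain ⟨m, hm⟩ : ∃ m, m + 1 = ℓ := ⟨ℓ - 1, by have := Fact.out (p := 1 < ℓ); omega⟩
  obtain ⟨⟨⟨τ, ι⟩, d⟩, v, p⟩ := x
  obtain rfl : ι = .two := hx
  rw [dec_zero, dec_zero]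
  -- the last letter is read and replaced, and the word is reversed
  have last : ∀ (χ : Bool) (κ κ' : ZMod ℓ) (u w : ZMod ℓ → Fin 3), u (-1) = 0 → w 0 = 1 → κ = κ' →
      (∀ i, i + 1 ≠ 0 → w (i + 1) = u (-2 - i)) →
      encStep ℓ (enc true χ κ 0 0 (cells u 0)) = enc true (!χ) κ' 0 0 (cells w 0) := by
    rintro χ κ _ u w hu hw rfl h
    rw [cells_zero_concat hm u, cells_zero_cons hm w, hu, hw]
    have e := map_range_congr hm h
    rw [e, ← map_range_reverse hm]
    conv_lhs => rw [← List.reverse_reverse ((List.range m).map _)]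
    exact encStep_filled_zero χ κ _ (by simp [hm])
  have same : ∀ (χ : Bool) (κ κ' : ZMod ℓ) (u w : ZMod ℓ → Fin 3), u (-1) ≠ 0 → κ = κ' →
      (∀ i, w i = u i) →
      encStep ℓ (enc true χ κ 0 0 (cells u 0)) = enc false χ κ' 0 0 (cells w 0) := by
    rintro χ κ _ u w hu rfl h
    rw [show w = u from funext h, cells_zero_concat hm u]
    exact encStep_filled_ne χ κ _ hu (by simp [hm])
  have first : ∀ (χ : Bool) (κ κ' : ZMod ℓ) (u w : ZMod ℓ → Fin 3),
      ((u 0 = 0 ∧ w 0 = 2) ∨ (u 0 = 1 ∧ w 0 = 0)) → κ + (sg χ : ℤ) = κ' →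
      (∀ i, i + 1 ≠ 0 → w (i + 1) = u (-2 - i + 1)) →
      encStep ℓ (enc false χ κ 0 0 (cells u 0)) = enc true (!χ) κ' 0 0 (cells w 0) := by
    rintro χ κ _ u w huw rfl h
    have e := map_range_congr hm h
    rw [cells_zero_cons hm u, cells_zero_cons hm w, e,
      ← map_range_reverse hm (fun i => u (i + 1))]
    rcases huw with ⟨hu, hw⟩ | ⟨hu, hw⟩ <;> rw [hu, hw]
    · exact encStep_hollow_zero χ κ _ (by simp [hm])
    · exact encStep_hollow_one χ κ _ (by simp [hm])
  have two : ∀ (χ : Bool) (κ κ' : ZMod ℓ) (u w : ZMod ℓ → Fin 3), u 0 = 2 → w (-1) = 0 → κ = κ' →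
      (∀ i, i + 1 ≠ 0 → w i = u (-2 - i + 1)) →
      encStep ℓ (enc false χ κ 0 0 (cells u 0)) = enc false (!χ) κ' 0 0 (cells w 0) := by
    rintro χ κ _ u w hu hw rfl h
    have e := map_range_congr hm h
    rw [cells_zero_cons hm u, cells_zero_concat hm w, e,
      ← map_range_reverse hm (fun i => u (i + 1)), hu, hw]
    exact encStep_hollow_two χ κ _ (by simp [hm])
  have upd : ∀ (c j : ZMod ℓ) (b : Fin 3), j ≠ c → Function.update v c b j = v j :=
    fun c j b h => Function.update_of_ne h _ _
  have upd' : ∀ (c j : ZMod ℓ) (b : Fin 3), j = c → Function.update v c b j = b := by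
    rintro c _ b rfl
    simp
  have upself : ∀ (c : ZMod ℓ) (b : Fin 3), v c = b → Function.update v c b = v := by
    rintro c _ rfl
    exact Function.update_eq_self c v
  have three : ∀ a : Fin 3, a = 0 ∨ a = 1 ∨ a = 2 := by decide
  rcases τ with _ | _ | _ | _
  · rcases three (v 1) with h | h | h <;>
      simp only [macroView, normMap, Triangle.toPair, Dir.val, Int.cast_one, h, smartWrite,
        triangle, Dir.rev, if_true, Triangle.typ, Triangle.chi]
    · refine last false _ _ _ _ (by simpa using h) (upd' _ _ _ (by ring)) rfl fun i hi => ?_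
      rw [upd _ _ _ fun h => hi (by linear_combination h)]
      congr 1
      ring
    all_goals
      refine same false _ _ _ _ (by simp [h]) rfl fun i => ?_
      rw [upself _ _ h]
      congr 1
      ring
  · rcases three (v (-1)) with h | h | h <;>
      simp only [macroView, normMap, Triangle.toPair, Dir.val, Int.cast_neg, Int.cast_one, h,
        smartWrite, triangle, Dir.rev, if_true, Triangle.typ, Triangle.chi]
    · refine last true _ _ _ _ h (upd' _ _ _ (by ring)) (by ring) fun i hi => ?_
      rw [upd _ _ _ fun h => hi (by linear_combination -h)]
      congr 1
      ring
    all_goals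
      refine same true _ _ _ _ (by simp [h]) (by ring) fun i => ?_
      rw [upself _ _ h]
      congr 1
      ring
  · rcases three (v 1) with h | h | h <;>
      simp only [macroView, normMap, Triangle.toPair, Dir.val, Int.cast_one, h, smartWrite,
        triangle, Dir.rev, if_true, Triangle.typ, Triangle.chi]
    · refine first true _ _ _ _ (.inl ⟨by simpa using h, upd' _ _ _ (by ring)⟩) (by simp [sg])
        fun i hi => ?_
      rw [upd _ _ _ fun h => hi (by linear_combination -h)]
      congr 1
      ring
    · refine first true _ _ _ _ (.inr ⟨by simpa using h, upd' _ _ _ (by ring)⟩) (by simp [sg])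
        fun i hi => ?_
      rw [upd _ _ _ fun h => hi (by linear_combination -h)]
      congr 1
      ring
    · refine two true _ _ _ _ (by simpa using h) (upd' _ _ _ (by ring)) rfl fun i hi => ?_
      rw [upd _ _ _ fun h => hi (by linear_combination -h)]
      congr 1
      ring
  · rcases three (v (-1)) with h | h | h <;>
      simp only [macroView, normMap, Triangle.toPair, Dir.val, Int.cast_neg, Int.cast_one, h,
        smartWrite, triangle, Dir.rev, if_true, Triangle.typ, Triangle.chi]
    · refine first false _ _ _ _ (.inl ⟨by simpa using h, upd' _ _ _ (by ring)⟩) (by simp [sg])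
        fun i hi => ?_
      rw [upd _ _ _ fun h => hi (by linear_combination h)]
      congr 1
      ring
    · refine first false _ _ _ _ (.inr ⟨by simpa using h, upd' _ _ _ (by ring)⟩) (by simp [sg])
        fun i hi => ?_
      rw [upd _ _ _ fun h => hi (by linear_combination h)]
      congr 1
      ring
    · refine two false _ _ _ _ (by simpa using h) (upd' _ _ _ (by ring)) (by ring) fun i hi => ?_
      rw [upd _ _ _ fun h => hi (by linear_combination h)]
      congr 1
      ring

end

end TM

namespace TM

/-! ## The powers of SMART on cyclic tapes -/

theorem Machine.Reversible.action_eq {P Q Γ : Type} [Ring P] [Nontrivial P] {M : Machine Q Γ}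
    (hM : M.Reversible) {x y : Tape P Q Γ} (h : M.Step x y) : hM.action x = y :=
  M.step_unique hM.1 (M.step_exists hM.1 x).choose_spec h

/-- One step of SMART. -/
def stepView {ℓ : ℕ} (x : View ℓ) : View ℓ :=
  match x.1.1.2 with
  | .two => (((x.1.1.1, .one), x.1.2), fun j => x.2.1 (j + (x.1.1.1.toPair.2.val : ℤ)),
      x.2.2 + (x.1.1.1.toPair.2.val : ℤ))
  | .one => (((triangle (smartWrite x.1.1.1.toPair (x.2.1 0)).1, .two), x.1.2),
      Function.update x.2.1 0 (smartWrite x.1.1.1.toPair (x.2.1 0)).2, x.2.2)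

theorem triangle_toPair_triangle (s : Bool × Dir) : (triangle s).toPair = s := by
  obtain ⟨_ | _, _ | _⟩ := s <;> rfl

theorem stepView_stepView {ℓ : ℕ} (x : View ℓ) (hx : x.1.1.2 = .two) :
    stepView (stepView x) = macroView x := by
  obtain ⟨⟨⟨τ, ι⟩, d⟩, v, p⟩ := x
  obtain rfl : ι = .two := hx
  simp only [stepView, macroView, if_true, zero_add, Prod.mk.injEq, true_and, and_true]
  funext j
  by_cases h : j = 0
  · subst h
    simp
  · rw [Function.update_of_ne h, Function.update_of_ne]
    intro h'
    exact h (by linear_combination h')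

theorem index_stepView {ℓ : ℕ} (x : View ℓ) : (stepView x).1.1.2 ≠ x.1.1.2 := by
  obtain ⟨⟨⟨τ, _ | _⟩, d⟩, v, p⟩ := x <;> simp [stepView]

theorem index_macroView_iterate {ℓ : ℕ} (m : ℕ) (x : View ℓ) : (macroView^[m] x).1.1.2 = x.1.1.2 := by
  induction m with
  | zero => rfl
  | succ m ih =>
    rw [Function.iterate_succ_apply', ← ih]
    generalize macroView^[m] x = y
    unfold macroView
    split_ifs with h
    · exact h.symm
    · rfl

theorem macroView_iterate_of_two {ℓ : ℕ} (m : ℕ) (x : View ℓ) (hx : x.1.1.2 = .two) :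
    macroView^[m] x = stepView^[2 * m] x := by
  induction m with
  | zero => rfl
  | succ m ih =>
    have h := (index_macroView_iterate m x).trans hx
    rw [Function.iterate_succ_apply', show 2 * (m + 1) = 2 * m + 1 + 1 by ring,
      Function.iterate_succ_apply', Function.iterate_succ_apply', ← ih, stepView_stepView _ h]

theorem macroView_iterate_of_one {ℓ : ℕ} (m : ℕ) (x : View ℓ) (hx : x.1.1.2 = .one) :
    macroView^[m] x = x :=
  Function.iterate_fixed (by rw [macroView, if_neg (by rw [hx]; simp)]) m

section

variable {ℓ : ℕ} [Fact (1 < ℓ)]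

theorem action_toTape (x : View ℓ) :
    decoratedSmart_reversible.action x.toTape = (stepView x).toTape := by
  refine decoratedSmart_reversible.action_eq ?_
  obtain ⟨⟨⟨τ, ι⟩, d⟩, v, p⟩ := x
  obtain ⟨s, rfl⟩ := triangle_surjective τ
  rcases ι with _ | _
  · have e : stepView (((triangle s, .one), d), v, p) =
        ((((triangle (smartWrite s (v 0)).1, .two), d), Function.update v 0 (smartWrite s (v 0)).2,
          p) : View ℓ) := by
      simp only [stepView, triangle_toPair_triangle]
    have h := step_write s d (fun i => v (i - p)) p
    have e' : (fun i => Function.update v 0 (smartWrite s (v 0)).2 (i - p)) =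
        Function.update (fun i => v (i - p)) p (smartWrite s (v 0)).2 := by
      funext j
      by_cases h : j = p
      · subst h
        simp
      · rw [Function.update_of_ne h, Function.update_of_ne (sub_ne_zero.2 h)]
    rw [e]
    change decoratedSmart.Step _ (Conf.toTape (_, _, _)) at h ⊢
    simp only [sub_self] at h
    rw [e']
    exact h
  · have e : stepView (((triangle s, .two), d), v, p) =
        ((((triangle s, .one), d), fun j => v (j + (s.2.val : ℤ)), p + (s.2.val : ℤ)) :
          View ℓ) := by
      simp only [stepView, triangle_toPair_triangle]
    have h := step_move s d (fun i => v (i - p)) p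
    have e' : (fun i => v (i - (p + ((s.2.val : ℤ) : ZMod ℓ)) + (s.2.val : ℤ))) =
        fun i => v (i - p) := by
      funext j
      congr 1
      ring
    rw [e]
    change decoratedSmart.Step _ (Conf.toTape (_, _, _)) at h ⊢
    rw [e']
    exact h

theorem realizes_action : Realizes (ℓ := ℓ) decoratedSmart_reversible.action stepView :=
  ⟨action_toTape, fun _ hx => decoratedSmart_reversible.action_eq (.inl ⟨hx, rfl⟩)⟩

theorem Realizes.pow {g : Equiv.Perm (Tape (ZMod ℓ) DecState (Fin 3))} {f : View ℓ → View ℓ}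
    (hg : Realizes g f) (n : ℕ) : Realizes (g ^ n) f^[n] := by
  induction n with
  | zero => exact ⟨fun _ => rfl, fun _ _ => rfl⟩
  | succ n ih =>
    rw [pow_succ', Function.iterate_succ']
    exact hg.mul ih

/-- The writing transitions of SMART, with the change of the index in the other states. -/
noncomputable def writePerm : Equiv.Perm (SmartState × Fin 3) := Equiv.ofBijective
  (fun x => match x.1.2 with
    | .two => ((x.1.1, .one), x.2)
    | .one => ((triangle (smartWrite x.1.1.toPair x.2).1, .two), (smartWrite x.1.1.toPair x.2).2))
  (Finite.injective_iff_bijective.1 (by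
    have : ∀ s s' a a', smartWrite s a = smartWrite s' a' → s = s' ∧ a = a' := by
      rintro ⟨_ | _, _ | _⟩ ⟨_ | _, _ | _⟩ a a' <;> fin_cases a <;> fin_cases a' <;>
        simp [smartWrite, Dir.rev]
    have ht : ∀ s s', triangle s = triangle s' → s = s' := fun s s' h => by
      rw [← triangle_toPair_triangle s, h, triangle_toPair_triangle]
    rintro ⟨⟨τ, _ | _⟩, a⟩ ⟨⟨τ', _ | _⟩, a'⟩ h
    · simp only [Prod.mk.injEq, and_true] at h
      obtain ⟨h1, h2⟩ := this _ _ _ _ (Prod.ext (ht _ _ h.1) h.2)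
      rw [← triangle_toPair τ, h1, triangle_toPair, h2]
    · simp at h
    · simp at h
    · simp only [Prod.mk.injEq, and_true] at h
      rw [h.1, h.2]))

/-- Heads of index two first move right or left, and a single gate then writes in index one and
lowers the index otherwise. Two sets of at most 96 states and one gate give `193`. -/
theorem costLE_stepView : CostLE (stepView (ℓ := ℓ)) 193 := by
  let A : Finset DecState := Finset.univ.filter fun q => q.1.2 = .two ∧ q.1.1.toPair.2.val = 1
  let B : Finset DecState := Finset.univ.filter fun q => q.1.2 = .two ∧ q.1.1.toPair.2.val = -1
  have hA : ∀ q, q ∈ A ↔ q.1.2 = .two ∧ q.1.1.toPair.2.val = 1 := by simp [A]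
  have hB : ∀ q, q ∈ B ↔ q.1.2 = .two ∧ q.1.1.toPair.2.val = -1 := by simp [B]
  have c1 := costLE_moveIn (ℓ := ℓ) A
  have c2 : CostLE (fun c : View ℓ => if c.1 ∈ B then (c.1, fun j => c.2.1 (j - 1), c.2.2 - 1)
      else c) B.card := (costLE_moveIn B).inv fun c => by
    by_cases h : c.1 ∈ B <;> simp [moveIn, h]
  have c3 := costLE_gateAt_zero (ℓ := ℓ) (liftGate writePerm)
  convert (c3.comp (c2.comp c1)).mono (m := 193) ?_ using 1
  · funext x
    obtain ⟨⟨⟨τ, ι⟩, d⟩, v, p⟩ := x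
    have e : ∀ (τ : Triangle) (ι : Index) (a : Fin 3), liftGate writePerm (((τ, ι), d), a) =
      (((writePerm ((τ, ι), a)).1, d), (writePerm ((τ, ι), a)).2) := fun _ _ _ => rfl
    have e1 : ∀ (τ : Triangle) (a : Fin 3), writePerm ((τ, .one), a) =
        ((triangle (smartWrite τ.toPair a).1, .two), (smartWrite τ.toPair a).2) := fun _ _ => rfl
    have e2 : ∀ (τ : Triangle) (a : Fin 3), writePerm ((τ, .two), a) = ((τ, .one), a) :=
      fun _ _ => rfl
    rcases ι with _ | _
    · simp [gateAt, moveIn, hA, hB, e, e1, stepView]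
    · cases τ <;> simp [gateAt, moveIn, hA, hB, e, e2, stepView, Triangle.toPair, Dir.val,
        sub_eq_add_neg]
  · have := card_le_96 A
    have := card_le_96 B
    omega

/-- A map with a cost is realized by a permutation, so `f` is the conjugate of `h` by `e` without a
separate proof that `e` is bijective. -/
theorem CostLE.of_semiconj {e f h : View ℓ → View ℓ} {a b : ℕ} (he : CostLE e a)
    (hh : CostLE h b) (H : ∀ c, e (f c) = h (e c)) : CostLE f (2 * a + b) := by
  obtain ⟨g, hg, hw⟩ := he
  obtain ⟨k, hk, hw'⟩ := hh
  refine ⟨g⁻¹ * k * g, ⟨fun c => ?_, fun x hx => ?_⟩, ?_⟩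
  · rw [Equiv.Perm.mul_apply, Equiv.Perm.mul_apply, hg.1, hk.1, ← H, ← hg.1,
      ← Equiv.Perm.mul_apply, inv_mul_cancel, Equiv.Perm.one_apply]
  · rw [Equiv.Perm.mul_apply, Equiv.Perm.mul_apply, hg.2 x hx, hk.2 x hx,
      Equiv.Perm.inv_eq_iff_eq, hg.2 x hx]
  · obtain ⟨w, h1, h2, h3⟩ := (hw.inv.mul hw').mul hw
    exact ⟨w, h1, h2, by omega⟩

theorem costLE_normMap : CostLE (normMap (ℓ := ℓ)) (gateConst * 10000 * ℓ ^ 4) := by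
  let A : Finset DecState := Finset.univ.filter fun q =>
    q.1.1 = .filledRight ∨ q.1.1 = .hollowRight
  let B : Finset SmartState := Finset.univ.filter fun q => q.1.chi = false
  have hA : ∀ q, q ∈ A ↔ q.1.1 = .filledRight ∨ q.1.1 = .hollowRight := by simp [A]
  have hB : ∀ q, q ∈ B ↔ q.1.chi = false := by simp [B]
  have c1 := costLE_moveIn (ℓ := ℓ) A
  have c2 := (predCost_true (ℓ := ℓ)).condPerm (Equiv.subLeft (-1)) (indepOf_true _) B
  convert (c2.comp c1).mono (m := gateConst * 10000 * ℓ ^ 4) ?_ using 1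
  · funext x
    obtain ⟨⟨⟨τ, ι⟩, d⟩, v, p⟩ := x
    cases τ <;> simp [normMap, moveIn, condPerm, hA, hB, Triangle.chi, Function.comp_def]
    funext j
    congr 1
    ring
  · obtain ⟨h1, h2, h3, h4⟩ := pow_le_pow_four (ℓ := ℓ)
    have h5 := card_le_96 A
    calc _ ≤ gateConst * (2400 * (1 + ℓ)) * ℓ + gateConst * 96 := by
          refine Nat.add_le_add_left (h5.trans ?_) _
          exact Nat.le_mul_of_pos_left _ gateConst_pos
      _ = gateConst * (2400 * ℓ ^ 2 + 2400 * ℓ + 96) := by ring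
      _ ≤ gateConst * (10000 * ℓ ^ 4) := Nat.mul_le_mul_left _ (by omega)
      _ = _ := by ring

/-- The computation of the counter conjugates the macro step to `incMap 1`, hence its `m`-th power
to `incMap m`. The `ℓ` stages of cost `O(ℓ ^ 3)` dominate. -/
theorem costLE_macroView_iterate (m : ℕ) :
    CostLE (macroView (ℓ := ℓ))^[m] (gateConst * 3000000 * ℓ ^ 4) := by
  have : NeZero ℓ := ⟨by have := Fact.out (p := 1 < ℓ); omega⟩
  obtain ⟨f, hf, h⟩ := exists_stages (ℓ := ℓ) ℓ le_rfl
  let e : View ℓ → View ℓ := fun x => finMap (f (normMap x))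
  have he : CostLE e _ := (costLE_finMap.comp hf).comp costLE_normMap
  have key : ∀ x, e (macroView x) = incMap 1 (e x) := by
    intro x
    by_cases hx : x.1.1.2 = .two
    · refine (incMap_finMap ?_ ?_ ?_ ?_).symm
      · rw [(h _).2.1, normMap_fst, hx]
      · rw [(h _).2.1, normMap_fst, macroView, if_pos hx]
      · rw [(h _).2.2, (h _).2.2, normMap_fst, normMap_fst, macroView, if_pos hx]
      · rw [(h _).1, (h _).1, encStep_dec_normMap x hx]
    · rw [macroView, if_neg hx, incMap, if_neg]
      change (f (normMap x)).1.1.2 ≠ _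
      rwa [(h _).2.1, normMap_fst]
  have key' : ∀ x, e (macroView^[m] x) = incMap m (e x) := by
    intro x
    rw [← incMap_iterate]
    exact Function.Semiconj.iterate_right (f := e) key m x
  refine (he.of_semiconj (costLE_incMap m) key').mono (le_of_eq_of_le (b := gateConst * 2320000 * ℓ ^ 4) (by ring) ?_)
  gcongr
  norm_num

theorem wordLE_action_pow_of_macro {b : ℕ} (n : ℕ)
    (hb : CostLE (macroView (ℓ := ℓ))^[n / 2] b) : WordLE
    ((decoratedSmart_reversible.action : Equiv.Perm (Tape (ZMod ℓ) DecState (Fin 3))) ^ n)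
    (2 * b + 579) := by
  set T : Equiv.Perm (Tape (ZMod ℓ) DecState (Fin 3)) := decoratedSmart_reversible.action with hT
  have hr : Realizes T stepView := realizes_action
  obtain ⟨T', hr', hw⟩ := costLE_stepView (ℓ := ℓ)
  rw [hr'.eq hr] at hw
  obtain ⟨F, hF, hFw⟩ := hb
  -- Here `F` is the required power on index two and the identity on index one. As `T` exchanges the
  -- indices, `T * F * T⁻¹` is the required power on index one and the identity on index two.
  have key : T ^ (2 * (n / 2)) = T * F * T⁻¹ * F := by
    have two : ∀ x : View ℓ, x.1.1.2 = .two → F x.toTape = (T ^ (2 * (n / 2))) x.toTape := by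
      intro x hx
      rw [hF.1, macroView_iterate_of_two _ _ hx, (hr.pow _).1]
    have one : ∀ x : View ℓ, x.1.1.2 = .one → F x.toTape = x.toTape := by
      intro x hx
      rw [hF.1, macroView_iterate_of_one _ _ hx]
    have pre : ∀ x : View ℓ, ∃ y : View ℓ, T⁻¹ x.toTape = y.toTape ∧ stepView y = x := by
      intro x
      by_cases hy : ∃ i, (T⁻¹ x.toTape).HeadAt i
      · obtain ⟨i, hi⟩ := hy
        obtain ⟨y, hy⟩ := Tape.exists_view _ hi
        refine ⟨y, hy.symm, View.toTape_injective ?_⟩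
        rw [← hr.1, hy, ← Equiv.Perm.mul_apply, mul_inv_cancel, Equiv.Perm.one_apply]
      · push Not at hy
        have h1 := hr.2 _ hy
        rw [← Equiv.Perm.mul_apply, mul_inv_cancel, Equiv.Perm.one_apply] at h1
        rw [← h1] at hy
        exact absurd ((Conf.headAt_toTape _ _).2 rfl) (hy x.2.2)
    ext1 z
    by_cases hz : ∃ i, z.HeadAt i
    · obtain ⟨i, hi⟩ := hz
      obtain ⟨x, rfl⟩ := z.exists_view hi
      simp only [Equiv.Perm.mul_apply]
      rcases hx : x.1.1.2 with _ | _
      · rw [one x hx]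
        obtain ⟨y, hy, hyx⟩ := pre x
        have hy2 : y.1.1.2 = .two := by
          have := index_stepView y
          rw [hyx, hx] at this
          rcases h : y.1.1.2 with _ | _
          · exact absurd h.symm this
          · rfl
        rw [hy, two y hy2, ← hy, ← Equiv.Perm.mul_apply, ← Equiv.Perm.mul_apply,
          (Commute.refl T).pow_right _ |>.eq, mul_assoc, mul_inv_cancel, mul_one]
      · rw [two x hx, (hr.pow _).1, ← macroView_iterate_of_two _ _ hx]
        have hi := (index_macroView_iterate (n / 2) x).trans hx
        generalize macroView^[n / 2] x = z at *
        obtain ⟨y, hy, hyz⟩ := pre z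
        have hy2 : y.1.1.2 = .one := by
          have := index_stepView y
          rw [hyz, hi] at this
          rcases h : y.1.1.2 with _ | _
          · rfl
          · exact absurd h.symm this
        rw [hy, one y hy2, hr.1, hyz]
    · push Not at hz
      have h1 : T⁻¹ z = z := by rw [Equiv.Perm.inv_eq_iff_eq, hr.2 z hz]
      simp only [Equiv.Perm.mul_apply, hF.2 z hz, h1, hr.2 z hz, (hr.pow _).2 z hz]
  have hodd : WordLE (T ^ (n % 2)) 193 := by
    rcases Nat.mod_two_eq_zero_or_one n with h | h <;> rw [h]
    · exact ⟨[], by simp, by simp, by simp⟩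
    · rwa [pow_one]
  have hn : T ^ n = T ^ (n % 2) * (T * F * T⁻¹ * F) := by
    rw [← key, ← pow_add, Nat.mod_add_div]
  rw [hn]
  obtain ⟨w, h1, h2, h3⟩ := hodd.mul (((hw.mul hFw).mul hw.inv).mul hFw)
  exact ⟨w, h1, h2, by omega⟩

theorem wordLE_action_pow (n : ℕ) : WordLE
    ((decoratedSmart_reversible.action : Equiv.Perm (Tape (ZMod ℓ) DecState (Fin 3))) ^ n)
    (gateConst * 7000000 * ℓ ^ 4) := by
  obtain ⟨w, h1, h2, h3⟩ := wordLE_action_pow_of_macro n (costLE_macroView_iterate (ℓ := ℓ) (n / 2))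
  refine ⟨w, h1, h2, le_trans h3 ?_⟩
  obtain ⟨h4, -, -, -⟩ := pow_le_pow_four (ℓ := ℓ)
  calc 2 * (gateConst * 3000000 * ℓ ^ 4) + 579
      ≤ 2 * (gateConst * 3000000 * ℓ ^ 4) + gateConst * 579 * ℓ ^ 4 :=
        Nat.add_le_add_left (le_gateConst_mul 579 (Nat.le_mul_of_pos_right _ h4)) _
    _ = gateConst * 6000579 * ℓ ^ 4 := by ring
    _ ≤ gateConst * 7000000 * ℓ ^ 4 := by
        gcongr
        norm_num

end

end TM

theorem mainTheorem2 :
    -- the automorphism defined by the decorated SMART machine has infinite order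
    ¬ IsOfFinOrder TM.decoratedSmart_reversible.beltAction ∧
    -- its movement function is at most `(ln 2 / ln 3) * log₂ n + C'`
    (∃ C' : ℝ, 0 < C' ∧ ∀ n : ℕ, 1 ≤ n →
      (TM.decoratedSmart.movement n : ℝ) ≤
        Real.log 2 / Real.log 3 * Real.logb 2 n + C') ∧
    -- on cyclic tapes of length `ℓ`, all its powers have word norm `O(ℓ⁴)`
    (∃ K : ℝ, ∀ (ℓ : ℕ) [Fact (1 < ℓ)] (n : ℕ),
      TM.decoratedSmart_reversible.action ^ n ∈
        TM.cyclicGroup ℓ TM.DecState (Fin 3) ∧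
      (TM.wordNorm (TM.instructions (ZMod ℓ) TM.DecState (Fin 3))
        (TM.decoratedSmart_reversible.action ^ n) : ℝ) ≤ K * (ℓ : ℝ) ^ 4) :=
  ⟨TM.beltAction_not_isOfFinOrder, ⟨12, by norm_num, fun n _ => TM.decoratedSmart_movement_bound n⟩,
    ((TM.gateConst * 7000000 : ℕ) : ℝ), fun ℓ _ n =>
      ⟨(TM.wordLE_action_pow n).mem_cyclicGroup,
        by exact_mod_cast (TM.wordLE_action_pow (ℓ := ℓ) n).wordNorm_le⟩⟩
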